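/- Let $\theta>0$, $\mu_0,\lambda\in\mathbb R$ and $\omega=2\pi/\theta$. Let $\mathcal H_B=L^2_{hol}(\mathbb C^2,d\mu)$, $d\mu(z)=(\omega/\pi)^2e^{-\omega|z|^2}d\,\mathrm{Re}\,z\,d\,\mathrm{Im}\,z$, be the Bargmann space, let $(T_v\phi)(z)=e^{-\frac{\omega}{2}|v|^2-\omega\bar v\cdot z}\phi(z+v)$ for $v\in\mathbb C^2$, and let $\phi U_\gamma:=T_\gamma\phi$ for $\gamma$ in the lattice $\Gamma=\{\frac{\theta}{\sqrt2}(m+in):m,n\in\mathbb Z^2\}$; this is the right action of the algebra $\mathcal A_\theta$ of the 4-dimensional noncommutative torus. The Heisenberg module $\mathcal E_B(\mathbb C^2)\subset\mathcal H_B$ is the image of $\mathcal S(\mathbb R^2)$ under the unitary Bargmann transform $$(Bf)(z)=\Big(\frac{\omega}{\pi}\Big)^{1/2}\int_{\mathbb R^2}e^{-\frac{\omega}{2}(x^2+z^2)+\sqrt2\,\omega\, z\cdot x}f(x)\,dx ,$$ with the hermitian form $(\chi,\phi)_{\mathcal A}=\sum_{\gamma\in\Gamma}\langle\chi,\phi U_\gamma\rangle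 U_{-\gamma}$. Consider the $\phi^4$ theory with action $S=\langle\phi,H\phi\rangle+\frac\lambda2\mathrm{Tr}_{\mathcal A}[(\phi,\phi)_{\mathcal A}^2]$, where $H=2\omega(z\cdot\partial_z+1)+\mu_0^2$, $\mathrm{Tr}_{\mathcal A}[\sum_\gamma a_\gamma U_\gamma]=a_0$, and $\phi$ and its conjugate are treated as independent fields. For $\epsilon\ge0$ put $H_\epsilon^{-1}=\int_\epsilon^\infty e^{-\beta H}d\beta$, so that $H_0^{-1}=H^{-1}$. For $\varphi,\chi\in\mathcal E_B(\mathbb C^2)$ let $B_{\varphi,\bar\chi}$ be the Hessian of $\frac12\mathrm{Tr}_{\mathcal A}[(\phi,\phi)^2_{\mathcal A}]$ at the background $(\varphi,\bar\chi)$, acting on fluctuations in $\mathcal H_B\oplus\overline{\mathcal H_B}$: $$B_{\varphi,\bar\chi}(\eta,\bar\zeta)=\big(\eta(\chi,\varphi)_{\mathcal A}+\varphi(\chi,\eta)_{\mathcal A}+\varphi(\zeta,\varphi)_{\mathcal A},\ \overline{\zeta(\varphi,\chi)_{\mathcal A}+\chi(\varphi,\zeta)_{\mathcal A}+\chi(\eta,\chi)_{\mathcal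 A}}\,\big).$$ The part of degree $2N$ of the (regularized) one-loop 1PI effective action $\frac12\ln\det(1+\lambda H_\epsilon^{-1}B_{\varphi,\bar\chi})$ is $$\Gamma^{(1)}_{2N,\epsilon}[\varphi,\bar\chi]=\frac12\,\frac{(-1)^{N+1}\lambda^N}{N}\,\mathrm{Tr}\big((H_\epsilon^{-1}B_{\varphi,\bar\chi})^N\big),$$ and the one-loop $2N$-point 1PI Green's function $G_{2N,\epsilon}(\varphi_1,\dots,\varphi_N;\bar\chi_1,\dots,\bar\chi_N)$ is the coefficient of $s_1\cdots s_Nt_1\cdots t_N$ in $\Gamma^{(1)}_{2N,\epsilon}[\sum_is_i\varphi_i,\sum_jt_j\bar\chi_j]$. Proposition. For $N>2$ the one-loop $2N$-point 1PI Green's function is finite as a tempered distribution. That is: the series over $\Gamma$ defining $B_{\varphi,\bar\chi}$ converge unconditionally in $\mathcal H_B$ for all $\varphi,\chi\in\mathcal E_B(\mathbb C^2)$ and all fluctuations; the diagonal blocks of $(H_\epsilon^{-1}B_{\varphi,\bar\chi})^N$ are of trace class for every $\epsilon\ge0$, including $\epsilon=0$; for every $\epsilon\geq 0$ there is a tempered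 distribution $G_{2N,\epsilon}\in\mathcal S'(\mathbb R^{4N})=\mathcal S'((\mathbb R^2)^{2N})$ with $$G_{2N,\epsilon}(f_1\otimes\cdots\otimes f_N\otimes g_1\otimes\cdots\otimes g_N)=G_{2N,\epsilon}\big(Bf_1,\dots,Bf_N;\overline{B\bar g_1},\dots,\overline{B\bar g_N}\big)\qquad(f_i,g_j\in\mathcal S(\mathbb R^2));$$ and $G_{2N,\epsilon}\to G_{2N,0}$ in $\mathcal S'(\mathbb R^{4N})$ as $\epsilon\to0^+$. -/

import Mathlib

open scoped SchwartzMap ComplexConjugate InnerProductSpace Topology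
open MeasureTheory Filter

noncomputable section

namespace HeisenbergPhi4

/-! ### The Bargmann space of square integrable entire functions on `ℂ²` -/

/-- The oscillator frequency `ω = 2π/θ`. -/
def freq (θ : ℝ) : ℝ := 2 * Real.pi / θ

/-- The Gaussian probability measure `(ω/π)² exp(-ω|z|²) d Re z d Im z` on `ℂ²`. -/
def gaussMeasure (θ : ℝ) : Measure (Fin 2 → ℂ) :=
  volume.withDensity fun z =>
    ENNReal.ofReal ((freq θ / Real.pi) ^ 2 * Real.exp (-(freq θ) * ∑ i, ‖z i‖ ^ 2))

/-- The Bargmann space `H_B = L²_hol(ℂ², dμ)`: the classes in `L²(ℂ², dμ)` that have an entire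
representative, with the inner product of `L²` (antilinear in the first argument). -/
def BargmannSpace (θ : ℝ) : Submodule ℂ (Lp ℂ 2 (gaussMeasure θ)) where
  carrier := {f | ∃ g : (Fin 2 → ℂ) → ℂ, Differentiable ℂ g ∧ f =ᵐ[gaussMeasure θ] g}
  zero_mem' := ⟨0, differentiable_const 0, Lp.coeFn_zero _ _ _⟩
  add_mem' := by
    rintro f₁ f₂ ⟨g₁, h₁, e₁⟩ ⟨g₂, h₂, e₂⟩
    exact ⟨g₁ + g₂, h₁.add h₂, (Lp.coeFn_add f₁ f₂).trans (e₁.add e₂)⟩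
  smul_mem' := by
    rintro c f ⟨g, h, e⟩
    exact ⟨c • g, h.const_smul c, (Lp.coeFn_smul c f).trans (e.const_smul c)⟩

/-- The entire function that represents an element of the Bargmann space. -/
def toFun {θ : ℝ} (φ : BargmannSpace θ) : (Fin 2 → ℂ) → ℂ := φ.2.choose

open Classical in
/-- The element of the Bargmann space given by an entire square integrable function. (The value
`0` for other functions is a convention that is never used: all functions inserted below are entire
and square integrable.) -/
def ofFun (θ : ℝ) (g : (Fin 2 → ℂ) → ℂ) : BargmannSpace θ :=
  if h : Differentiable ℂ g ∧ MemLp g 2 (gaussMeasure θ) then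
    ⟨h.2.toLp g, g, h.1, h.2.coeFn_toLp⟩
  else 0

/-- The normalized monomials `(ω^{n₀+n₁}/(n₀! n₁!))^{1/2} z₀^{n₀} z₁^{n₁}`, which form an orthonormal
basis of the Bargmann space. -/
def monomialState (θ : ℝ) (n : ℕ × ℕ) : BargmannSpace θ :=
  ofFun θ fun z =>
    (Real.sqrt (freq θ ^ (n.1 + n.2) / (n.1.factorial * n.2.factorial : ℝ)) : ℂ) *
      (z 0 ^ n.1 * z 1 ^ n.2)

/-! ### Trace class operators -/

/-- `T` is a trace class (nuclear) operator: `T η = ∑ₙ ⟨xₙ, η⟩ yₙ` with `∑ₙ ‖xₙ‖ ‖yₙ‖ < ∞`. -/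
def IsTraceClass {θ : ℝ} (T : BargmannSpace θ → BargmannSpace θ) : Prop :=
  ∃ x y : ℕ → BargmannSpace θ, (Summable fun n => ‖x n‖ * ‖y n‖) ∧
    ∀ η, HasSum (fun n => ⟪x n, η⟫_ℂ • y n) (T η)

/-- The operator trace, evaluated in the orthonormal basis of normalized monomials. -/
def opTrace {θ : ℝ} (T : BargmannSpace θ → BargmannSpace θ) : ℂ :=
  ∑' n : ℕ × ℕ, ⟪monomialState θ n, T (monomialState θ n)⟫_ℂ

/-! ### The Heisenberg module over the four-dimensional noncommutative torus -/

/-- The index group `ℤ⁴` of the lattice. -/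
abbrev Lattice : Type := (Fin 2 → ℤ) × (Fin 2 → ℤ)

/-- The lattice `Γ = {(θ/√2)(m + i n)} ⊂ ℂ²`. -/
def latticePoint (θ : ℝ) (γ : Lattice) : Fin 2 → ℂ := fun i =>
  ((θ / Real.sqrt 2 : ℝ) : ℂ) * ((γ.1 i : ℂ) + (γ.2 i : ℂ) * Complex.I)

/-- The projective unitary representation of `ℂ²`:
`(T_v φ)(z) = exp(-ω|v|²/2 - ω v̄·z) φ(z + v)`. -/
def translation (θ : ℝ) (v : Fin 2 → ℂ) (φ : BargmannSpace θ) : BargmannSpace θ :=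
  ofFun θ fun z =>
    Complex.exp (-((freq θ / 2 * ∑ i, ‖v i‖ ^ 2 : ℝ) : ℂ) - (freq θ : ℂ) * ∑ i, conj (v i) * z i) *
      toFun φ (z + v)

/-- The right action of the generator `U_γ` of the torus algebra: `φ U_γ = T_γ φ`. -/
def actU {θ : ℝ} (φ : BargmannSpace θ) (γ : Lattice) : BargmannSpace θ :=
  translation θ (latticePoint θ γ) φ

/-- The right action `φ a = ∑_γ a_γ φ U_γ` of `a = ∑_γ a_γ U_γ`. -/
def act {θ : ℝ} (φ : BargmannSpace θ) (a : Lattice → ℂ) : BargmannSpace θ :=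
  ∑' γ, a γ • actU φ γ

/-- The coefficients of the algebra valued hermitian form
`(χ, φ)_A = ∑_γ ⟨χ, φ U_γ⟩ U_{-γ}`. -/
def pairing {θ : ℝ} (χ φ : BargmannSpace θ) : Lattice → ℂ := fun γ => ⟪χ, actU φ (-γ)⟫_ℂ

/-- The Bargmann transform `L²(ℝ²) → H_B`,
`(B f)(z) = (ω/π)^{1/2} ∫ exp(-ω(x² + z²)/2 + √2 ω z·x) f(x) dx`
(on `ℝ²` this is the normalization that makes it unitary). -/
def bargmann (θ : ℝ) (f : (Fin 2 → ℝ) → ℂ) : BargmannSpace θ :=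
  ofFun θ fun z => (Real.sqrt (freq θ / Real.pi) : ℂ) *
    ∫ x : Fin 2 → ℝ,
      Complex.exp (-((freq θ : ℂ) / 2) * ∑ i, ((x i : ℂ) ^ 2 + z i ^ 2) +
        (Real.sqrt 2 : ℂ) * (freq θ : ℂ) * ∑ i, z i * (x i : ℂ)) * f x

/-- The smooth Heisenberg module `E_B(ℂ²)`: the image of the Schwartz space `𝓢(ℝ²)` under the
Bargmann transform. -/
def smoothModule (θ : ℝ) : Set (BargmannSpace θ) :=
  Set.range fun f : 𝓢(Fin 2 → ℝ, ℂ) => bargmann θ f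

/-! ### The propagator -/

/-- The kinetic operator on entire functions, `H = 2ω(z·∂_z + 1) + μ₀²`: the image under the
Bargmann transform of the harmonic oscillator Hamiltonian `-Δ + ω²x² + μ₀²` on `ℝ²`. -/
def oscillator (θ μ₀ : ℝ) (φ : (Fin 2 → ℂ) → ℂ) (z : Fin 2 → ℂ) : ℂ :=
  2 * (freq θ : ℂ) * (fderiv ℂ φ z z + φ z) + (μ₀ : ℂ) ^ 2 * φ z

/-- The heat semigroup `e^{-βH}`. -/
def heat (θ μ₀ β : ℝ) (φ : (Fin 2 → ℂ) → ℂ) (z : Fin 2 → ℂ) : ℂ :=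
  Complex.exp (-(β : ℂ) * (2 * (freq θ : ℂ) + (μ₀ : ℂ) ^ 2)) *
    φ (Complex.exp (-(2 * (freq θ : ℂ) * (β : ℂ))) • z)

theorem heat_zero (θ μ₀ : ℝ) (φ : (Fin 2 → ℂ) → ℂ) : heat θ μ₀ 0 φ = φ := by
  funext z
  simp [heat]

/-- `heat` solves the heat equation `∂_β u = -H u` of the kinetic operator. -/
theorem heat_hasDerivAt (θ μ₀ β : ℝ) (φ : (Fin 2 → ℂ) → ℂ) (hφ : Differentiable ℂ φ)
    (z : Fin 2 → ℂ) :
    HasDerivAt (fun b : ℝ => heat θ μ₀ b φ z) (-(oscillator θ μ₀ (heat θ μ₀ β φ) z)) β := by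
  have hb : HasDerivAt (fun b : ℝ => (b : ℂ)) 1 β := Complex.ofRealCLM.hasDerivAt
  have h1 : HasDerivAt
      (fun b : ℝ => Complex.exp (-(b : ℂ) * (2 * (freq θ : ℂ) + (μ₀ : ℂ) ^ 2))) _ β :=
    ((hb.neg.mul_const (2 * (freq θ : ℂ) + (μ₀ : ℂ) ^ 2)).cexp)
  have h2 : HasDerivAt (fun b : ℝ => Complex.exp (-(2 * (freq θ : ℂ) * (b : ℂ))) • z) _ β :=
    (((hb.const_mul (2 * (freq θ : ℂ))).neg).cexp).smul_const z
  have h3 := ((hφ _).hasFDerivAt.restrictScalars ℝ).comp_hasDerivAt β h2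
  have h4 := h1.mul h3
  have h5 : fderiv ℂ (heat θ μ₀ β φ) z z =
      Complex.exp (-(β : ℂ) * (2 * (freq θ : ℂ) + (μ₀ : ℂ) ^ 2)) *
        (Complex.exp (-(2 * (freq θ : ℂ) * (β : ℂ))) *
          fderiv ℂ φ (Complex.exp (-(2 * (freq θ : ℂ) * (β : ℂ))) • z) z) := by
    have h6 : HasFDerivAt (fun w : Fin 2 → ℂ => Complex.exp (-(2 * (freq θ : ℂ) * (β : ℂ))) • w)
        (Complex.exp (-(2 * (freq θ : ℂ) * (β : ℂ))) •
          ContinuousLinearMap.id ℂ (Fin 2 → ℂ)) z :=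
      (Complex.exp (-(2 * (freq θ : ℂ) * (β : ℂ))) • ContinuousLinearMap.id ℂ (Fin 2 → ℂ)).hasFDerivAt
    have h7 := ((hφ _).hasFDerivAt.comp z h6).const_mul
      (Complex.exp (-(β : ℂ) * (2 * (freq θ : ℂ) + (μ₀ : ℂ) ^ 2)))
    have h8 : HasFDerivAt (heat θ μ₀ β φ) _ z := h7
    rw [h8.fderiv]
    simp
  have h9 : HasDerivAt (fun b : ℝ => heat θ μ₀ b φ z) _ β := h4
  convert h9 using 1
  simp only [oscillator, h5, heat, ContinuousLinearMap.coe_restrictScalars', map_smul,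
    Function.comp_apply, smul_eq_mul, Pi.neg_apply]
  ring

/-- The regularized propagator `H_ε⁻¹ = ∫_ε^∞ e^{-βH} dβ = H⁻¹ e^{-εH}`; at `ε = 0` it is the
propagator `H⁻¹`. -/
def propagator {θ : ℝ} (μ₀ ε : ℝ) (φ : BargmannSpace θ) : BargmannSpace θ :=
  ofFun θ fun z => ∫ β in Set.Ioi ε, heat θ μ₀ β (toFun φ) z

/-! ### The one-loop effective action -/

/-- The Hessian `B_{φ,χ̄}` of the interaction `½ Tr_A[(φ, φ)_A²]`, in which `φ` and its conjugate
are treated as independent fields, at the background `(φ, χ̄)`. It acts on fluctuations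
`(η, ζ̄) ∈ H_B ⊕ conj(H_B)`; an element `ζ̄` of the conjugate space is represented by `ζ`.
The second order part of `½ Tr_A[(χ + ζ, φ + η)_A²]` in `(η, ζ̄)` is
`∑_γ { ⟨ζ, ηU_γ⟩⟨χ, φU_{-γ}⟩ + ⟨ζ, φU_γ⟩⟨χ, ηU_{-γ}⟩
  + ½⟨ζ, φU_γ⟩⟨ζ, φU_{-γ}⟩ + ½⟨χ, ηU_γ⟩⟨χ, ηU_{-γ}⟩ }`,
and the two components below are its derivatives with respect to `ζ̄` and `η`. -/
def hessian {θ : ℝ} (φ χ : BargmannSpace θ) (p : BargmannSpace θ × BargmannSpace θ) :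
    BargmannSpace θ × BargmannSpace θ :=
  (act p.1 (pairing χ φ) + act φ (pairing χ p.1) + act φ (pairing p.2 φ),
    act p.2 (pairing φ χ) + act χ (pairing φ p.2) + act χ (pairing p.1 χ))

/-- The operator `H_ε⁻¹ B_{φ,χ̄}` on `H_B ⊕ conj(H_B)`. -/
def loopOperator {θ : ℝ} (μ₀ ε : ℝ) (φ χ : BargmannSpace θ)
    (p : BargmannSpace θ × BargmannSpace θ) : BargmannSpace θ × BargmannSpace θ :=
  (propagator μ₀ ε (hessian φ χ p).1, propagator μ₀ ε (hessian φ χ p).2)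

/-- The diagonal block of `(H_ε⁻¹ B_{φ,χ̄})^N` on `H_B`. -/
def loopBlock {θ : ℝ} (μ₀ ε : ℝ) (N : ℕ) (φ χ : BargmannSpace θ) (η : BargmannSpace θ) :
    BargmannSpace θ :=
  ((loopOperator μ₀ ε φ χ)^[N] (η, 0)).1

/-- The diagonal block of `(H_ε⁻¹ B_{φ,χ̄})^N` on the conjugate space. -/
def loopBlockConj {θ : ℝ} (μ₀ ε : ℝ) (N : ℕ) (φ χ : BargmannSpace θ) (ζ : BargmannSpace θ) :
    BargmannSpace θ :=
  ((loopOperator μ₀ ε φ χ)^[N] (0, ζ)).2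

/-- The part of degree `2N` in the fields of the one-loop 1PI effective action
`½ ln det(1 + lam H_ε⁻¹ B_{φ,χ̄})`, that is
`½ (-1)^{N+1} (lam^N / N) Tr((H_ε⁻¹ B_{φ,χ̄})^N)`. The trace over `H_B ⊕ conj(H_B)` is the sum of
the traces of the diagonal blocks; an operator on the conjugate space has the complex conjugate of
the trace of the same map regarded as an operator on `H_B`. -/
def effectiveAction {θ : ℝ} (μ₀ lam ε : ℝ) (N : ℕ) (φ χ : BargmannSpace θ) : ℂ :=
  1 / 2 * ((-1) ^ (N + 1) * (lam : ℂ) ^ N / (N : ℂ) *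
    (opTrace (loopBlock μ₀ ε N φ χ) + conj (opTrace (loopBlockConj μ₀ ε N φ χ))))

/-- The one-loop `2N`-point 1PI Green's function
`δ^{2N} Γ^{(1)} / δφ₁ ⋯ δφ_N δχ̄₁ ⋯ δχ̄_N` in external fields: the coefficient of
`s₁ ⋯ s_N t₁ ⋯ t_N` in `Γ^{(1)}[∑ sᵢ φᵢ, ∑ tⱼ χ̄ⱼ]`. The part of `Γ^{(1)}` that contributes is
homogeneous of degree `N` in each of the two fields, so that the coefficient is given by
polarization. -/
def green {θ : ℝ} (μ₀ lam ε : ℝ) (N : ℕ) (φ χ : Fin N → BargmannSpace θ) : ℂ :=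
  ∑ S : Finset (Fin N), ∑ T : Finset (Fin N),
    (-1) ^ (Sᶜ.card + Tᶜ.card) *
      effectiveAction μ₀ lam ε N (∑ i ∈ S, φ i) (∑ j ∈ T, χ j)

end HeisenbergPhi4

end

open HeisenbergPhi4

/-!
# Finiteness of the one-loop Green's functions beyond the four-point function

The proof is an analysis of decay in phase space. After multiplication by the square root
`exp(-ω|z|²/2)` of the Gaussian weight, every element of the Bargmann space is a bounded function
on `ℂ²`, and the translations `U_γ` become shifts times phases (`gauged_transFun`). `Decay s C φ`
says that this function is bounded by `C (1 + ‖z‖)⁻ˢ`. Elements of the smooth module decay to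
every order; only the order `20` is used.

* *Vertices.* If two of the three fields in `a (b, c)_A` decay rapidly, then the product inherits
  the decay of the third one (`exists_decay_tri`), because the coefficients of the pairing and the
  translates are localized on the lattice. For a merely square integrable fluctuation the lattice
  sums converge since the translates of a rapidly decaying function form a Bessel system
  (`norm_sum_smul_sq_le`, `summable_norm_inner_sq`).
* *Propagators.* The heat semigroup contracts the argument, `z ↦ e^{-2ωβ} z`, and the integral over
  `β` gains two orders of decay, uniformly in the regularization (`exists_decay_propagator`).
* *Traces.* A loop with `N > 2` vertices contains three propagators and hence maps the Bargmann
  space into functions of decay order `6`. The overlap of the normalized monomial of index `n` with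
  such a function is at most a constant times `traceWeight n`, and `∑ traceWeight n < ∞`
  (`summable_traceWeight`): in one variable the terms fall off like `n^{-5/4}`. This gives the trace
  class property (`isTraceClass_of_decay`) and dominates the sum over diagonal matrix elements.

For the distributions, the background fields are parametrized by absolutely summable sequences
through the monomials, divided by their size in the norm of decay order `20` (`synth`). The loop
traces are then bounded multilinear forms in these sequences, with a bound that does not depend on
the regularization (`norm_loopTrace_le`), and polarization expresses the Green's functions by them
(`sum_polarization`, `green_eq_greenLin`). To handle the conjugate fields linearly, they are
replaced by their images under the antiunitary `J`, which commutes with all the structure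
(`J_act`, `propagator_J`, `bargmann_conj`).

The Bargmann transform turns the creation operator into multiplication by a coordinate, so the
transform of a Schwartz function of any number of variables decays faster than every power, with
constants that are continuous seminorms (`norm_bt_le_div`). Hence its coefficients in the products
of monomials are rapidly decreasing, and their sum against the bounded array `greenCoeff` of the
values of the Green's function on monomials is a tempered distribution (`tempDist`, `greenDist`).
As the regularization is removed, every entry of the array converges, and dominated convergence
gives the convergence of the distributions.
-/

set_option linter.unusedSectionVars false

namespace HeisenbergPhi4

/-- The inner product of the Bargmann space as the one of its `InnerProductSpace` structure. It is
definitionally the one that is found through `CStarModule`, and makes the lemmas on inner product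
spaces applicable. -/
noncomputable instance (θ : ℝ) : Inner ℂ (BargmannSpace θ) :=
  InnerProductSpace.toInner (𝕜 := ℂ) (E := BargmannSpace θ)

theorem pairing_apply {θ : ℝ} (χ φ : BargmannSpace θ) (γ : Lattice) :
    pairing χ φ γ = ⟪χ, actU φ (-γ)⟫_ℂ := rfl

theorem inner_smul_bargmann_left {θ : ℝ} (c : ℂ) (x y : BargmannSpace θ) :
    ⟪c • x, y⟫_ℂ = conj c * ⟪x, y⟫_ℂ :=
  inner_smul_left (𝕜 := ℂ) (E := BargmannSpace θ) _ _ _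

theorem inner_smul_bargmann_right {θ : ℝ} (c : ℂ) (x y : BargmannSpace θ) :
    ⟪x, c • y⟫_ℂ = c * ⟪x, y⟫_ℂ :=
  inner_smul_right (𝕜 := ℂ) (E := BargmannSpace θ) _ _ _

theorem opTrace_eq {θ : ℝ} (T : BargmannSpace θ → BargmannSpace θ) :
    opTrace T = ∑' n : ℕ × ℕ, ⟪monomialState θ n, T (monomialState θ n)⟫_ℂ := rfl

/-! ### The Gaussian measure -/

/-- The squared Euclidean norm `|z|²` on `ℂ²`; the norm of `Fin 2 → ℂ` is the maximum norm. -/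
noncomputable def sqNorm (z : Fin 2 → ℂ) : ℝ := ∑ i, ‖z i‖ ^ 2

/-- The Gaussian density `(ω/π)² exp(-ω|z|²)`. -/
noncomputable def gaussDensity (θ : ℝ) (z : Fin 2 → ℂ) : ℝ :=
  (freq θ / Real.pi) ^ 2 * Real.exp (-(freq θ) * sqNorm z)

/-- A function on `ℂ²` multiplied by the square root `exp(-ω|z|²/2)` of the Gaussian weight. -/
noncomputable def gauged (θ : ℝ) (g : (Fin 2 → ℂ) → ℂ) (z : Fin 2 → ℂ) : ℂ :=
  (Real.exp (-(freq θ / 2 * sqNorm z)) : ℂ) * g z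

theorem continuous_sqNorm : Continuous sqNorm := by unfold sqNorm; fun_prop

theorem sqNorm_nonneg (z : Fin 2 → ℂ) : 0 ≤ sqNorm z := by unfold sqNorm; positivity

theorem norm_sq_le_sqNorm (z : Fin 2 → ℂ) : ‖z‖ ^ 2 ≤ sqNorm z := by
  have h : ‖z‖ ≤ Real.sqrt (sqNorm z) := by
    rw [pi_norm_le_iff_of_nonneg (Real.sqrt_nonneg _)]
    intro i
    apply Real.le_sqrt_of_sq_le
    exact Finset.single_le_sum (f := fun i => ‖z i‖ ^ 2) (fun i _ => by positivity)
      (Finset.mem_univ i)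
  calc ‖z‖ ^ 2 ≤ Real.sqrt (sqNorm z) ^ 2 := by gcongr
    _ = sqNorm z := Real.sq_sqrt (sqNorm_nonneg z)

theorem gaussMeasure_eq (θ : ℝ) :
    gaussMeasure θ = volume.withDensity fun z => ENNReal.ofReal (gaussDensity θ z) := rfl

theorem continuous_gaussDensity (θ : ℝ) : Continuous (gaussDensity θ) := by
  have := continuous_sqNorm
  unfold gaussDensity; fun_prop

theorem gaussDensity_nonneg (θ : ℝ) (z : Fin 2 → ℂ) : 0 ≤ gaussDensity θ z := by
  unfold gaussDensity; positivity

theorem measurable_ofReal_gaussDensity (θ : ℝ) :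
    Measurable fun z => ENNReal.ofReal (gaussDensity θ z) :=
  (continuous_gaussDensity θ).measurable.ennreal_ofReal

theorem integral_gaussMeasure {E : Type*} [NormedAddCommGroup E] [NormedSpace ℝ E] (θ : ℝ)
    (f : (Fin 2 → ℂ) → E) :
    ∫ z, f z ∂gaussMeasure θ = ∫ z, gaussDensity θ z • f z := by
  rw [gaussMeasure_eq, integral_withDensity_eq_integral_toReal_smul
    (measurable_ofReal_gaussDensity θ) (ae_of_all _ fun _ => ENNReal.ofReal_lt_top)]
  simp only [ENNReal.toReal_ofReal (gaussDensity_nonneg θ _)]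

theorem integrable_gaussMeasure_iff {E : Type*} [NormedAddCommGroup E] [NormedSpace ℝ E] (θ : ℝ)
    (f : (Fin 2 → ℂ) → E) :
    Integrable f (gaussMeasure θ) ↔ Integrable fun z => gaussDensity θ z • f z := by
  rw [gaussMeasure_eq, integrable_withDensity_iff_integrable_smul'
    (measurable_ofReal_gaussDensity θ) (ae_of_all _ fun _ => ENNReal.ofReal_lt_top)]
  simp only [ENNReal.toReal_ofReal (gaussDensity_nonneg θ _)]

section
variable {θ : ℝ} [hθ : Fact (0 < θ)]

theorem freq_pos (θ : ℝ) [hθ : Fact (0 < θ)] : 0 < freq θ :=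
  div_pos (by positivity) hθ.out

theorem gaussDensity_pos (z : Fin 2 → ℂ) : 0 < gaussDensity θ z := by
  have := freq_pos θ
  unfold gaussDensity; positivity

theorem gaussDensity_eq_prod (z : Fin 2 → ℂ) : gaussDensity θ z =
    ∏ i, (freq θ / Real.pi * Real.exp (-(freq θ) * ‖z i‖ ^ 2)) := by
  simp only [gaussDensity, sqNorm, Fin.sum_univ_two, Fin.prod_univ_two]
  rw [mul_add, Real.exp_add]; ring

theorem integral_exp_neg_mul_sq_norm_complex {b : ℝ} (hb : 0 < b) :
    ∫ z : ℂ, Real.exp (-b * ‖z‖ ^ 2) = Real.pi / b := by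
  have := GaussianFourier.integral_rexp_neg_mul_sq_norm (V := ℂ) hb
  rw [this]; simp

theorem integral_gaussDensity : ∫ z, gaussDensity θ z = 1 := by
  have h := freq_pos θ
  simp_rw [gaussDensity_eq_prod]
  rw [integral_fintype_prod_volume_eq_prod
    (fun (_ : Fin 2) (w : ℂ) => freq θ / Real.pi * Real.exp (-(freq θ) * ‖w‖ ^ 2))]
  simp only [integral_const_mul, integral_exp_neg_mul_sq_norm_complex h]
  have := Real.pi_pos
  simp only [Finset.prod_const]
  field_simp
  simp

theorem integrable_gaussDensity : Integrable (gaussDensity θ) := by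
  by_contra h
  have := integral_undef h
  rw [integral_gaussDensity] at this
  exact one_ne_zero this

instance : IsProbabilityMeasure (gaussMeasure θ) := by
  constructor
  rw [gaussMeasure_eq, withDensity_apply _ MeasurableSet.univ, Measure.restrict_univ,
    ← ofReal_integral_eq_lintegral_ofReal integrable_gaussDensity
      (ae_of_all _ (gaussDensity_nonneg θ)), integral_gaussDensity, ENNReal.ofReal_one]

theorem volume_absolutelyContinuous_gaussMeasure :
    (volume : Measure (Fin 2 → ℂ)) ≪ gaussMeasure θ :=
  withDensity_absolutelyContinuous' (measurable_ofReal_gaussDensity θ).aemeasurable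
    (ae_of_all _ fun z => by
      rw [ne_eq, ENNReal.ofReal_eq_zero, not_le]
      exact gaussDensity_pos (θ := θ) z)

instance : (gaussMeasure θ).IsOpenPosMeasure :=
  (volume_absolutelyContinuous_gaussMeasure (θ := θ)).isOpenPosMeasure

theorem measurePreserving_gaussMeasure {f : (Fin 2 → ℂ) → (Fin 2 → ℂ)}
    (hf : MeasurePreserving f volume volume) (hq : ∀ z, sqNorm (f z) = sqNorm z) :
    MeasurePreserving f (gaussMeasure θ) (gaussMeasure θ) := by
  refine ⟨hf.measurable, ?_⟩
  ext s hs
  rw [Measure.map_apply hf.measurable hs, gaussMeasure_eq, withDensity_apply _ hs,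
    withDensity_apply _ (hf.measurable hs),
    ← hf.setLIntegral_comp_preimage hs (measurable_ofReal_gaussDensity θ)]
  simp only [gaussDensity, hq]

/-! ### Gauged functions -/

theorem norm_gauged (g : (Fin 2 → ℂ) → ℂ) (z : Fin 2 → ℂ) :
    ‖gauged θ g z‖ = Real.exp (-(freq θ / 2 * sqNorm z)) * ‖g z‖ := by
  rw [gauged, norm_mul, Complex.norm_real, Real.norm_eq_abs, abs_of_pos (Real.exp_pos _)]

theorem gaussDensity_eq_exp_sq (z : Fin 2 → ℂ) : gaussDensity θ z =
    (freq θ / Real.pi) ^ 2 * (Real.exp (-(freq θ / 2 * sqNorm z)) *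
      Real.exp (-(freq θ / 2 * sqNorm z))) := by
  rw [gaussDensity, ← Real.exp_add]; congr 2; ring

theorem gaussDensity_smul_mul (f g : (Fin 2 → ℂ) → ℂ) (z : Fin 2 → ℂ) :
    gaussDensity θ z • (conj (f z) * g z) =
      (((freq θ / Real.pi) ^ 2 : ℝ) : ℂ) * (conj (gauged θ f z) * gauged θ g z) := by
  rw [gaussDensity_eq_exp_sq, gauged, gauged, map_mul, Complex.conj_ofReal, Complex.real_smul]
  push_cast; ring

theorem memLp_gaussMeasure_iff {g : (Fin 2 → ℂ) → ℂ} (hg : Continuous g) :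
    MemLp g 2 (gaussMeasure θ) ↔ Integrable fun z => ‖gauged θ g z‖ ^ 2 := by
  rw [memLp_two_iff_integrable_sq_norm hg.aestronglyMeasurable, integrable_gaussMeasure_iff]
  have h := freq_pos θ
  have hc : (freq θ / Real.pi) ^ 2 ≠ 0 := by have := Real.pi_pos; positivity
  rw [← integrable_const_mul_iff (isUnit_iff_ne_zero.mpr hc) (fun z => ‖gauged θ g z‖ ^ 2)]
  apply iff_of_eq; congr 1; funext z
  rw [norm_gauged, gaussDensity_eq_exp_sq, smul_eq_mul]; ring

/-! ### Entire representatives -/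

theorem differentiable_toFun (φ : BargmannSpace θ) : Differentiable ℂ (toFun φ) :=
  φ.2.choose_spec.1

theorem continuous_toFun (φ : BargmannSpace θ) : Continuous (toFun φ) :=
  (differentiable_toFun φ).continuous

theorem coeFn_ae_eq_toFun (φ : BargmannSpace θ) :
    (φ : Lp ℂ 2 (gaussMeasure θ)) =ᵐ[gaussMeasure θ] toFun φ :=
  φ.2.choose_spec.2

theorem toFun_eq_of_ae (φ : BargmannSpace θ) {g : (Fin 2 → ℂ) → ℂ} (hg : Continuous g)
    (h : (φ : Lp ℂ 2 (gaussMeasure θ)) =ᵐ[gaussMeasure θ] g) : toFun φ = g :=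
  Measure.eq_of_ae_eq ((coeFn_ae_eq_toFun φ).symm.trans h) (continuous_toFun φ) hg

theorem toFun_injective : Function.Injective (toFun (θ := θ)) := by
  intro φ ψ h
  apply Subtype.ext
  apply Lp.ext
  have h1 := coeFn_ae_eq_toFun φ
  rw [h] at h1
  exact h1.trans (coeFn_ae_eq_toFun ψ).symm

theorem toFun_add (φ ψ : BargmannSpace θ) : toFun (φ + ψ) = toFun φ + toFun ψ := by
  apply toFun_eq_of_ae _ ((continuous_toFun φ).add (continuous_toFun ψ))
  exact (Lp.coeFn_add (φ : Lp ℂ 2 (gaussMeasure θ)) ψ).trans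
    ((coeFn_ae_eq_toFun φ).add (coeFn_ae_eq_toFun ψ))

theorem toFun_smul (c : ℂ) (φ : BargmannSpace θ) : toFun (c • φ) = c • toFun φ := by
  apply toFun_eq_of_ae _ ((continuous_toFun φ).const_smul c)
  exact (Lp.coeFn_smul c (φ : Lp ℂ 2 (gaussMeasure θ))).trans
    ((coeFn_ae_eq_toFun φ).const_smul c)

theorem memLp_toFun (φ : BargmannSpace θ) : MemLp (toFun φ) 2 (gaussMeasure θ) :=
  (memLp_congr_ae (coeFn_ae_eq_toFun φ)).1 (Lp.memLp _)

theorem toFun_ofFun {g : (Fin 2 → ℂ) → ℂ} (hg : Differentiable ℂ g)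
    (hg' : MemLp g 2 (gaussMeasure θ)) : toFun (ofFun θ g) = g := by
  have h : Differentiable ℂ g ∧ MemLp g 2 (gaussMeasure θ) := ⟨hg, hg'⟩
  apply toFun_eq_of_ae _ hg.continuous
  rw [ofFun, dif_pos h]
  exact hg'.coeFn_toLp

theorem ofFun_eq {g : (Fin 2 → ℂ) → ℂ} {φ : BargmannSpace θ} (h : toFun φ = g) :
    ofFun θ g = φ := by
  subst h
  exact toFun_injective (toFun_ofFun (differentiable_toFun φ) (memLp_toFun φ))

theorem inner_eq_integral (χ φ : BargmannSpace θ) :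
    ⟪χ, φ⟫_ℂ = ∫ z, conj (toFun χ z) * toFun φ z ∂gaussMeasure θ := by
  rw [Submodule.coe_inner, L2.inner_def]
  apply integral_congr_ae
  filter_upwards [coeFn_ae_eq_toFun χ, coeFn_ae_eq_toFun φ] with z h1 h2
  rw [h1, h2, RCLike.inner_apply, mul_comm]

theorem inner_eq_integral_gauged (χ φ : BargmannSpace θ) :
    ⟪χ, φ⟫_ℂ = (((freq θ / Real.pi) ^ 2 : ℝ) : ℂ) *
      ∫ z, conj (gauged θ (toFun χ) z) * gauged θ (toFun φ) z := by
  rw [inner_eq_integral, integral_gaussMeasure]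
  simp_rw [gaussDensity_smul_mul]
  rw [integral_const_mul]

theorem memLp_toFun_one (φ : BargmannSpace θ) : Integrable (toFun φ) (gaussMeasure θ) :=
  (memLp_toFun φ).integrable (by norm_num)

end

section
variable {θ : ℝ} [hθ : Fact (0 < θ)]

/-! ### Mean value property and reproducing kernel -/

theorem measurePreserving_mul_circle (c : Fin 2 → Circle) :
    MeasurePreserving (fun z : Fin 2 → ℂ => fun i => (c i : ℂ) * z i)
      (gaussMeasure θ) (gaussMeasure θ) := by
  apply measurePreserving_gaussMeasure
  · exact volume_preserving_pi (f := fun i (w : ℂ) => (c i : ℂ) * w) fun i =>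
      (rotation (c i)).measurePreserving
  · intro z
    simp only [sqNorm, norm_mul, Circle.norm_coe, one_mul]

/-- The mean value property for the Gaussian measure: it is invariant under the circle action
`z ↦ e^{it} z`, and the average of an entire function over each circle orbit is its value at the
origin. -/
theorem integral_entire_gaussMeasure {f : (Fin 2 → ℂ) → ℂ} (hf : Differentiable ℂ f)
    (hi : Integrable f (gaussMeasure θ)) : ∫ z, f z ∂gaussMeasure θ = f 0 := by
  have hrot : ∀ t : ℝ, MeasurePreserving (fun z : Fin 2 → ℂ => circleMap 0 1 t • z)
      (gaussMeasure θ) (gaussMeasure θ) := by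
    intro t
    have := measurePreserving_mul_circle (θ := θ) (fun _ => Circle.exp t)
    convert this using 2 with z
    funext i
    simp [circleMap, Circle.coe_exp]
  have hcont : Continuous fun p : ℝ × (Fin 2 → ℂ) => f (circleMap 0 1 p.1 • p.2) := by
    have := hf.continuous
    have h2 := continuous_circleMap 0 1
    fun_prop
  have hne : ∀ t : ℝ, MeasurableEmbedding (fun z : Fin 2 → ℂ => circleMap 0 1 t • z) := by
    intro t
    have hc : circleMap 0 1 t ≠ 0 := by
      have : ‖circleMap 0 1 t‖ = 1 := by simp
      intro h0; rw [h0] at this; simp at this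
    exact (Homeomorph.smulOfNeZero _ hc).measurableEmbedding
  have hprod : Integrable (fun p : ℝ × (Fin 2 → ℂ) => f (circleMap 0 1 p.1 • p.2))
      ((volume.restrict (Set.Ioc 0 (2 * Real.pi))).prod (gaussMeasure θ)) := by
    rw [integrable_prod_iff hcont.aestronglyMeasurable]
    refine ⟨ae_of_all _ fun t => ?_, ?_⟩
    · exact ((hrot t).integrable_comp_emb (hne t)).2 hi
    · have : (fun t : ℝ => ∫ z, ‖f (circleMap 0 1 t • z)‖ ∂gaussMeasure θ) =
          fun _ => ∫ z, ‖f z‖ ∂gaussMeasure θ := by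
        funext t
        exact (hrot t).integral_comp (hne t) (fun z => ‖f z‖)
      simp only [this]
      exact integrable_const _
  have hswap := integral_integral_swap (f := fun t z => f (circleMap 0 1 t • z)) hprod
  have h1 : ∀ t : ℝ, ∫ z, f (circleMap 0 1 t • z) ∂gaussMeasure θ = ∫ z, f z ∂gaussMeasure θ :=
    fun t => (hrot t).integral_comp (hne t) f
  have h2 : ∀ z : Fin 2 → ℂ,
      ∫ t in Set.Ioc 0 (2 * Real.pi), f (circleMap 0 1 t • z) = (2 * Real.pi : ℝ) • f 0 := by
    intro z
    have hd : Differentiable ℂ fun c : ℂ => f (c • z) :=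
      hf.comp (differentiable_id.smul_const z)
    have := DiffContOnCl.circleAverage (f := fun c : ℂ => f (c • z)) (c := 0) (R := 1)
      hd.diffContOnCl
    rw [Real.circleAverage_def, zero_smul, intervalIntegral.integral_of_le (by positivity)] at this
    rw [← this, smul_smul, mul_inv_cancel₀ (by positivity), one_smul]
  simp only [h1, h2] at hswap
  rw [integral_const, integral_const] at hswap
  have h3 : (volume.restrict (Set.Ioc 0 (2 * Real.pi))).real Set.univ = 2 * Real.pi := by
    simp [Measure.real, Real.pi_pos.le]
  rw [h3] at hswap
  simp only [probReal_univ, one_smul] at hswap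
  exact smul_right_injective ℂ (r := (2 * Real.pi : ℝ)) (by positivity) hswap

/-- The function `exp(-ω|v|²/2 - ω v̄·z) f(z + v)` that represents the translation of `f`. -/
noncomputable def transFun (θ : ℝ) (v : Fin 2 → ℂ) (f : (Fin 2 → ℂ) → ℂ) (z : Fin 2 → ℂ) : ℂ :=
  Complex.exp (-((freq θ / 2 * ∑ i, ‖v i‖ ^ 2 : ℝ) : ℂ) - (freq θ : ℂ) * ∑ i, conj (v i) * z i) *
    f (z + v)

theorem differentiable_transFun (v : Fin 2 → ℂ) {f : (Fin 2 → ℂ) → ℂ} (hf : Differentiable ℂ f) :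
    Differentiable ℂ (transFun θ v f) := by
  unfold transFun
  fun_prop

theorem sqNorm_add (z v : Fin 2 → ℂ) :
    sqNorm (z + v) = sqNorm z + sqNorm v + 2 * (∑ i, conj (v i) * z i).re := by
  simp only [sqNorm, Fin.sum_univ_two, Pi.add_apply, ← Complex.normSq_eq_norm_sq,
    Complex.normSq_apply, Complex.add_re, Complex.add_im, Complex.mul_re, Complex.conj_re,
    Complex.conj_im]
  ring

/-- In the gauged picture the translation is a shift followed by a multiplication by a phase. -/
theorem gauged_transFun (v : Fin 2 → ℂ) (f : (Fin 2 → ℂ) → ℂ) (z : Fin 2 → ℂ) :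
    gauged θ (transFun θ v f) z =
      Complex.exp (((-(freq θ * (∑ i, conj (v i) * z i).im) : ℝ) : ℂ) * Complex.I) *
        gauged θ f (z + v) := by
  simp only [gauged, transFun, ← mul_assoc, Complex.ofReal_exp]
  rw [← Complex.exp_add, ← Complex.exp_add]
  congr 2
  rw [sqNorm_add, ← sqNorm]
  generalize (∑ i, conj (v i) * z i) = w
  apply Complex.ext
  · simp; ring
  · simp

theorem norm_gauged_transFun (v : Fin 2 → ℂ) (f : (Fin 2 → ℂ) → ℂ) (z : Fin 2 → ℂ) :
    ‖gauged θ (transFun θ v f) z‖ = ‖gauged θ f (z + v)‖ := by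
  rw [gauged_transFun, norm_mul, Complex.norm_exp_ofReal_mul_I, one_mul]

theorem memLp_transFun (v : Fin 2 → ℂ) (φ : BargmannSpace θ) :
    MemLp (transFun θ v (toFun φ)) 2 (gaussMeasure θ) := by
  rw [memLp_gaussMeasure_iff (differentiable_transFun v (differentiable_toFun φ)).continuous]
  simp only [norm_gauged_transFun]
  exact ((memLp_gaussMeasure_iff (continuous_toFun φ)).1 (memLp_toFun φ)).comp_add_right v

theorem toFun_translation (v : Fin 2 → ℂ) (φ : BargmannSpace θ) :
    toFun (translation θ v φ) = transFun θ v (toFun φ) :=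
  toFun_ofFun (differentiable_transFun v (differentiable_toFun φ)) (memLp_transFun v φ)

theorem translation_add (v : Fin 2 → ℂ) (φ ψ : BargmannSpace θ) :
    translation θ v (φ + ψ) = translation θ v φ + translation θ v ψ := by
  apply toFun_injective
  rw [toFun_add, toFun_translation, toFun_translation, toFun_translation, toFun_add]
  funext z; simp [transFun, mul_add]

theorem translation_smul (v : Fin 2 → ℂ) (c : ℂ) (φ : BargmannSpace θ) :
    translation θ v (c • φ) = c • translation θ v φ := by
  apply toFun_injective
  rw [toFun_smul, toFun_translation, toFun_translation, toFun_smul]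
  funext z; simp only [transFun, Pi.smul_apply, smul_eq_mul]; ring

theorem inner_translation_translation (v : Fin 2 → ℂ) (χ φ : BargmannSpace θ) :
    ⟪translation θ v χ, translation θ v φ⟫_ℂ = ⟪χ, φ⟫_ℂ := by
  rw [inner_eq_integral_gauged, inner_eq_integral_gauged, toFun_translation, toFun_translation]
  congr 1
  rw [← integral_add_right_eq_self (fun z => conj (gauged θ (toFun χ) z) * gauged θ (toFun φ) z) v]
  congr 1; funext z
  rw [gauged_transFun, gauged_transFun, map_mul]
  have h : ∀ r : ℝ, conj (Complex.exp (r * Complex.I)) * Complex.exp (r * Complex.I) = 1 := by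
    intro r
    rw [← Complex.normSq_eq_conj_mul_self, Complex.normSq_eq_norm_sq,
      Complex.norm_exp_ofReal_mul_I]
    simp
  have := h (-(freq θ * (∑ i, conj (v i) * z i).im))
  linear_combination (conj (gauged θ (toFun χ) (z + v)) * gauged θ (toFun φ) (z + v)) * this

theorem translation_translation_neg (v : Fin 2 → ℂ) (φ : BargmannSpace θ) :
    translation θ v (translation θ (-v) φ) = φ := by
  apply toFun_injective
  rw [toFun_translation, toFun_translation]
  funext z
  simp only [transFun, ← mul_assoc, ← Complex.exp_add]
  have h : ∀ i, conj (v i) * v i = (‖v i‖ ^ 2 : ℝ) := by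
    intro i; rw [← Complex.normSq_eq_conj_mul_self, Complex.normSq_eq_norm_sq]
  have : (-((freq θ / 2 * ∑ i, ‖v i‖ ^ 2 : ℝ) : ℂ) - (freq θ : ℂ) * ∑ i, conj (v i) * z i +
      (-((freq θ / 2 * ∑ i, ‖(-v) i‖ ^ 2 : ℝ) : ℂ) -
        (freq θ : ℂ) * ∑ i, conj ((-v) i) * (z + v) i)) = 0 := by
    simp only [Pi.neg_apply, norm_neg, map_neg, Pi.add_apply, Fin.sum_univ_two]
    have h0 := h 0
    have h1 := h 1
    push_cast at h0 h1 ⊢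
    linear_combination (freq θ : ℂ) * (h0 + h1)
  rw [this, Complex.exp_zero, one_mul, add_neg_cancel_right]

theorem inner_translation_neg (v : Fin 2 → ℂ) (χ φ : BargmannSpace θ) :
    ⟪χ, translation θ (-v) φ⟫_ℂ = ⟪translation θ v χ, φ⟫_ℂ := by
  rw [← inner_translation_translation v, translation_translation_neg]

/-- The vacuum, the constant function `1`. -/
noncomputable def vacuum (θ : ℝ) : BargmannSpace θ := ofFun θ fun _ => 1

theorem toFun_vacuum : toFun (vacuum θ) = fun _ => 1 :=
  toFun_ofFun (differentiable_const _) (memLp_const _)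

/-- The coherent state `z ↦ exp(ω v̄·z)`, the reproducing kernel at `v`. -/
noncomputable def coherent (v : Fin 2 → ℂ) : BargmannSpace θ :=
  (Real.exp (freq θ / 2 * sqNorm v) : ℂ) • translation θ (-v) (vacuum θ)

theorem toFun_coherent (v z : Fin 2 → ℂ) :
    toFun (coherent (θ := θ) v) z = Complex.exp ((freq θ : ℂ) * ∑ i, conj (v i) * z i) := by
  rw [coherent, toFun_smul, toFun_translation, toFun_vacuum, Pi.smul_apply, transFun, mul_one,
    smul_eq_mul, Complex.ofReal_exp, ← Complex.exp_add]
  congr 1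
  simp [sqNorm, Fin.sum_univ_two]
  ring

/-- The reproducing property: the mean value property of the translated function. -/
theorem inner_coherent (v : Fin 2 → ℂ) (φ : BargmannSpace θ) :
    ⟪coherent v, φ⟫_ℂ = toFun φ v := by
  have h := inner_translation_neg (-v) (vacuum θ) φ
  rw [neg_neg, inner_eq_integral, toFun_vacuum] at h
  simp only [map_one, one_mul] at h
  rw [integral_entire_gaussMeasure (differentiable_toFun _) (memLp_toFun_one _),
    toFun_translation, transFun] at h
  rw [coherent, inner_smul_bargmann_left, ← h, Complex.conj_ofReal, ← mul_assoc, Complex.ofReal_exp,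
    ← Complex.exp_add]
  simp [sqNorm]

theorem norm_coherent (v : Fin 2 → ℂ) :
    ‖coherent (θ := θ) v‖ = Real.exp (freq θ / 2 * sqNorm v) := by
  have h := inner_coherent v (coherent (θ := θ) v)
  rw [toFun_coherent, inner_self_eq_norm_sq_to_K] at h
  have h2 : (freq θ : ℂ) * ∑ i, conj (v i) * v i = ((freq θ * sqNorm v : ℝ) : ℂ) := by
    simp only [sqNorm, ← Complex.normSq_eq_conj_mul_self, Complex.normSq_eq_norm_sq]
    push_cast; rfl
  rw [h2, ← Complex.ofReal_exp] at h
  have h3 : ‖coherent (θ := θ) v‖ ^ 2 = Real.exp (freq θ * sqNorm v) := by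
    apply Complex.ofReal_injective
    rw [← h]; simp
  rw [← Real.sqrt_sq (norm_nonneg _), h3, Real.sqrt_eq_iff_mul_self_eq (by positivity)
    (by positivity), ← Real.exp_add]
  congr 1; ring

/-- The reproducing property and the Cauchy-Schwarz inequality bound an element pointwise. -/
theorem norm_toFun_le (φ : BargmannSpace θ) (z : Fin 2 → ℂ) :
    ‖toFun φ z‖ ≤ ‖φ‖ * Real.exp (freq θ / 2 * sqNorm z) := by
  rw [← inner_coherent, mul_comm, ← norm_coherent]
  exact norm_inner_le_norm (𝕜 := ℂ) _ _

/-- Evaluation at a point, a continuous linear functional on the Bargmann space. -/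
noncomputable def evalCLM (z : Fin 2 → ℂ) : BargmannSpace θ →L[ℂ] ℂ := innerSL ℂ (coherent z)

theorem evalCLM_apply (z : Fin 2 → ℂ) (φ : BargmannSpace θ) : evalCLM z φ = toFun φ z :=
  inner_coherent z φ

theorem hasSum_toFun {ι : Type*} {f : ι → BargmannSpace θ} {φ : BargmannSpace θ}
    (h : HasSum f φ) (z : Fin 2 → ℂ) : HasSum (fun i => toFun (f i) z) (toFun φ z) := by
  simpa only [evalCLM_apply] using (evalCLM z).hasSum h

end

/-! ### Laplace type integrals are entire -/

/-- Differentiation under the integral sign: `z ↦ ∫ exp(z·ℓ(x)) h(x) dν(x)` is entire if `h` decays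
faster than every exponential of `ℓ`. -/
theorem differentiable_integral_exp {Ω : Type*} [MeasurableSpace Ω] {ν : Measure Ω}
    {l : Ω → Fin 2 → ℂ} (hl : Measurable l) {h : Ω → ℂ} (hh : AEStronglyMeasurable h ν)
    (hint : ∀ R : ℝ, Integrable (fun x => Real.exp (R * ‖l x‖) * ‖h x‖) ν) :
    Differentiable ℂ fun z : Fin 2 → ℂ => ∫ x, Complex.exp (∑ i, z i * l x i) * h x ∂ν := by
  intro z₀
  have hnorm : ∀ (z : Fin 2 → ℂ) (x : Ω),
      ‖Complex.exp (∑ i, z i * l x i)‖ ≤ Real.exp (2 * ‖z‖ * ‖l x‖) := by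
    intro z x
    rw [Complex.norm_exp, Real.exp_le_exp]
    refine (Complex.re_le_norm _).trans ((norm_sum_le _ _).trans ?_)
    rw [Fin.sum_univ_two, norm_mul, norm_mul]
    have h1 := mul_le_mul (norm_le_pi_norm z 0) (norm_le_pi_norm (l x) 0) (norm_nonneg _)
      (norm_nonneg _)
    have h2 := mul_le_mul (norm_le_pi_norm z 1) (norm_le_pi_norm (l x) 1) (norm_nonneg _)
      (norm_nonneg _)
    linarith
  have hmeas : ∀ z : Fin 2 → ℂ, AEStronglyMeasurable
      (fun x => Complex.exp (∑ i, z i * l x i) * h x) ν := by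
    intro z
    refine AEStronglyMeasurable.mul (Measurable.aestronglyMeasurable ?_) hh
    fun_prop
  let P : Fin 2 → (Fin 2 → ℂ) →L[ℂ] ℂ := fun i => ContinuousLinearMap.proj i
  have hP : ∀ i, ‖P i‖ ≤ 1 := fun i =>
    ContinuousLinearMap.opNorm_le_bound _ zero_le_one fun z => by
      simpa [P] using norm_le_pi_norm z i
  let F' : (Fin 2 → ℂ) → Ω → (Fin 2 → ℂ) →L[ℂ] ℂ := fun z x =>
    (Complex.exp (∑ i, z i * l x i) * h x) • ∑ i, l x i • P i
  have hF'm : AEStronglyMeasurable (F' z₀) ν := by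
    refine (hmeas z₀).smul ?_
    refine Finset.aestronglyMeasurable_fun_sum _ fun i _ => ?_
    exact (Measurable.aestronglyMeasurable (by fun_prop)).smul_const (P i)
  have hsum : ∀ x, ‖∑ i, l x i • P i‖ ≤ 2 * ‖l x‖ := by
    intro x
    refine (norm_sum_le _ _).trans ?_
    rw [Fin.sum_univ_two, norm_smul, norm_smul]
    have h1 := mul_le_mul (norm_le_pi_norm (l x) 0) (hP 0) (norm_nonneg _) (norm_nonneg _)
    have h2 := mul_le_mul (norm_le_pi_norm (l x) 1) (hP 1) (norm_nonneg _) (norm_nonneg _)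
    linarith
  refine HasFDerivAt.differentiableAt (f' := ∫ x, F' z₀ x ∂ν)
    (hasFDerivAt_integral_of_dominated_of_fderiv_le (F' := F')
    (bound := fun x => 2 * (Real.exp ((2 * (‖z₀‖ + 1) + 1) * ‖l x‖) * ‖h x‖))
    (Metric.ball_mem_nhds z₀ one_pos) (Eventually.of_forall hmeas) ?_ hF'm ?_ ?_ ?_)
  · refine (hint (2 * ‖z₀‖)).mono' (hmeas z₀) (ae_of_all _ fun x => ?_)
    rw [norm_mul]
    gcongr
    exact hnorm _ _
  · refine ae_of_all _ fun x z hz => ?_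
    have hz' : ‖z‖ ≤ ‖z₀‖ + 1 := by
      have := norm_sub_norm_le z z₀
      rw [Metric.mem_ball, dist_eq_norm] at hz
      linarith
    have hl1 : ‖l x‖ ≤ Real.exp ‖l x‖ := by
      have := Real.add_one_le_exp ‖l x‖; linarith
    calc ‖F' z x‖ ≤ (Real.exp (2 * ‖z‖ * ‖l x‖) * ‖h x‖) * (2 * ‖l x‖) := by
          rw [norm_smul, norm_mul]
          gcongr
          · exact hnorm _ _
          · exact hsum x
      _ ≤ (Real.exp (2 * (‖z₀‖ + 1) * ‖l x‖) * ‖h x‖) * (2 * Real.exp ‖l x‖) := by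
          gcongr
      _ = 2 * (Real.exp ((2 * (‖z₀‖ + 1) + 1) * ‖l x‖) * ‖h x‖) := by
          rw [add_mul _ 1, one_mul, Real.exp_add]; ring
  · exact (hint _).const_mul 2
  · refine ae_of_all _ fun x z _ => ?_
    have h1 : HasFDerivAt (fun z : Fin 2 → ℂ => ∑ i, z i * l x i) (∑ i, l x i • P i) z := by
      refine HasFDerivAt.fun_sum fun i _ => ?_
      exact ((P i).hasFDerivAt (x := z)).mul_const (l x i)
    have h2 := (h1.cexp).mul_const (h x)
    refine h2.congr_fderiv ?_
    simp only [F', smul_smul]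
    rw [mul_comm]

section
variable {θ : ℝ} [hθ : Fact (0 < θ)]

/-! ### Completeness of the Bargmann space -/

theorem integrable_exp_neg_mul_sqNorm {b : ℝ} (hb : 0 < b) :
    Integrable fun z : Fin 2 → ℂ => Real.exp (-b * sqNorm z) := by
  have h : Integrable fun w : ℂ => Real.exp (-b * ‖w‖ ^ 2) := by
    by_contra h
    have h2 := integral_undef h
    rw [integral_exp_neg_mul_sq_norm_complex hb] at h2
    have := Real.pi_pos
    have h3 : 0 < Real.pi / b := by positivity
    linarith
  have := Integrable.fintype_prod (μ := fun _ : Fin 2 => (volume : Measure ℂ))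
    (f := fun _ w => Real.exp (-b * ‖w‖ ^ 2)) (fun _ => h)
  refine this.congr (ae_of_all _ fun z => ?_)
  simp only [sqNorm, Fin.prod_univ_two, Fin.sum_univ_two, mul_add, Real.exp_add]

theorem memLp_exp_norm (R : ℝ) :
    MemLp (fun z : Fin 2 → ℂ => Real.exp (R * ‖z‖)) 2 (gaussMeasure θ) := by
  have hω := freq_pos θ
  have hc : Continuous fun z : Fin 2 → ℂ => Real.exp (R * ‖z‖) := by fun_prop
  rw [memLp_two_iff_integrable_sq_norm hc.aestronglyMeasurable, integrable_gaussMeasure_iff]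
  refine ((integrable_exp_neg_mul_sqNorm (b := freq θ / 2) (by positivity)).const_mul
    ((freq θ / Real.pi) ^ 2 * Real.exp (2 * R ^ 2 / freq θ))).mono'
    (((continuous_gaussDensity θ).smul (hc.norm.pow 2)).aestronglyMeasurable)
    (ae_of_all _ fun z => ?_)
  rw [Real.norm_of_nonneg (smul_nonneg (gaussDensity_nonneg _ _) (by positivity)), smul_eq_mul,
    gaussDensity, Real.norm_of_nonneg (by positivity), ← Real.exp_nat_mul, mul_assoc, mul_assoc,
    ← Real.exp_add, ← Real.exp_add]
  refine mul_le_mul_of_nonneg_left (Real.exp_le_exp.2 ?_) (by positivity)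
  have h1 := norm_sq_le_sqNorm z
  have h2 : 2 * (R * ‖z‖) ≤ freq θ / 2 * ‖z‖ ^ 2 + 2 * R ^ 2 / freq θ := by
    have : freq θ / 2 * ‖z‖ ^ 2 + 2 * R ^ 2 / freq θ - 2 * (R * ‖z‖) =
        freq θ / 2 * (‖z‖ - 2 * R / freq θ) ^ 2 := by field_simp; ring
    have h3 : 0 ≤ freq θ / 2 * (‖z‖ - 2 * R / freq θ) ^ 2 := by positivity
    linarith
  have h3 : freq θ / 2 * ‖z‖ ^ 2 ≤ freq θ / 2 * sqNorm z := by gcongr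
  push_cast
  linarith

/-- The Bargmann projection of a function in `L²(ℂ², dμ)`, the pairing with the reproducing
kernel. -/
noncomputable def bargmannProj (f : Lp ℂ 2 (gaussMeasure θ)) (z : Fin 2 → ℂ) : ℂ :=
  ⟪(coherent z : BargmannSpace θ).1, f⟫_ℂ

theorem differentiable_bargmannProj (f : Lp ℂ 2 (gaussMeasure θ)) :
    Differentiable ℂ (bargmannProj f) := by
  have h : bargmannProj f = fun z => ∫ w : Fin 2 → ℂ,
      Complex.exp (∑ i, z i * ((freq θ : ℂ) * conj (w i))) * f w ∂gaussMeasure θ := by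
    funext z
    rw [bargmannProj, L2.inner_def]
    apply integral_congr_ae
    filter_upwards [coeFn_ae_eq_toFun (coherent z : BargmannSpace θ)] with w hw
    rw [hw, RCLike.inner_apply, toFun_coherent, ← Complex.exp_conj, mul_comm]
    congr 2
    simp only [map_mul, Complex.conj_ofReal, map_sum, Complex.conj_conj, Finset.mul_sum]
    exact Finset.sum_congr rfl fun i _ => by ring
  rw [h]
  have hl₀ : Measurable fun (w : Fin 2 → ℂ) (i : Fin 2) => (freq θ : ℂ) * conj (w i) :=
    measurable_pi_lambda _ fun i =>
      (Complex.continuous_conj.measurable.comp (measurable_pi_apply i)).const_mul _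
  refine differentiable_integral_exp (ν := gaussMeasure θ) hl₀
    (Lp.aestronglyMeasurable f) fun R => ?_
  have hl : ∀ w : Fin 2 → ℂ, ‖fun i => (freq θ : ℂ) * conj (w i)‖ = freq θ * ‖w‖ := by
    intro w
    have h1 : (fun i => (freq θ : ℂ) * conj (w i)) = (freq θ : ℂ) • fun i => conj (w i) := rfl
    have h2 : ‖fun i => conj (w i)‖ = ‖w‖ := by simp [Pi.norm_def]
    rw [h1, norm_smul, h2, Complex.norm_real, Real.norm_of_nonneg (freq_pos θ).le]
  have hf : MemLp (fun w => ‖f w‖) 2 (gaussMeasure θ) := (Lp.memLp f).norm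
  have hprod : Integrable (fun w : Fin 2 → ℂ => Real.exp (R * freq θ * ‖w‖) * ‖f w‖)
      (gaussMeasure θ) :=
    (memLp_exp_norm (θ := θ) (R * freq θ)).integrable_mul hf
  refine hprod.congr (ae_of_all _ fun w => ?_)
  simp only [hl, mul_assoc]

/-- An `L²` limit of entire functions is almost everywhere equal to its Bargmann projection, which is
entire. -/
theorem isClosed_bargmannSpace : IsClosed (BargmannSpace θ : Set (Lp ℂ 2 (gaussMeasure θ))) := by
  apply isClosed_of_closure_subset
  intro f hf
  obtain ⟨u, hu, hlim⟩ := mem_closure_iff_seq_limit.1 hf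
  refine ⟨bargmannProj f, differentiable_bargmannProj f, ?_⟩
  obtain ⟨ns, hmono, hns⟩ := (tendstoInMeasure_of_tendsto_Lp hlim).exists_seq_tendsto_ae
  have hae : ∀ᵐ z ∂gaussMeasure θ, ∀ k, u (ns k) z = toFun (⟨u (ns k), hu _⟩ : BargmannSpace θ) z :=
    ae_all_iff.2 fun k => coeFn_ae_eq_toFun (⟨u (ns k), hu _⟩ : BargmannSpace θ)
  have hns2 : Tendsto ns atTop atTop := hmono.tendsto_atTop
  filter_upwards [hns, hae] with z h1 h2
  refine tendsto_nhds_unique h1 ?_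
  simp only [h2]
  have h3 : ∀ k, toFun (⟨u (ns k), hu _⟩ : BargmannSpace θ) z =
      ⟪(coherent z : BargmannSpace θ).1, u (ns k)⟫_ℂ := fun k => by
    rw [← inner_coherent, Submodule.coe_inner]
  simp only [h3]
  exact ((continuous_const.inner continuous_id).tendsto f).comp (hlim.comp hns2)

instance : CompleteSpace (BargmannSpace θ) :=
  (isClosed_bargmannSpace (θ := θ)).completeSpace_coe

end
section
variable {θ : ℝ} [hθ : Fact (0 < θ)]

/-! ### The orthonormal basis of monomials -/

/-- The normalized monomial `(ωⁿ/n!)^{1/2} wⁿ` in one variable. -/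
noncomputable def mono₁ (θ : ℝ) (n : ℕ) (w : ℂ) : ℂ :=
  (Real.sqrt (freq θ ^ n / n.factorial) : ℂ) * w ^ n

/-- The normalized monomial in two variables. -/
noncomputable def mono (θ : ℝ) (n : ℕ × ℕ) (z : Fin 2 → ℂ) : ℂ :=
  mono₁ θ n.1 (z 0) * mono₁ θ n.2 (z 1)

theorem continuous_mono₁ (n : ℕ) : Continuous (mono₁ θ n) := by
  unfold mono₁; fun_prop

theorem differentiable_mono (n : ℕ × ℕ) : Differentiable ℂ (mono θ n) := by
  unfold mono mono₁; fun_prop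

theorem monomialState_eq (n : ℕ × ℕ) : monomialState θ n = ofFun θ (mono θ n) := by
  rw [monomialState]
  congr 1; funext z
  have h : Real.sqrt (freq θ ^ (n.1 + n.2) / (n.1.factorial * n.2.factorial : ℝ)) =
      Real.sqrt (freq θ ^ n.1 / n.1.factorial) * Real.sqrt (freq θ ^ n.2 / n.2.factorial) := by
    have := freq_pos θ
    rw [← Real.sqrt_mul (by positivity)]
    congr 1
    rw [pow_add]; field_simp
  rw [h, mono, mono₁, mono₁]
  push_cast; ring

theorem norm_mono₁ (n : ℕ) (w : ℂ) :
    ‖mono₁ θ n w‖ = Real.sqrt (freq θ ^ n / n.factorial) * ‖w‖ ^ n := by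
  rw [mono₁, norm_mul, norm_pow, Complex.norm_real, Real.norm_of_nonneg (Real.sqrt_nonneg _)]

theorem norm_mono₁_sq (n : ℕ) (w : ℂ) :
    ‖mono₁ θ n w‖ ^ 2 = (freq θ * ‖w‖ ^ 2) ^ n / n.factorial := by
  have := freq_pos θ
  rw [norm_mono₁, mul_pow, Real.sq_sqrt (by positivity), mul_pow, ← pow_mul, ← pow_mul,
    mul_comm n 2]
  ring

theorem memLp_mono (n : ℕ × ℕ) : MemLp (mono θ n) 2 (gaussMeasure θ) := by
  refine MemLp.of_le_mul (c := Real.sqrt (freq θ ^ n.1 / n.1.factorial) *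
    Real.sqrt (freq θ ^ n.2 / n.2.factorial) * (n.1.factorial * n.2.factorial))
    (memLp_exp_norm (θ := θ) 2)
    (differentiable_mono n).continuous.aestronglyMeasurable (ae_of_all _ fun z => ?_)
  rw [mono, norm_mul, norm_mono₁, norm_mono₁, Real.norm_of_nonneg (Real.exp_pos _).le]
  have key : ∀ (k : ℕ) (i : Fin 2), ‖z i‖ ^ k ≤ k.factorial * Real.exp ‖z‖ := by
    intro k i
    have h1 := Real.pow_div_factorial_le_exp ‖z‖ (norm_nonneg z) k
    rw [div_le_iff₀ (by positivity)] at h1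
    have h2 : ‖z i‖ ^ k ≤ ‖z‖ ^ k := by gcongr; exact norm_le_pi_norm z i
    linarith
  have h2 : Real.exp (2 * ‖z‖) = Real.exp ‖z‖ * Real.exp ‖z‖ := by
    rw [← Real.exp_add]; congr 1; ring
  rw [h2]
  calc _ = Real.sqrt (freq θ ^ n.1 / n.1.factorial) * Real.sqrt (freq θ ^ n.2 / n.2.factorial) *
        (‖z 0‖ ^ n.1 * ‖z 1‖ ^ n.2) := by ring
    _ ≤ Real.sqrt (freq θ ^ n.1 / n.1.factorial) * Real.sqrt (freq θ ^ n.2 / n.2.factorial) *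
        ((n.1.factorial * Real.exp ‖z‖) * (n.2.factorial * Real.exp ‖z‖)) := by
        gcongr <;> exact key _ _
    _ = _ := by ring

theorem toFun_monomialState (n : ℕ × ℕ) : toFun (monomialState θ n) = mono θ n := by
  rw [monomialState_eq]
  exact toFun_ofFun (differentiable_mono n) (memLp_mono n)

theorem integral_conj_mono₁_mul (m n : ℕ) :
    ∫ w : ℂ, ((freq θ / Real.pi * Real.exp (-(freq θ) * ‖w‖ ^ 2) : ℝ) : ℂ) *
      (conj (mono₁ θ m w) * mono₁ θ n w) = if m = n then 1 else 0 := by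
  have hω := freq_pos θ
  have hπ := Real.pi_pos
  split_ifs with h
  · subst h
    have h1 : ∀ w : ℂ, ((freq θ / Real.pi * Real.exp (-(freq θ) * ‖w‖ ^ 2) : ℝ) : ℂ) *
        (conj (mono₁ θ m w) * mono₁ θ m w) = ((freq θ / Real.pi * (freq θ ^ m / m.factorial) *
          (‖w‖ ^ (2 * m : ℝ) * Real.exp (-(freq θ) * ‖w‖ ^ (2 : ℝ))) : ℝ) : ℂ) := by
      intro w
      have e1 : ‖w‖ ^ (2 * m : ℝ) = (‖w‖ ^ 2) ^ m := by
        rw [← pow_mul, ← Real.rpow_natCast]; push_cast; rfl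
      have e2 : ‖w‖ ^ (2 : ℝ) = ‖w‖ ^ 2 := by exact_mod_cast Real.rpow_natCast ‖w‖ 2
      rw [← Complex.normSq_eq_conj_mul_self, Complex.normSq_eq_norm_sq, norm_mono₁_sq,
        ← Complex.ofReal_mul, e1, e2, mul_pow]
      congr 1; ring
    simp_rw [h1]
    rw [integral_complex_ofReal, integral_const_mul,
      Complex.integral_rpow_mul_exp_neg_mul_rpow (by norm_num)
        (by have : (0 : ℝ) ≤ m := Nat.cast_nonneg m
            linarith) hω]
    have e3 : (2 * (m : ℝ) + 2) / 2 = m + 1 := by ring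
    have e4 : -(2 * (m : ℝ) + 2) / 2 = -((m + 1 : ℕ) : ℝ) := by push_cast; ring
    rw [e3, e4, Real.Gamma_nat_eq_factorial, Real.rpow_neg hω.le, Real.rpow_natCast]
    rw [← Complex.ofReal_one]
    congr 1
    field_simp
    ring
  -- the rotation by `π/(n - m)` changes the sign of the integrand
  · obtain ⟨c, hc⟩ : ∃ c : Circle, conj (c : ℂ) ^ m * (c : ℂ) ^ n = -1 := by
      have hmn : ((n : ℝ) - m) ≠ 0 := by
        rw [sub_ne_zero]; exact_mod_cast Ne.symm h
      refine ⟨Circle.exp (Real.pi / (n - m)), ?_⟩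
      rw [Circle.coe_exp, ← Complex.exp_conj, ← Complex.exp_nat_mul, ← Complex.exp_nat_mul,
        ← Complex.exp_add, ← Complex.exp_pi_mul_I]
      congr 1
      have hmn' : ((n : ℂ) - m) ≠ 0 := by exact_mod_cast hmn
      simp only [map_mul, Complex.conj_ofReal, Complex.conj_I]
      push_cast
      field_simp
      ring
    have h2 := (rotation c).measurePreserving.integral_comp
      (rotation c).toHomeomorph.measurableEmbedding (fun w : ℂ =>
      ((freq θ / Real.pi * Real.exp (-(freq θ) * ‖w‖ ^ 2) : ℝ) : ℂ) *
      (conj (mono₁ θ m w) * mono₁ θ n w))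
    have h3 : ∀ w : ℂ, ((freq θ / Real.pi * Real.exp (-(freq θ) * ‖rotation c w‖ ^ 2) : ℝ) : ℂ) *
        (conj (mono₁ θ m (rotation c w)) * mono₁ θ n (rotation c w)) =
        (-1) * (((freq θ / Real.pi * Real.exp (-(freq θ) * ‖w‖ ^ 2) : ℝ) : ℂ) *
      (conj (mono₁ θ m w) * mono₁ θ n w)) := by
      intro w
      rw [← hc]
      have e : ‖rotation c w‖ = ‖w‖ := LinearIsometryEquiv.norm_map _ w
      rw [e]
      simp only [rotation_apply, mono₁, map_mul, map_pow, mul_pow, Complex.conj_ofReal]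
      ring
    simp_rw [h3] at h2
    rw [integral_const_mul] at h2
    linear_combination (-1 / 2 : ℂ) * h2

theorem inner_monomialState (m n : ℕ × ℕ) :
    ⟪monomialState θ m, monomialState θ n⟫_ℂ = if m = n then 1 else 0 := by
  rw [inner_eq_integral, integral_gaussMeasure, toFun_monomialState, toFun_monomialState]
  have h1 : ∀ z : Fin 2 → ℂ, gaussDensity θ z • (conj (mono θ m z) * mono θ n z) =
      ∏ i, ((freq θ / Real.pi * Real.exp (-(freq θ) * ‖z i‖ ^ 2) : ℝ) : ℂ) *
        (conj (mono₁ θ (![m.1, m.2] i) (z i)) * mono₁ θ (![n.1, n.2] i) (z i)) := by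
    intro z
    rw [gaussDensity_eq_prod, Complex.real_smul, Fin.prod_univ_two, Fin.prod_univ_two, mono, mono,
      map_mul]
    simp only [Matrix.cons_val_zero, Matrix.cons_val_one]
    push_cast; ring
  simp_rw [h1]
  rw [integral_fintype_prod_volume_eq_prod (fun (i : Fin 2) (w : ℂ) =>
    ((freq θ / Real.pi * Real.exp (-(freq θ) * ‖w‖ ^ 2) : ℝ) : ℂ) *
        (conj (mono₁ θ (![m.1, m.2] i) w) * mono₁ θ (![n.1, n.2] i) w))]
  rw [Fin.prod_univ_two, integral_conj_mono₁_mul, integral_conj_mono₁_mul]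
  change (if m.1 = n.1 then (1 : ℂ) else 0) * (if m.2 = n.2 then 1 else 0) = _
  by_cases h₁ : m.1 = n.1 <;> by_cases h₂ : m.2 = n.2 <;> simp [h₁, h₂, Prod.ext_iff]

theorem orthonormal_monomialState : Orthonormal ℂ (monomialState θ) := by
  classical
  rw [orthonormal_iff_ite]
  exact inner_monomialState

theorem norm_monomialState (n : ℕ × ℕ) : ‖monomialState θ n‖ = 1 :=
  orthonormal_monomialState.1 n

theorem summable_norm_mono_sq (z : Fin 2 → ℂ) :
    Summable fun n : ℕ × ℕ => ‖mono θ n z‖ ^ 2 := by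
  have h : ∀ i, Summable fun n : ℕ => ‖mono₁ θ n (z i)‖ ^ 2 := fun i => by
    simp_rw [norm_mono₁_sq]
    exact Real.summable_pow_div_factorial _
  have := (h 0).mul_of_nonneg (h 1) (fun _ => by positivity) (fun _ => by positivity)
  refine this.congr fun n => ?_
  rw [mono, norm_mul, mul_pow]

theorem summable_smul_monomialState {c : ℕ × ℕ → ℂ} (hc : Summable fun n => ‖c n‖ ^ 2) :
    Summable fun n => c n • monomialState θ n := by
  have h := (orthonormal_monomialState (θ := θ)).orthogonalFamily
  have := (h.summable_iff_norm_sq_summable c).2 hc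
  simpa using this

theorem hasSum_of_eq {ι E : Type*} [AddCommMonoid E] [TopologicalSpace E] {f g : ι → E} {a : E}
    (h : HasSum f a) (e : ∀ i, g i = f i) : HasSum g a := by
  rwa [funext e]

theorem hasSum_conj_mono₁_mul (w u : ℂ) :
    HasSum (fun n => conj (mono₁ θ n w) * mono₁ θ n u)
      (Complex.exp ((freq θ : ℂ) * (conj w * u))) := by
  have hω := freq_pos θ
  have h := NormedSpace.expSeries_div_hasSum_exp ((freq θ : ℂ) * (conj w * u))
  rw [← Complex.exp_eq_exp_ℂ] at h
  refine hasSum_of_eq h fun n => ?_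
  have h1 : (Real.sqrt (freq θ ^ n / n.factorial) : ℂ) * (Real.sqrt (freq θ ^ n / n.factorial) : ℂ)
      = (freq θ : ℂ) ^ n / n.factorial := by
    rw [← Complex.ofReal_mul, Real.mul_self_sqrt (by positivity)]; push_cast; rfl
  simp only [mono₁, map_mul, map_pow, Complex.conj_ofReal, mul_pow]
  linear_combination (conj w ^ n * u ^ n) * h1

theorem hasSum_mul_prod {f g : ℕ → ℂ} {a b : ℂ} (hf : HasSum f a) (hg : HasSum g b)
    (hf' : Summable fun n => ‖f n‖) (hg' : Summable fun n => ‖g n‖) :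
    HasSum (fun n : ℕ × ℕ => f n.1 * g n.2) (a * b) :=
  hf.mul hg (summable_mul_of_summable_norm hf' hg')

theorem hasSum_conj_mono_mul (w z : Fin 2 → ℂ) :
    HasSum (fun n : ℕ × ℕ => conj (mono θ n w) * mono θ n z)
      (Complex.exp ((freq θ : ℂ) * ∑ i, conj (w i) * z i)) := by
  have hsum : ∀ i, Summable fun n => ‖conj (mono₁ θ n (w i)) * mono₁ θ n (z i)‖ :=
    fun i => (hasSum_conj_mono₁_mul (w i) (z i)).summable.norm
  have h2 := hasSum_mul_prod (hasSum_conj_mono₁_mul (θ := θ) (w 0) (z 0))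
    (hasSum_conj_mono₁_mul (θ := θ) (w 1) (z 1)) (hsum 0) (hsum 1)
  rw [Fin.sum_univ_two, mul_add, Complex.exp_add]
  refine hasSum_of_eq h2 fun n => ?_
  rw [mono, mono, map_mul]
  ring

theorem toFun_smul_monomialState (c : ℂ) (n : ℕ × ℕ) (z : Fin 2 → ℂ) :
    toFun (c • monomialState θ n) z = c * mono θ n z := by
  rw [toFun_smul, toFun_monomialState, Pi.smul_apply, smul_eq_mul]

theorem hasSum_coherent (w : Fin 2 → ℂ) :
    HasSum (fun n => conj (mono θ n w) • monomialState θ n) (coherent w) := by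
  have hs : Summable fun n => conj (mono θ n w) • monomialState θ n :=
    summable_smul_monomialState (by
      simpa only [RCLike.norm_conj] using summable_norm_mono_sq (θ := θ) w)
  obtain ⟨ψ, hψ⟩ := hs
  suffices hc : coherent w = ψ by rw [hc]; exact hψ
  apply toFun_injective
  funext z
  have h1 := hasSum_toFun hψ z
  simp only [toFun_smul_monomialState] at h1
  rw [toFun_coherent]
  exact (hasSum_conj_mono_mul w z).unique h1

theorem eq_zero_of_inner_monomialState {η : BargmannSpace θ}
    (h : ∀ n, ⟪monomialState θ n, η⟫_ℂ = 0) : η = 0 := by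
  apply toFun_injective
  funext w
  have h1 := ((innerSL ℂ η).hasSum (hasSum_coherent w))
  have h2 : ∀ n, innerSL ℂ η (conj (mono θ n w) • monomialState θ n) = 0 := fun n => by
    rw [map_smul, innerSL_apply_apply, ← inner_conj_symm, h]; simp
  have h3 := h1.unique (by simpa only [h2] using hasSum_zero)
  rw [innerSL_apply_apply, ← inner_conj_symm, inner_coherent, map_eq_zero] at h3
  rw [h3, ← inner_coherent, inner_zero_right]

/-- The normalized monomials as a Hilbert basis of the Bargmann space. They are complete because
the coherent states, which reproduce the values of a function, are combinations of monomials. -/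
noncomputable def monomialBasis (θ : ℝ) [Fact (0 < θ)] :
    HilbertBasis (ℕ × ℕ) ℂ (BargmannSpace θ) :=
  HilbertBasis.mkOfOrthogonalEqBot (orthonormal_monomialState (θ := θ)) (by
    rw [Submodule.eq_bot_iff]
    intro η hη
    apply eq_zero_of_inner_monomialState
    intro n
    exact (Submodule.mem_orthogonal _ _).1 hη _ (Submodule.subset_span ⟨n, rfl⟩))

theorem coe_monomialBasis : ⇑(monomialBasis θ) = monomialState θ :=
  HilbertBasis.coe_mkOfOrthogonalEqBot _ _

theorem hasSum_inner_smul_monomialState (η : BargmannSpace θ) :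
    HasSum (fun n => ⟪monomialState θ n, η⟫_ℂ • monomialState θ n) η := by
  have := (monomialBasis θ).hasSum_repr η
  simpa only [HilbertBasis.repr_apply_apply, coe_monomialBasis] using this

theorem hasSum_norm_inner_sq (η : BargmannSpace θ) :
    HasSum (fun n => ‖⟪monomialState θ n, η⟫_ℂ‖ ^ 2) (‖η‖ ^ 2) := by
  have h := (monomialBasis θ).hasSum_inner_mul_inner η η
  rw [inner_self_eq_norm_sq_to_K] at h
  have h2 : ∀ n, ⟪η, monomialBasis θ n⟫_ℂ * ⟪monomialBasis θ n, η⟫_ℂ =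
      ((‖⟪monomialState θ n, η⟫_ℂ‖ ^ 2 : ℝ) : ℂ) := fun n => by
    rw [coe_monomialBasis, ← inner_conj_symm, ← Complex.normSq_eq_conj_mul_self,
      Complex.normSq_eq_norm_sq]
  simp only [h2] at h
  have h3 : ((‖η‖ : ℂ)) ^ 2 = ((‖η‖ ^ 2 : ℝ) : ℂ) := by push_cast; rfl
  exact Complex.hasSum_ofReal.1 (h3 ▸ h)

theorem hasSum_toFun_mono (η : BargmannSpace θ) (z : Fin 2 → ℂ) :
    HasSum (fun n => ⟪monomialState θ n, η⟫_ℂ * mono θ n z) (toFun η z) := by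
  have := hasSum_toFun (hasSum_inner_smul_monomialState η) z
  simpa only [toFun_smul_monomialState] using this

theorem inner_eq_of_hasSum {c : ℕ × ℕ → ℂ} {η : BargmannSpace θ}
    (h : HasSum (fun n => c n • monomialState θ n) η) (m : ℕ × ℕ) :
    ⟪monomialState θ m, η⟫_ℂ = c m := by
  have h1 := (innerSL ℂ (monomialState θ m)).hasSum h
  simp only [map_smul, innerSL_apply_apply, inner_monomialState, smul_eq_mul, mul_ite, mul_one,
    mul_zero] at h1
  refine h1.unique (hasSum_of_eq (hasSum_ite_eq m (c m)) fun n => ?_)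
  by_cases h : m = n
  · simp [h]
  · simp [h, Ne.symm h]

/-! ### The complex conjugation -/

/-- The antiunitary conjugation `(Jη)(z) = conj (η(z̄))`, the conjugation of the coefficients in
the basis of monomials. Under the Bargmann transform it is the pointwise conjugation. -/
noncomputable def J (η : BargmannSpace θ) : BargmannSpace θ :=
  ∑' n, conj ⟪monomialState θ n, η⟫_ℂ • monomialState θ n

theorem hasSum_J (η : BargmannSpace θ) :
    HasSum (fun n => conj ⟪monomialState θ n, η⟫_ℂ • monomialState θ n) (J η) :=
  (summable_smul_monomialState (by
    simpa only [RCLike.norm_conj] using (hasSum_norm_inner_sq η).summable)).hasSum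

theorem inner_monomialState_J (n : ℕ × ℕ) (η : BargmannSpace θ) :
    ⟪monomialState θ n, J η⟫_ℂ = conj ⟪monomialState θ n, η⟫_ℂ :=
  inner_eq_of_hasSum (hasSum_J η) n

theorem eq_of_inner_monomialState {η ξ : BargmannSpace θ}
    (h : ∀ n, ⟪monomialState θ n, η⟫_ℂ = ⟪monomialState θ n, ξ⟫_ℂ) : η = ξ := by
  rw [← sub_eq_zero]
  apply eq_zero_of_inner_monomialState
  intro n
  rw [inner_sub_right, h, sub_self]

theorem J_J (η : BargmannSpace θ) : J (J η) = η :=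
  eq_of_inner_monomialState fun n => by simp only [inner_monomialState_J, Complex.conj_conj]

theorem J_add (η ξ : BargmannSpace θ) : J (η + ξ) = J η + J ξ :=
  eq_of_inner_monomialState fun n => by
    simp only [inner_monomialState_J, inner_add_right, map_add]

theorem J_smul (c : ℂ) (η : BargmannSpace θ) : J (c • η) = conj c • J η :=
  eq_of_inner_monomialState fun n => by
    simp only [inner_monomialState_J, inner_smul_bargmann_right, map_mul]

theorem J_monomialState (n : ℕ × ℕ) : J (monomialState θ n) = monomialState θ n :=
  eq_of_inner_monomialState fun m => by
    rw [inner_monomialState_J, inner_monomialState]; split_ifs <;> simp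

theorem norm_J (η : BargmannSpace θ) : ‖J η‖ = ‖η‖ := by
  have h1 := hasSum_norm_inner_sq (J η)
  simp only [inner_monomialState_J, RCLike.norm_conj] at h1
  have := h1.unique (hasSum_norm_inner_sq η)
  exact (pow_left_inj₀ (norm_nonneg _) (norm_nonneg _) two_ne_zero).1 this

/-- `J` as an isometric semilinear map. -/
noncomputable def Jₗᵢ : BargmannSpace θ →ₛₗᵢ[starRingEnd ℂ] BargmannSpace θ where
  toFun := J
  map_add' := J_add
  map_smul' := J_smul
  norm_map' := norm_J

theorem toFun_J (η : BargmannSpace θ) (z : Fin 2 → ℂ) :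
    toFun (J η) z = conj (toFun η (fun i => conj (z i))) := by
  have h1 := hasSum_toFun_mono (J η) z
  have h2 := (Complex.hasSum_conj'.2 (hasSum_toFun_mono η (fun i => conj (z i))))
  refine h1.unique ?_
  refine hasSum_of_eq h2 fun n => ?_
  rw [inner_monomialState_J]
  simp [mono, mono₁]

theorem inner_J_J (η ξ : BargmannSpace θ) : ⟪J η, J ξ⟫_ℂ = conj ⟪η, ξ⟫_ℂ := by
  have h1 := (monomialBasis θ).hasSum_inner_mul_inner (J η) (J ξ)
  have h2 := Complex.hasSum_conj'.2 ((monomialBasis θ).hasSum_inner_mul_inner η ξ)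
  refine h1.unique ?_
  refine hasSum_of_eq h2 fun n => ?_
  rw [coe_monomialBasis, map_mul, inner_monomialState_J, ← inner_conj_symm (J η),
    inner_monomialState_J, inner_conj_symm]

end
section
variable {θ : ℝ} [hθ : Fact (0 < θ)]

/-! ### The propagator in the basis of monomials -/

/-- The eigenvalue `2ω(n₀ + n₁ + 1) + μ₀²` of the oscillator on the monomial `z₀^{n₀} z₁^{n₁}`. -/
noncomputable def energy (θ μ₀ : ℝ) (n : ℕ × ℕ) : ℝ :=
  2 * freq θ * (n.1 + n.2 + 1) + μ₀ ^ 2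

theorem two_mul_freq_le_energy (μ₀ : ℝ) (n : ℕ × ℕ) : 2 * freq θ ≤ energy θ μ₀ n := by
  have := freq_pos θ
  have h1 : (0 : ℝ) ≤ n.1 + n.2 := by positivity
  unfold energy
  nlinarith [sq_nonneg μ₀]

theorem energy_pos (μ₀ : ℝ) (n : ℕ × ℕ) : 0 < energy θ μ₀ n := by
  have := freq_pos θ
  have := two_mul_freq_le_energy (θ := θ) μ₀ n
  linarith

/-- The eigenvalue `∫_ε^∞ e^{-βλₙ} dβ` of the regularized propagator. -/
noncomputable def propCoeff (θ μ₀ ε : ℝ) (n : ℕ × ℕ) : ℝ :=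
  Real.exp (-(energy θ μ₀ n) * ε) / energy θ μ₀ n

theorem integral_exp_energy (μ₀ ε : ℝ) (n : ℕ × ℕ) :
    ∫ β in Set.Ioi ε, Real.exp (-(energy θ μ₀ n) * β) = propCoeff θ μ₀ ε n := by
  have := energy_pos (θ := θ) μ₀ n
  rw [integral_exp_mul_Ioi (by linarith), propCoeff, neg_div_neg_eq]

theorem propCoeff_nonneg (μ₀ ε : ℝ) (n : ℕ × ℕ) : 0 ≤ propCoeff θ μ₀ ε n :=
  div_nonneg (Real.exp_pos _).le (energy_pos μ₀ n).le

theorem propCoeff_le (μ₀ : ℝ) {ε : ℝ} (hε : 0 ≤ ε) (n : ℕ × ℕ) :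
    propCoeff θ μ₀ ε n ≤ 1 / (2 * freq θ) := by
  have := freq_pos θ
  have h1 := energy_pos (θ := θ) μ₀ n
  unfold propCoeff
  gcongr
  · rw [Real.exp_le_one_iff]; nlinarith
  · exact two_mul_freq_le_energy μ₀ n

theorem heat_mono (μ₀ β : ℝ) (n : ℕ × ℕ) (z : Fin 2 → ℂ) :
    heat θ μ₀ β (mono θ n) z = (Real.exp (-(energy θ μ₀ n) * β) : ℂ) * mono θ n z := by
  have h : (Real.exp (-(energy θ μ₀ n) * β) : ℂ) =
      Complex.exp (-(β : ℂ) * (2 * (freq θ : ℂ) + (μ₀ : ℂ) ^ 2)) *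
        (Complex.exp (-(2 * (freq θ : ℂ) * (β : ℂ))) ^ n.1 *
          Complex.exp (-(2 * (freq θ : ℂ) * (β : ℂ))) ^ n.2) := by
    rw [← Complex.exp_nat_mul, ← Complex.exp_nat_mul, ← Complex.exp_add, ← Complex.exp_add,
      Complex.ofReal_exp]
    congr 1
    unfold energy
    push_cast; ring
  rw [h, heat]
  simp only [mono, mono₁, Pi.smul_apply, smul_eq_mul, mul_pow]
  ring

theorem heat_eq_smul (μ₀ β : ℝ) (f : (Fin 2 → ℂ) → ℂ) (z : Fin 2 → ℂ) :
    heat θ μ₀ β f z = (Real.exp (-(2 * freq θ + μ₀ ^ 2) * β) : ℂ) *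
      f ((Real.exp (-(2 * freq θ) * β) : ℂ) • z) := by
  rw [heat]
  push_cast
  congr 2
  · ring_nf
  · ring_nf

theorem hasSum_heat (μ₀ β : ℝ) (η : BargmannSpace θ) (z : Fin 2 → ℂ) :
    HasSum (fun n => ⟪monomialState θ n, η⟫_ℂ *
      ((Real.exp (-(energy θ μ₀ n) * β) : ℂ) * mono θ n z)) (heat θ μ₀ β (toFun η) z) := by
  have h := (hasSum_toFun_mono η (Complex.exp (-(2 * (freq θ : ℂ) * (β : ℂ))) • z)).mul_left
    (Complex.exp (-(β : ℂ) * (2 * (freq θ : ℂ) + (μ₀ : ℂ) ^ 2)))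
  refine hasSum_of_eq h fun n => ?_
  rw [← heat_mono, heat]
  ring

/-- The diagonal operator with the eigenvalues of the regularized propagator. -/
noncomputable def propSum (μ₀ ε : ℝ) (η : BargmannSpace θ) : BargmannSpace θ :=
  ∑' n, ((propCoeff θ μ₀ ε n : ℂ) * ⟪monomialState θ n, η⟫_ℂ) • monomialState θ n

theorem hasSum_propSum (μ₀ : ℝ) {ε : ℝ} (hε : 0 ≤ ε) (η : BargmannSpace θ) :
    HasSum (fun n => ((propCoeff θ μ₀ ε n : ℂ) * ⟪monomialState θ n, η⟫_ℂ) • monomialState θ n)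
      (propSum μ₀ ε η) := by
  refine (summable_smul_monomialState ?_).hasSum
  refine Summable.of_nonneg_of_le (fun n => by positivity) (fun n => ?_)
    ((hasSum_norm_inner_sq η).summable.mul_left ((1 / (2 * freq θ)) ^ 2))
  rw [norm_mul, mul_pow, Complex.norm_real, Real.norm_of_nonneg (propCoeff_nonneg _ _ _)]
  have := propCoeff_nonneg (θ := θ) μ₀ ε n
  gcongr
  exact propCoeff_le μ₀ hε n

/-- The series over the monomials and the integral over the time can be exchanged. -/
theorem toFun_propSum (μ₀ : ℝ) {ε : ℝ} (hε : 0 ≤ ε) (η : BargmannSpace θ) (z : Fin 2 → ℂ) :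
    toFun (propSum μ₀ ε η) z = ∫ β in Set.Ioi ε, heat θ μ₀ β (toFun η) z := by
  have h1 := hasSum_toFun (hasSum_propSum μ₀ hε η) z
  simp only [toFun_smul_monomialState] at h1
  have hint : ∀ n, IntegrableOn (fun β : ℝ => ⟪monomialState θ n, η⟫_ℂ *
      ((Real.exp (-(energy θ μ₀ n) * β) : ℂ) * mono θ n z)) (Set.Ioi ε) := fun n => by
    refine Integrable.const_mul (Integrable.mul_const ?_ _) _
    exact (integrableOn_exp_mul_Ioi (by have := energy_pos (θ := θ) μ₀ n; linarith) ε).ofReal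
  have hnorm : ∀ n, ∫ β in Set.Ioi ε, ‖⟪monomialState θ n, η⟫_ℂ *
      ((Real.exp (-(energy θ μ₀ n) * β) : ℂ) * mono θ n z)‖ =
      propCoeff θ μ₀ ε n * ‖⟪monomialState θ n, η⟫_ℂ * mono θ n z‖ := fun n => by
    rw [← integral_exp_energy, ← integral_mul_const]
    congr 1; funext β
    rw [norm_mul, norm_mul, norm_mul, Complex.norm_real, Real.norm_of_nonneg (Real.exp_pos _).le]
    ring
  have hsum : Summable fun n => ∫ β in Set.Ioi ε, ‖⟪monomialState θ n, η⟫_ℂ *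
      ((Real.exp (-(energy θ μ₀ n) * β) : ℂ) * mono θ n z)‖ := by
    simp only [hnorm]
    refine Summable.of_nonneg_of_le
      (fun n => mul_nonneg (propCoeff_nonneg _ _ _) (norm_nonneg _)) (fun n => ?_)
      ((hasSum_toFun_mono η z).summable.norm.mul_left (1 / (2 * freq θ)))
    gcongr
    exact propCoeff_le μ₀ hε n
  have h2 := hasSum_integral_of_summable_integral_norm hint hsum
  have h3 : ∀ β : ℝ, (∑' n, ⟪monomialState θ n, η⟫_ℂ *
      ((Real.exp (-(energy θ μ₀ n) * β) : ℂ) * mono θ n z)) = heat θ μ₀ β (toFun η) z :=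
    fun β => (hasSum_heat μ₀ β η z).tsum_eq
  simp only [h3] at h2
  refine h1.unique (hasSum_of_eq h2 fun n => ?_)
  rw [integral_const_mul, integral_mul_const, integral_complex_ofReal, integral_exp_energy]
  ring

theorem propagator_eq_propSum (μ₀ : ℝ) {ε : ℝ} (hε : 0 ≤ ε) (η : BargmannSpace θ) :
    propagator μ₀ ε η = propSum μ₀ ε η :=
  ofFun_eq (funext (toFun_propSum μ₀ hε η))

theorem toFun_propagator (μ₀ : ℝ) {ε : ℝ} (hε : 0 ≤ ε) (η : BargmannSpace θ) (z : Fin 2 → ℂ) :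
    toFun (propagator μ₀ ε η) z = ∫ β in Set.Ioi ε, heat θ μ₀ β (toFun η) z := by
  rw [propagator_eq_propSum μ₀ hε, toFun_propSum μ₀ hε]

theorem inner_monomialState_propagator (μ₀ : ℝ) {ε : ℝ} (hε : 0 ≤ ε) (η : BargmannSpace θ)
    (n : ℕ × ℕ) : ⟪monomialState θ n, propagator μ₀ ε η⟫_ℂ =
      propCoeff θ μ₀ ε n * ⟪monomialState θ n, η⟫_ℂ := by
  rw [propagator_eq_propSum μ₀ hε]
  exact inner_eq_of_hasSum (hasSum_propSum μ₀ hε η) n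

theorem propagator_add (μ₀ : ℝ) {ε : ℝ} (hε : 0 ≤ ε) (η ξ : BargmannSpace θ) :
    propagator μ₀ ε (η + ξ) = propagator μ₀ ε η + propagator μ₀ ε ξ :=
  eq_of_inner_monomialState fun n => by
    simp only [inner_add_right, inner_monomialState_propagator μ₀ hε, mul_add]

theorem propagator_smul (μ₀ : ℝ) {ε : ℝ} (hε : 0 ≤ ε) (c : ℂ) (η : BargmannSpace θ) :
    propagator μ₀ ε (c • η) = c • propagator μ₀ ε η :=
  eq_of_inner_monomialState fun n => by
    simp only [inner_smul_bargmann_right, inner_monomialState_propagator μ₀ hε]; ring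

theorem propagator_J (μ₀ : ℝ) {ε : ℝ} (hε : 0 ≤ ε) (η : BargmannSpace θ) :
    propagator μ₀ ε (J η) = J (propagator μ₀ ε η) :=
  eq_of_inner_monomialState fun n => by
    simp only [inner_monomialState_J, inner_monomialState_propagator μ₀ hε, map_mul,
      Complex.conj_ofReal]

/-! ### Decay in phase space -/

/-- The function `φ` decays in phase space like `(1 + ‖z‖)⁻ˢ` with constant `C`, after
multiplication by the square root of the Gaussian weight. -/
def Decay (s : ℕ) (C : ℝ) (φ : BargmannSpace θ) : Prop :=
  ∀ z, (1 + ‖z‖) ^ s * ‖toFun φ z‖ ≤ C * Real.exp (freq θ / 2 * sqNorm z)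

theorem decay_zero (φ : BargmannSpace θ) : Decay 0 ‖φ‖ φ := fun z => by
  rw [pow_zero, one_mul]; exact norm_toFun_le φ z

theorem Decay.nonneg {s : ℕ} {C : ℝ} {φ : BargmannSpace θ} (h : Decay s C φ) : 0 ≤ C := by
  have h1 := h 0
  have h2 : 0 ≤ (1 + ‖(0 : Fin 2 → ℂ)‖) ^ s * ‖toFun φ 0‖ := by positivity
  exact nonneg_of_mul_nonneg_left (h2.trans h1) (Real.exp_pos _)

theorem Decay.mono {s s' : ℕ} {C C' : ℝ} {φ : BargmannSpace θ} (h : Decay s C φ) (hs : s' ≤ s)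
    (hC : C ≤ C') : Decay s' C' φ := fun z => by
  calc (1 + ‖z‖) ^ s' * ‖toFun φ z‖ ≤ (1 + ‖z‖) ^ s * ‖toFun φ z‖ := by
        gcongr; linarith [norm_nonneg z]
    _ ≤ C * Real.exp (freq θ / 2 * sqNorm z) := h z
    _ ≤ _ := by gcongr

theorem Decay.add {s : ℕ} {C C' : ℝ} {φ ψ : BargmannSpace θ} (h : Decay s C φ)
    (h' : Decay s C' ψ) : Decay s (C + C') (φ + ψ) := fun z => by
  rw [toFun_add, Pi.add_apply]
  calc (1 + ‖z‖) ^ s * ‖toFun φ z + toFun ψ z‖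
      ≤ (1 + ‖z‖) ^ s * (‖toFun φ z‖ + ‖toFun ψ z‖) := by gcongr; exact norm_add_le _ _
    _ ≤ _ := by rw [mul_add, add_mul]; exact add_le_add (h z) (h' z)

theorem Decay.smul {s : ℕ} {C : ℝ} {φ : BargmannSpace θ} (h : Decay s C φ) (c : ℂ) :
    Decay s (‖c‖ * C) (c • φ) := fun z => by
  rw [toFun_smul, Pi.smul_apply, smul_eq_mul, norm_mul, mul_left_comm, mul_assoc]
  exact mul_le_mul_of_nonneg_left (h z) (norm_nonneg _)

theorem norm_conj_pi (z : Fin 2 → ℂ) : ‖fun i => conj (z i)‖ = ‖z‖ := by simp [Pi.norm_def]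

theorem Decay.J {s : ℕ} {C : ℝ} {φ : BargmannSpace θ} (h : Decay s C φ) : Decay s C (J φ) :=
  fun z => by
    have := h fun i => conj (z i)
    rw [norm_conj_pi] at this
    simpa [toFun_J, sqNorm] using this

theorem Decay.norm_gauged_le {s : ℕ} {C : ℝ} {φ : BargmannSpace θ} (h : Decay s C φ)
    (z : Fin 2 → ℂ) : ‖gauged θ (toFun φ) z‖ ≤ C / (1 + ‖z‖) ^ s := by
  rw [norm_gauged, le_div_iff₀ (by positivity), Real.exp_neg, mul_assoc, inv_mul_le_iff₀
    (Real.exp_pos _), mul_comm (‖_‖), mul_comm (Real.exp _)]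
  exact h z

theorem one_add_pow_mul_exp_neg_le {a y : ℝ} (ha : 0 < a) (hy : 0 ≤ y) (s : ℕ) :
    (1 + y) ^ s * Real.exp (-(a * y ^ 2)) ≤ s.factorial * Real.exp (1 + 1 / (4 * a)) := by
  have h1 := Real.pow_div_factorial_le_exp (1 + y) (by linarith) s
  rw [div_le_iff₀ (by positivity)] at h1
  calc (1 + y) ^ s * Real.exp (-(a * y ^ 2))
      ≤ (Real.exp (1 + y) * s.factorial) * Real.exp (-(a * y ^ 2)) := by gcongr
    _ = s.factorial * Real.exp (1 + y + -(a * y ^ 2)) := by rw [Real.exp_add (1 + y)]; ring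
    _ ≤ _ := by
      refine mul_le_mul_of_nonneg_left (Real.exp_le_exp.2 ?_) (by positivity)
      have : 1 / (4 * a) - y + a * y ^ 2 = a * (y - 1 / (2 * a)) ^ 2 := by field_simp; ring
      have h3 : 0 ≤ a * (y - 1 / (2 * a)) ^ 2 := by positivity
      linarith

/-- The gain of one power of `1 + a` in the time integral of the propagator. -/
theorem integral_exp_mul_exp_le {ω a : ℝ} (hω : 0 < ω) (ha : 0 ≤ a) :
    IntegrableOn (fun β : ℝ => Real.exp (-(2 * ω) * β) *
      Real.exp (-(a * (1 - Real.exp (-(2 * ω) * β))))) (Set.Ioi 0) ∧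
    (1 + a) * ∫ β in Set.Ioi (0 : ℝ), Real.exp (-(2 * ω) * β) *
      Real.exp (-(a * (1 - Real.exp (-(2 * ω) * β)))) ≤ 1 / ω := by
  have hint0 : IntegrableOn (fun β : ℝ => Real.exp (-(2 * ω) * β)) (Set.Ioi 0) :=
    integrableOn_exp_mul_Ioi (by linarith) 0
  have hle : ∀ β ∈ Set.Ioi (0 : ℝ), Real.exp (-(2 * ω) * β) *
      Real.exp (-(a * (1 - Real.exp (-(2 * ω) * β)))) ≤ Real.exp (-(2 * ω) * β) := by
    intro β hβ
    have h1 : Real.exp (-(2 * ω) * β) ≤ 1 := by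
      rw [Real.exp_le_one_iff]; have : 0 < β := hβ; nlinarith
    have h2 : Real.exp (-(a * (1 - Real.exp (-(2 * ω) * β)))) ≤ 1 := by
      rw [Real.exp_le_one_iff]; nlinarith
    exact mul_le_of_le_one_right (Real.exp_pos _).le h2
  have hint : IntegrableOn (fun β : ℝ => Real.exp (-(2 * ω) * β) *
      Real.exp (-(a * (1 - Real.exp (-(2 * ω) * β))))) (Set.Ioi 0) := by
    refine Integrable.mono' hint0 (Continuous.aestronglyMeasurable (by fun_prop)) ?_
    filter_upwards [ae_restrict_mem measurableSet_Ioi] with β hβ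
    rw [Real.norm_of_nonneg (by positivity)]
    exact hle β hβ
  refine ⟨hint, ?_⟩
  have h1 : ∫ β in Set.Ioi (0 : ℝ), Real.exp (-(2 * ω) * β) *
      Real.exp (-(a * (1 - Real.exp (-(2 * ω) * β)))) ≤ 1 / (2 * ω) := by
    calc _ ≤ ∫ β in Set.Ioi (0 : ℝ), Real.exp (-(2 * ω) * β) :=
          setIntegral_mono_on hint hint0 measurableSet_Ioi hle
      _ = 1 / (2 * ω) := by
          rw [integral_exp_mul_Ioi (by linarith)]; simp
  have h2 : a * ∫ β in Set.Ioi (0 : ℝ), Real.exp (-(2 * ω) * β) *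
      Real.exp (-(a * (1 - Real.exp (-(2 * ω) * β)))) ≤ 1 / (2 * ω) := by
    -- up to the factor `-2ωa` the integrand is a derivative
    have hder : ∀ β ∈ Set.Ici (0 : ℝ), HasDerivAt
        (fun β : ℝ => Real.exp (-(a * (1 - Real.exp (-(2 * ω) * β)))))
        (-(2 * ω * a) * (Real.exp (-(2 * ω) * β) *
          Real.exp (-(a * (1 - Real.exp (-(2 * ω) * β)))))) β := by
      intro β _
      have e1 : HasDerivAt (fun β : ℝ => -(2 * ω) * β) (-(2 * ω)) β := by
        simpa using (hasDerivAt_id β).const_mul (-(2 * ω))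
      have e2 := (((e1.exp.const_sub 1).const_mul a).neg).exp
      refine e2.congr_deriv ?_
      simp only [Pi.neg_apply]
      ring
    have hlim : Tendsto (fun β : ℝ => Real.exp (-(a * (1 - Real.exp (-(2 * ω) * β))))) atTop
        (𝓝 (Real.exp (-(a * (1 - 0))))) := by
      have e3 : Tendsto (fun β : ℝ => Real.exp (-(2 * ω) * β)) atTop (𝓝 0) :=
        Real.tendsto_exp_atBot.comp
          (tendsto_id.const_mul_atTop_of_neg (by linarith : -(2 * ω) < 0))
      exact (Real.continuous_exp.tendsto _).comp ((((tendsto_const_nhds.sub e3)).const_mul a).neg)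
    have e4 := integral_Ioi_of_hasDerivAt_of_tendsto' hder (hint.const_mul _) hlim
    rw [integral_const_mul] at e4
    simp only [mul_zero, Real.exp_zero, sub_self, neg_zero] at e4
    have e5 := Real.exp_pos (-(a * (1 - 0)))
    rw [le_div_iff₀ (by positivity)]
    linarith
  have h3 : 1 / ω = 1 / (2 * ω) + 1 / (2 * ω) := by field_simp; norm_num
  rw [h3, add_mul, one_mul]
  exact add_le_add h1 h2

/-- The heat semigroup evaluates a function at `t z` with `t = e^{-2ωβ}`. By Peetre's inequality the
decay in `t z` becomes decay in `z` at the cost of the factor `(1 + (1 - t)‖z‖)ˢ`, which half of the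
Gaussian gain `exp(-(ω/2)(1 - t²)|z|²)` absorbs. -/
theorem norm_heat_le (μ₀ : ℝ) {β : ℝ} (hβ : 0 < β) {s : ℕ} {C : ℝ} {η : BargmannSpace θ}
    (h : Decay s C η) (z : Fin 2 → ℂ) :
    (1 + ‖z‖) ^ s * ‖heat θ μ₀ β (toFun η) z‖ ≤
      s.factorial * Real.exp (1 + 1 / (4 * (freq θ / 4))) * C *
        Real.exp (freq θ / 2 * sqNorm z) *
      (Real.exp (-(2 * freq θ) * β) *
        Real.exp (-(freq θ / 4 * ‖z‖ ^ 2 * (1 - Real.exp (-(2 * freq θ) * β))))) := by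
  have hω := freq_pos θ
  have hC := h.nonneg
  set t := Real.exp (-(2 * freq θ) * β) with ht
  have ht0 : 0 < t := Real.exp_pos _
  have ht1 : t ≤ 1 := by rw [ht, Real.exp_le_one_iff]; nlinarith
  have hz := norm_nonneg z
  have h1 := h ((t : ℂ) • z)
  have hn : ‖(t : ℂ) • z‖ = t * ‖z‖ := by
    rw [norm_smul, Complex.norm_real, Real.norm_of_nonneg ht0.le]
  have hq : sqNorm ((t : ℂ) • z) = t ^ 2 * sqNorm z := by
    simp only [sqNorm, Pi.smul_apply, smul_eq_mul, norm_mul, Complex.norm_real,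
      Real.norm_of_nonneg ht0.le, mul_pow, Finset.mul_sum]
  rw [hn, hq] at h1
  have hexp : Real.exp (-(2 * freq θ + μ₀ ^ 2) * β) ≤ t := by
    rw [ht, Real.exp_le_exp]
    nlinarith [mul_nonneg (sq_nonneg μ₀) hβ.le]
  have hy := one_add_pow_mul_exp_neg_le (a := freq θ / 4) (y := (1 - t) * ‖z‖) (by positivity)
    (mul_nonneg (by linarith) hz) s
  have hpeetre : (1 + ‖z‖) ^ s ≤ (1 + t * ‖z‖) ^ s * (1 + (1 - t) * ‖z‖) ^ s := by
    rw [← mul_pow]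
    gcongr
    have : 0 ≤ t * ‖z‖ * ((1 - t) * ‖z‖) := by
      have : 0 ≤ 1 - t := by linarith
      positivity
    nlinarith
  have h1t : 0 ≤ 1 - t := by linarith
  have hgauss : Real.exp (freq θ / 2 * (t ^ 2 * sqNorm z)) ≤
      Real.exp (freq θ / 2 * sqNorm z) * (Real.exp (-(freq θ / 4 * ((1 - t) * ‖z‖) ^ 2)) *
        Real.exp (-(freq θ / 4 * ‖z‖ ^ 2 * (1 - t)))) := by
    rw [← Real.exp_add, ← Real.exp_add, Real.exp_le_exp]
    have e1 := norm_sq_le_sqNorm z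
    have e2 : (1 - t) * ‖z‖ ^ 2 ≤ (1 - t ^ 2) * sqNorm z := by
      have : 1 - t ≤ 1 - t ^ 2 := by nlinarith
      have : 0 ≤ sqNorm z := sqNorm_nonneg z
      calc (1 - t) * ‖z‖ ^ 2 ≤ (1 - t) * sqNorm z := by gcongr
        _ ≤ _ := by gcongr
    have e3 : ((1 - t) * ‖z‖) ^ 2 ≤ (1 - t) * ‖z‖ ^ 2 := by
      rw [mul_pow]
      gcongr
      nlinarith
    nlinarith
  rw [heat_eq_smul, norm_mul, Complex.norm_real, Real.norm_of_nonneg (Real.exp_pos _).le]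
  calc (1 + ‖z‖) ^ s * (Real.exp (-(2 * freq θ + μ₀ ^ 2) * β) * ‖toFun η ((t : ℂ) • z)‖)
      ≤ ((1 + t * ‖z‖) ^ s * (1 + (1 - t) * ‖z‖) ^ s) * (t * ‖toFun η ((t : ℂ) • z)‖) := by
        gcongr
    _ = (1 + (1 - t) * ‖z‖) ^ s * t * ((1 + t * ‖z‖) ^ s * ‖toFun η ((t : ℂ) • z)‖) := by ring
    _ ≤ (1 + (1 - t) * ‖z‖) ^ s * t * (C * Real.exp (freq θ / 2 * (t ^ 2 * sqNorm z))) := by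
        gcongr
    _ ≤ (1 + (1 - t) * ‖z‖) ^ s * t * (C * (Real.exp (freq θ / 2 * sqNorm z) *
        (Real.exp (-(freq θ / 4 * ((1 - t) * ‖z‖) ^ 2)) *
          Real.exp (-(freq θ / 4 * ‖z‖ ^ 2 * (1 - t)))))) := by gcongr
    _ = ((1 + (1 - t) * ‖z‖) ^ s * Real.exp (-(freq θ / 4 * ((1 - t) * ‖z‖) ^ 2))) * C *
        Real.exp (freq θ / 2 * sqNorm z) *
        (t * Real.exp (-(freq θ / 4 * ‖z‖ ^ 2 * (1 - t)))) := by ring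
    _ ≤ _ := by gcongr

/-- The propagator improves the decay by two powers, uniformly in the regularization. -/
theorem exists_decay_propagator (θ : ℝ) [Fact (0 < θ)] (μ₀ : ℝ) (s : ℕ) : ∃ A : ℝ, 0 ≤ A ∧
    ∀ ε : ℝ, 0 ≤ ε → ∀ (C : ℝ) (η : BargmannSpace θ), Decay s C η →
      Decay (s + 2) (A * C) (propagator μ₀ ε η) := by
  have hω := freq_pos θ
  set M := s.factorial * Real.exp (1 + 1 / (4 * (freq θ / 4))) with hM
  refine ⟨M * ((2 + 8 / freq θ) * (1 / freq θ)), by positivity, fun ε hε C η h z => ?_⟩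
  have hC := h.nonneg
  obtain ⟨hint, hle⟩ := integral_exp_mul_exp_le hω (a := freq θ / 4 * ‖z‖ ^ 2) (by positivity)
  have hsub : Set.Ioi ε ⊆ Set.Ioi 0 := Set.Ioi_subset_Ioi hε
  set F : ℝ → ℝ := fun β => Real.exp (-(2 * freq θ) * β) *
    Real.exp (-(freq θ / 4 * ‖z‖ ^ 2 * (1 - Real.exp (-(2 * freq θ) * β)))) with hF
  have hz : 0 < (1 + ‖z‖) ^ s := by positivity
  have h1 : (1 + ‖z‖) ^ s * ‖toFun (propagator μ₀ ε η) z‖ ≤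
      M * C * Real.exp (freq θ / 2 * sqNorm z) * ∫ β in Set.Ioi (0 : ℝ), F β := by
    rw [toFun_propagator μ₀ hε, ← le_div_iff₀' hz]
    calc ‖∫ β in Set.Ioi ε, heat θ μ₀ β (toFun η) z‖
        ≤ ∫ β in Set.Ioi ε, M * C * Real.exp (freq θ / 2 * sqNorm z) * F β / (1 + ‖z‖) ^ s := by
          refine norm_integral_le_of_norm_le
            (((hint.mono_set hsub).const_mul _).div_const _) ?_
          filter_upwards [ae_restrict_mem measurableSet_Ioi] with β hβ
          rw [le_div_iff₀' hz]
          exact norm_heat_le μ₀ (hε.trans_lt hβ) h z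
      _ ≤ ∫ β in Set.Ioi 0, M * C * Real.exp (freq θ / 2 * sqNorm z) * F β / (1 + ‖z‖) ^ s := by
          refine setIntegral_mono_set ((hint.const_mul _).div_const _) (ae_of_all _ fun β => ?_)
            hsub.eventuallyLE
          simp only [Pi.zero_apply, hF]
          positivity
      _ = _ := by rw [integral_div, integral_const_mul]
  have h2 : (1 + ‖z‖) ^ 2 ≤ (2 + 8 / freq θ) * (1 + freq θ / 4 * ‖z‖ ^ 2) := by
    have : (2 + 8 / freq θ) * (1 + freq θ / 4 * ‖z‖ ^ 2) =
        2 + 2 * ‖z‖ ^ 2 + (8 / freq θ + freq θ / 2 * ‖z‖ ^ 2) := by field_simp; ring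
    rw [this]
    have : 0 ≤ 8 / freq θ + freq θ / 2 * ‖z‖ ^ 2 := by positivity
    nlinarith [sq_nonneg (1 - ‖z‖)]
  have hI : 0 ≤ ∫ β in Set.Ioi (0 : ℝ), F β := integral_nonneg fun β => by
    simp only [Pi.zero_apply, hF]; positivity
  calc (1 + ‖z‖) ^ (s + 2) * ‖toFun (propagator μ₀ ε η) z‖
      = (1 + ‖z‖) ^ 2 * ((1 + ‖z‖) ^ s * ‖toFun (propagator μ₀ ε η) z‖) := by ring
    _ ≤ ((2 + 8 / freq θ) * (1 + freq θ / 4 * ‖z‖ ^ 2)) *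
        (M * C * Real.exp (freq θ / 2 * sqNorm z) * ∫ β in Set.Ioi (0 : ℝ), F β) := by gcongr
    _ = M * C * Real.exp (freq θ / 2 * sqNorm z) * (2 + 8 / freq θ) *
        ((1 + freq θ / 4 * ‖z‖ ^ 2) * ∫ β in Set.Ioi (0 : ℝ), F β) := by ring
    _ ≤ M * C * Real.exp (freq θ / 2 * sqNorm z) * (2 + 8 / freq θ) * (1 / freq θ) := by gcongr
    _ = _ := by ring

/-- The regularization removes the times in `(0, ε]` from the propagator, an effect of order `ε`. -/
theorem decay_propagator_sub (μ₀ : ℝ) {ε : ℝ} (hε : 0 ≤ ε) {C : ℝ} {η : BargmannSpace θ}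
    (h : Decay 0 C η) :
    Decay 0 (Real.exp (1 + 1 / (4 * (freq θ / 4))) * C * ε)
      (propagator μ₀ ε η - propagator μ₀ 0 η) := by
  have hω := freq_pos θ
  have hC := h.nonneg
  intro z
  have hbound : ∀ β : ℝ, 0 < β → ‖heat θ μ₀ β (toFun η) z‖ ≤
      Real.exp (1 + 1 / (4 * (freq θ / 4))) * C * Real.exp (freq θ / 2 * sqNorm z) *
        Real.exp (-(2 * freq θ) * β) := by
    intro β hβ
    have h1 := norm_heat_le μ₀ hβ h z
    rw [pow_zero, one_mul, Nat.factorial_zero, Nat.cast_one, one_mul] at h1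
    refine h1.trans ?_
    have ht1 : Real.exp (-(2 * freq θ) * β) ≤ 1 := by rw [Real.exp_le_one_iff]; nlinarith
    have h2 : Real.exp (-(freq θ / 4 * ‖z‖ ^ 2 * (1 - Real.exp (-(2 * freq θ) * β)))) ≤ 1 := by
      rw [Real.exp_le_one_iff, neg_nonpos]
      have : 0 ≤ 1 - Real.exp (-(2 * freq θ) * β) := by linarith
      positivity
    gcongr
    exact mul_le_of_le_one_right (Real.exp_pos _).le h2
  have hcont : Continuous fun β : ℝ => heat θ μ₀ β (toFun η) z := by
    have := continuous_toFun η
    unfold heat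
    fun_prop
  have hint : IntegrableOn (fun β : ℝ => heat θ μ₀ β (toFun η) z) (Set.Ioi 0) := by
    refine Integrable.mono' ((integrableOn_exp_mul_Ioi (a := -(2 * freq θ))
      (by linarith) 0).const_mul
      (Real.exp (1 + 1 / (4 * (freq θ / 4))) * C * Real.exp (freq θ / 2 * sqNorm z))) hcont.aestronglyMeasurable ?_
    filter_upwards [ae_restrict_mem measurableSet_Ioi] with β hβ
    exact hbound β hβ
  have hsplit : ∫ β in Set.Ioi (0 : ℝ), heat θ μ₀ β (toFun η) z =
      (∫ β in Set.Ioc 0 ε, heat θ μ₀ β (toFun η) z) +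
        ∫ β in Set.Ioi ε, heat θ μ₀ β (toFun η) z := by
    rw [← setIntegral_union (Set.Ioc_disjoint_Ioi le_rfl) measurableSet_Ioi
      (hint.mono_set Set.Ioc_subset_Ioi_self) (hint.mono_set (Set.Ioi_subset_Ioi hε)),
      Set.Ioc_union_Ioi_eq_Ioi hε]
  have hfun : toFun (propagator μ₀ ε η - propagator μ₀ 0 η) z =
      -∫ β in Set.Ioc 0 ε, heat θ μ₀ β (toFun η) z := by
    rw [sub_eq_add_neg, ← neg_one_smul ℂ, toFun_add, toFun_smul, Pi.add_apply, Pi.smul_apply,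
      toFun_propagator μ₀ hε, toFun_propagator μ₀ le_rfl, hsplit, smul_eq_mul]
    ring
  rw [hfun, norm_neg, pow_zero, one_mul]
  have h3 := norm_setIntegral_le_of_norm_le_const (μ := volume) (s := Set.Ioc (0 : ℝ) ε)
    (f := fun β => heat θ μ₀ β (toFun η) z)
    (C := Real.exp (1 + 1 / (4 * (freq θ / 4))) * C * Real.exp (freq θ / 2 * sqNorm z))
    (by simp) (fun β hβ => (hbound β hβ.1).trans (mul_le_of_le_one_right (by positivity) (by
      rw [Real.exp_le_one_iff]; have := hβ.1; nlinarith)))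
  rw [Real.volume_real_Ioc_of_le hε, sub_zero] at h3
  linarith

end

/-! ### Lattice sums -/

/-- Peetre's inequality. -/
theorem one_add_norm_le_mul {E : Type*} [SeminormedAddCommGroup E] (x y : E) :
    1 + ‖x + y‖ ≤ (1 + ‖x‖) * (1 + ‖y‖) := by
  nlinarith [norm_add_le x y, mul_nonneg (norm_nonneg x) (norm_nonneg y)]

theorem latticePoint_add (θ : ℝ) (γ γ' : Lattice) :
    latticePoint θ (γ + γ') = latticePoint θ γ + latticePoint θ γ' := by
  funext i
  simp only [latticePoint, Prod.fst_add, Prod.snd_add, Pi.add_apply]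
  push_cast; ring

theorem latticePoint_neg (θ : ℝ) (γ : Lattice) : latticePoint θ (-γ) = -latticePoint θ γ := by
  funext i
  simp only [latticePoint, Prod.fst_neg, Prod.snd_neg, Pi.neg_apply]
  push_cast; ring

theorem latticePoint_sub (θ : ℝ) (γ γ' : Lattice) :
    latticePoint θ (γ - γ') = latticePoint θ γ - latticePoint θ γ' := by
  rw [sub_eq_add_neg, latticePoint_add, latticePoint_neg, sub_eq_add_neg]

theorem summable_int_inv_one_add_abs_sq :
    Summable fun n : ℤ => 1 / (1 + |(n : ℝ)|) ^ 2 := by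
  have h : Summable fun n : ℕ => 1 / (1 + |((n : ℤ) : ℝ)|) ^ 2 := by
    have h1 := (summable_nat_add_iff 1).2 (Real.summable_one_div_nat_pow.2 one_lt_two)
    refine h1.congr fun n => ?_
    rw [Int.cast_natCast, abs_of_nonneg (Nat.cast_nonneg n), add_comm]
    push_cast; rfl
  refine Summable.of_nat_of_neg h ?_
  refine h.congr fun n => ?_
  rw [Int.cast_neg, abs_neg]

theorem summable_mul_prod {α β : Type*} {f : α → ℝ} {g : β → ℝ} (hf : Summable f)
    (hg : Summable g) (hf0 : ∀ x, 0 ≤ f x) (hg0 : ∀ y, 0 ≤ g y) :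
    Summable fun p : α × β => f p.1 * g p.2 :=
  hf.mul_of_nonneg hg hf0 hg0

theorem summable_lattice_mul {f : ℤ → ℝ} (hf : Summable f) (hf0 : ∀ n, 0 ≤ f n) :
    Summable fun γ : Lattice => (f (γ.1 0) * f (γ.1 1)) * (f (γ.2 0) * f (γ.2 1)) := by
  have h1 : Summable fun p : ℤ × ℤ => f p.1 * f p.2 := summable_mul_prod hf hf hf0 hf0
  have h2 : Summable fun m : Fin 2 → ℤ => f (m 0) * f (m 1) :=
    ((finTwoArrowEquiv ℤ).summable_iff (f := fun p : ℤ × ℤ => f p.1 * f p.2)).2 h1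
  have h3 : ∀ m : Fin 2 → ℤ, 0 ≤ f (m 0) * f (m 1) := fun m => mul_nonneg (hf0 _) (hf0 _)
  exact summable_mul_prod h2 h2 h3 h3

section
variable {θ : ℝ} [hθ : Fact (0 < θ)]

theorem latticeConst_pos (θ : ℝ) [hθ : Fact (0 < θ)] : 0 < θ / Real.sqrt 2 :=
  div_pos hθ.out (by positivity)

theorem re_latticePoint (γ : Lattice) (i : Fin 2) :
    (latticePoint θ γ i).re = θ / Real.sqrt 2 * γ.1 i := by
  simp [latticePoint]

theorem im_latticePoint (γ : Lattice) (i : Fin 2) :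
    (latticePoint θ γ i).im = θ / Real.sqrt 2 * γ.2 i := by
  simp [latticePoint]

/-- The exponent `8` provides an inverse square for each of the four integer coordinates. -/
theorem summable_lattice_inv_pow :
    Summable fun γ : Lattice => 1 / (1 + ‖latticePoint θ γ‖) ^ 8 := by
  have ha := latticeConst_pos θ
  set a := θ / Real.sqrt 2 with ha'
  set c := min 1 a with hc
  have hc0 : 0 < c := lt_min one_pos ha
  obtain ⟨f, hf⟩ : ∃ f : ℤ → ℝ, ∀ n, f n = 1 / (1 + |(n : ℝ)|) ^ 2 := ⟨_, fun _ => rfl⟩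
  have hfs : Summable f := summable_int_inv_one_add_abs_sq.congr fun n => (hf n).symm
  have hf0 : ∀ n, 0 ≤ f n := fun n => by rw [hf]; positivity
  refine Summable.of_nonneg_of_le (fun _ => by positivity) (fun γ => ?_)
    ((summable_lattice_mul hfs hf0).mul_left (1 / c ^ 8))
  have key : ∀ x : ℝ, a * |x| ≤ ‖latticePoint θ γ‖ → c * (1 + |x|) ≤ 1 + ‖latticePoint θ γ‖ := by
    intro x hx
    have h1 : c * |x| ≤ a * |x| := mul_le_mul_of_nonneg_right (min_le_right _ _) (abs_nonneg _)
    have h2 : c ≤ 1 := min_le_left _ _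
    linarith
  have hre : ∀ i, a * |(γ.1 i : ℝ)| ≤ ‖latticePoint θ γ‖ := fun i => by
    refine le_trans ?_ (norm_le_pi_norm _ i)
    refine le_trans (le_of_eq ?_) (Complex.abs_re_le_norm _)
    rw [re_latticePoint, abs_mul, abs_of_pos ha]
  have him : ∀ i, a * |(γ.2 i : ℝ)| ≤ ‖latticePoint θ γ‖ := fun i => by
    refine le_trans ?_ (norm_le_pi_norm _ i)
    refine le_trans (le_of_eq ?_) (Complex.abs_im_le_norm _)
    rw [im_latticePoint, abs_mul, abs_of_pos ha]
  have k1 := key _ (hre 0)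
  have k2 := key _ (hre 1)
  have k3 := key _ (him 0)
  have k4 := key _ (him 1)
  have hprod : (c * (1 + |(γ.1 0 : ℝ)|)) ^ 2 * (c * (1 + |(γ.1 1 : ℝ)|)) ^ 2 *
      ((c * (1 + |(γ.2 0 : ℝ)|)) ^ 2 * (c * (1 + |(γ.2 1 : ℝ)|)) ^ 2) ≤
      (1 + ‖latticePoint θ γ‖) ^ 8 := by
    calc _ ≤ (1 + ‖latticePoint θ γ‖) ^ 2 * (1 + ‖latticePoint θ γ‖) ^ 2 *
          ((1 + ‖latticePoint θ γ‖) ^ 2 * (1 + ‖latticePoint θ γ‖) ^ 2) := by gcongr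
      _ = _ := by ring
  calc 1 / (1 + ‖latticePoint θ γ‖) ^ 8
      ≤ 1 / ((c * (1 + |(γ.1 0 : ℝ)|)) ^ 2 * (c * (1 + |(γ.1 1 : ℝ)|)) ^ 2 *
      ((c * (1 + |(γ.2 0 : ℝ)|)) ^ 2 * (c * (1 + |(γ.2 1 : ℝ)|)) ^ 2)) := by gcongr
    _ = _ := by simp only [hf]; field_simp

theorem exists_latticePoint_near (w : Fin 2 → ℂ) :
    ∃ γ : Lattice, ‖w - latticePoint θ γ‖ ≤ θ / Real.sqrt 2 := by
  have ha := latticeConst_pos θ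
  set a := θ / Real.sqrt 2 with ha'
  have key : ∀ x : ℝ, |x - a * round (x / a)| ≤ a / 2 := by
    intro x
    have h1 := abs_sub_round (x / a)
    have h2 : x - a * round (x / a) = a * (x / a - round (x / a)) := by field_simp
    rw [h2, abs_mul, abs_of_pos ha]
    nlinarith
  refine ⟨(fun i => round ((w i).re / a), fun i => round ((w i).im / a)), ?_⟩
  rw [pi_norm_le_iff_of_nonneg ha.le]
  intro i
  refine (Complex.norm_le_abs_re_add_abs_im _).trans ?_
  rw [Pi.sub_apply, Complex.sub_re, Complex.sub_im, re_latticePoint, im_latticePoint]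
  have := key (w i).re
  have := key (w i).im
  linarith

/-- Lattice sums are bounded uniformly in the shift `w`, which lies in a bounded set modulo the
lattice. -/
theorem exists_tsum_lattice_le (θ : ℝ) [hθ : Fact (0 < θ)] : ∃ A : ℝ, 0 ≤ A ∧
    ∀ w : Fin 2 → ℂ, Summable (fun γ : Lattice => 1 / (1 + ‖w + latticePoint θ γ‖) ^ 8) ∧
      ∑' γ : Lattice, 1 / (1 + ‖w + latticePoint θ γ‖) ^ 8 ≤ A := by
  have ha := latticeConst_pos θ
  refine ⟨(1 + θ / Real.sqrt 2) ^ 8 * ∑' γ : Lattice, 1 / (1 + ‖latticePoint θ γ‖) ^ 8,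
    mul_nonneg (by positivity) (tsum_nonneg fun _ => by positivity), fun w => ?_⟩
  obtain ⟨γ₀, hγ₀⟩ := exists_latticePoint_near (θ := θ) w
  have hle : ∀ γ : Lattice, 1 / (1 + ‖w + latticePoint θ γ‖) ^ 8 ≤
      (1 + θ / Real.sqrt 2) ^ 8 * (1 / (1 + ‖latticePoint θ (γ₀ + γ)‖) ^ 8) := by
    intro γ
    have h1 := one_add_norm_le_mul (latticePoint θ γ₀ - w) (w + latticePoint θ γ)
    have h0 : latticePoint θ γ₀ - w + (w + latticePoint θ γ) = latticePoint θ (γ₀ + γ) := by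
      rw [latticePoint_add]; abel
    rw [h0, norm_sub_rev] at h1
    have h2 : 1 + ‖latticePoint θ (γ₀ + γ)‖ ≤
        (1 + θ / Real.sqrt 2) * (1 + ‖w + latticePoint θ γ‖) := by
      refine h1.trans ?_
      gcongr
    rw [mul_one_div, div_le_div_iff₀ (by positivity) (by positivity), one_mul, ← mul_pow]
    gcongr
  have hs : Summable fun γ : Lattice => (1 + θ / Real.sqrt 2) ^ 8 *
      (1 / (1 + ‖latticePoint θ (γ₀ + γ)‖) ^ 8) :=
    (((Equiv.addLeft γ₀).summable_iff
      (f := fun γ : Lattice => 1 / (1 + ‖latticePoint θ γ‖) ^ 8)).2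
      summable_lattice_inv_pow).mul_left _
  have hs' := Summable.of_nonneg_of_le (fun _ => by positivity) hle hs
  refine ⟨hs', (hs'.tsum_le_tsum hle hs).trans (le_of_eq ?_)⟩
  rw [tsum_mul_left]
  congr 1
  exact (Equiv.addLeft γ₀).tsum_eq (fun γ : Lattice => 1 / (1 + ‖latticePoint θ γ‖) ^ 8)

end

/-! ### Bessel systems -/

section Bessel
variable {E Γ : Type*} [NormedAddCommGroup E] [InnerProductSpace ℂ E] [AddCommGroup Γ]
  {v : Γ → E} {g : Γ → ℝ}

/-- Schur's test for a Gram matrix that is dominated by a summable convolution kernel. -/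
theorem norm_sum_smul_sq_le (hg : Summable g) (hg0 : ∀ γ, 0 ≤ g γ)
    (h : ∀ γ γ', ‖⟪v γ, v γ'⟫_ℂ‖ ≤ g (γ - γ')) (S : Finset Γ) (a : Γ → ℂ) :
    ‖∑ γ ∈ S, a γ • v γ‖ ^ 2 ≤ (∑' γ, g γ) * ∑ γ ∈ S, ‖a γ‖ ^ 2 := by
  have h1 : ∀ γ, ∑ γ' ∈ S, g (γ - γ') ≤ ∑' γ, g γ := fun γ => by
    rw [← (Equiv.subLeft γ).tsum_eq g]
    exact Summable.sum_le_tsum S (fun _ _ => hg0 _) ((Equiv.subLeft γ).summable_iff.2 hg)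
  have h2 : ∀ γ', ∑ γ ∈ S, g (γ - γ') ≤ ∑' γ, g γ := fun γ' => by
    rw [← (Equiv.subRight γ').tsum_eq g]
    exact Summable.sum_le_tsum S (fun _ _ => hg0 _) ((Equiv.subRight γ').summable_iff.2 hg)
  have h3 : ‖∑ γ ∈ S, a γ • v γ‖ ^ 2 =
      ‖∑ γ ∈ S, ∑ γ' ∈ S, conj (a γ) * (a γ' * ⟪v γ, v γ'⟫_ℂ)‖ := by
    have h0 : ‖∑ γ ∈ S, a γ • v γ‖ ^ 2 =
        ‖⟪∑ γ ∈ S, a γ • v γ, ∑ γ ∈ S, a γ • v γ⟫_ℂ‖ := by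
      rw [inner_self_eq_norm_sq_to_K, norm_pow]
      simp
    rw [h0]
    rw [sum_inner]
    congr 1
    refine Finset.sum_congr rfl fun γ _ => ?_
    rw [inner_sum]
    refine Finset.sum_congr rfl fun γ' _ => ?_
    rw [inner_smul_left, inner_smul_right]
  rw [h3]
  calc _ ≤ ∑ γ ∈ S, ∑ γ' ∈ S, ‖conj (a γ) * (a γ' * ⟪v γ, v γ'⟫_ℂ)‖ :=
        (norm_sum_le _ _).trans (Finset.sum_le_sum fun γ _ => norm_sum_le _ _)
    _ ≤ ∑ γ ∈ S, ∑ γ' ∈ S, (1 / 2 * (‖a γ‖ ^ 2 * g (γ - γ')) +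
          1 / 2 * (‖a γ'‖ ^ 2 * g (γ - γ'))) := by
        refine Finset.sum_le_sum fun γ _ => Finset.sum_le_sum fun γ' _ => ?_
        rw [norm_mul, norm_mul, RCLike.norm_conj, ← mul_assoc]
        calc ‖a γ‖ * ‖a γ'‖ * ‖⟪v γ, v γ'⟫_ℂ‖ ≤ ‖a γ‖ * ‖a γ'‖ * g (γ - γ') := by
              gcongr; exact h _ _
          _ ≤ (1 / 2 * (‖a γ‖ ^ 2 + ‖a γ'‖ ^ 2)) * g (γ - γ') := by
              refine mul_le_mul_of_nonneg_right ?_ (hg0 _)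
              nlinarith [sq_nonneg (‖a γ‖ - ‖a γ'‖)]
          _ = _ := by ring
    _ = 1 / 2 * ∑ γ ∈ S, ‖a γ‖ ^ 2 * ∑ γ' ∈ S, g (γ - γ') +
          1 / 2 * ∑ γ' ∈ S, ‖a γ'‖ ^ 2 * ∑ γ ∈ S, g (γ - γ') := by
        simp only [Finset.sum_add_distrib, ← Finset.mul_sum]
        congr 2
        rw [Finset.sum_comm]
        simp only [← Finset.mul_sum]
    _ ≤ 1 / 2 * ∑ γ ∈ S, ‖a γ‖ ^ 2 * (∑' γ, g γ) +
          1 / 2 * ∑ γ' ∈ S, ‖a γ'‖ ^ 2 * (∑' γ, g γ) := by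
        gcongr with γ _ γ' _
        · exact h1 γ
        · exact h2 γ'
    _ = _ := by rw [← Finset.sum_mul]; ring

/-- Bessel's inequality: the coefficients with respect to such a system are square summable. -/
theorem summable_norm_inner_sq (hg : Summable g) (hg0 : ∀ γ, 0 ≤ g γ)
    (h : ∀ γ γ', ‖⟪v γ, v γ'⟫_ℂ‖ ≤ g (γ - γ')) (η : E) :
    Summable fun γ => ‖⟪v γ, η⟫_ℂ‖ ^ 2 := by
  refine summable_of_sum_le (c := (∑' γ, g γ) * ‖η‖ ^ 2) (fun _ => by positivity) fun S => ?_
  set X := ∑ γ ∈ S, ‖⟪v γ, η⟫_ℂ‖ ^ 2 with hX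
  set G := ∑' γ, g γ with hG
  have hG0 : 0 ≤ G := tsum_nonneg hg0
  have hX0 : 0 ≤ X := Finset.sum_nonneg fun _ _ => by positivity
  have h1 := norm_sum_smul_sq_le hg hg0 h S fun γ => ⟪v γ, η⟫_ℂ
  have h2 : X ≤ ‖∑ γ ∈ S, ⟪v γ, η⟫_ℂ • v γ‖ * ‖η‖ := by
    have h3 : ⟪∑ γ ∈ S, ⟪v γ, η⟫_ℂ • v γ, η⟫_ℂ = (X : ℂ) := by
      rw [sum_inner, hX, Complex.ofReal_sum]
      refine Finset.sum_congr rfl fun γ _ => ?_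
      rw [inner_smul_left, ← Complex.normSq_eq_conj_mul_self, Complex.normSq_eq_norm_sq]
    have h4 := norm_inner_le_norm (𝕜 := ℂ) (∑ γ ∈ S, ⟪v γ, η⟫_ℂ • v γ) η
    rwa [h3, Complex.norm_real, Real.norm_of_nonneg hX0] at h4
  have h5 : X ^ 2 ≤ (G * X) * ‖η‖ ^ 2 := by
    calc X ^ 2 ≤ (‖∑ γ ∈ S, ⟪v γ, η⟫_ℂ • v γ‖ * ‖η‖) ^ 2 := by gcongr
      _ = ‖∑ γ ∈ S, ⟪v γ, η⟫_ℂ • v γ‖ ^ 2 * ‖η‖ ^ 2 := by ring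
      _ ≤ _ := by gcongr
  rcases hX0.eq_or_lt with h0 | h0
  · rw [← h0]; positivity
  · refine le_of_mul_le_mul_left ?_ h0
    linarith

/-- Square summable coefficients give unconditionally convergent series over such a system. -/
theorem summable_smul_of_gram [CompleteSpace E] (hg : Summable g) (hg0 : ∀ γ, 0 ≤ g γ)
    (h : ∀ γ γ', ‖⟪v γ, v γ'⟫_ℂ‖ ≤ g (γ - γ')) {a : Γ → ℂ} (ha : Summable fun γ => ‖a γ‖ ^ 2) :
    Summable fun γ => a γ • v γ := by
  rw [summable_iff_vanishing_norm]
  intro ε hε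
  have hG0 : 0 ≤ ∑' γ, g γ := tsum_nonneg hg0
  obtain ⟨s, hs⟩ := summable_iff_vanishing_norm.1 ha (ε ^ 2 / (∑' γ, g γ + 1)) (by positivity)
  refine ⟨s, fun t ht => ?_⟩
  have h1 := hs t ht
  rw [Real.norm_of_nonneg (Finset.sum_nonneg fun _ _ => by positivity),
    lt_div_iff₀ (by positivity)] at h1
  have h2 := norm_sum_smul_sq_le hg hg0 h t a
  have h3 : 0 ≤ ∑ γ ∈ t, ‖a γ‖ ^ 2 := Finset.sum_nonneg fun _ _ => by positivity
  refine lt_of_pow_lt_pow_left₀ 2 hε.le ?_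
  nlinarith

end Bessel

/-! ### Matrix coefficients of translations and the module action -/

section
variable {θ : ℝ} [hθ : Fact (0 < θ)]

theorem integrable_inv_one_add_norm_pow :
    Integrable fun z : Fin 2 → ℂ => 1 / (1 + ‖z‖) ^ 5 := by
  have h : (Module.finrank ℝ (Fin 2 → ℂ) : ℝ) < 5 := by
    rw [Module.finrank_pi_fintype]; simp; norm_num
  refine (integrable_one_add_norm (μ := volume) h).congr (ae_of_all _ fun z => ?_)
  have h0 : (0 : ℝ) ≤ 1 + ‖z‖ := by positivity
  show (1 + ‖z‖) ^ (-5 : ℝ) = _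
  rw [Real.rpow_neg h0, ← one_div]
  norm_cast

/-- The constant in the bound on inner products of functions that are localized in phase space. -/
noncomputable def innerConst (θ : ℝ) : ℝ :=
  (freq θ / Real.pi) ^ 2 * ∫ z : Fin 2 → ℂ, 1 / (1 + ‖z‖) ^ 5

theorem innerConst_nonneg (θ : ℝ) : 0 ≤ innerConst θ :=
  mul_nonneg (by positivity) (integral_nonneg fun _ => by positivity)

/-- By Peetre's inequality functions that are localized near the points `-v` and `-u` have a small
overlap. Five of the powers are spent on integrability over the four real dimensions of `ℂ²`. -/
theorem norm_inner_le_of_gauged {s : ℕ} {C C' : ℝ} (hC : 0 ≤ C) (hC' : 0 ≤ C')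
    {x y : BargmannSpace θ} {v u : Fin 2 → ℂ}
    (hx : ∀ z, ‖gauged θ (toFun x) z‖ ≤ C / (1 + ‖z + v‖) ^ (s + 5))
    (hy : ∀ z, ‖gauged θ (toFun y) z‖ ≤ C' / (1 + ‖z + u‖) ^ s) :
    ‖⟪x, y⟫_ℂ‖ ≤ innerConst θ * (C * C') / (1 + ‖v - u‖) ^ s := by
  have hpt : ∀ z, ‖conj (gauged θ (toFun x) z) * gauged θ (toFun y) z‖ ≤
      C * C' / (1 + ‖v - u‖) ^ s * (1 / (1 + ‖z + v‖) ^ 5) := by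
    intro z
    have h1 : 1 + ‖v - u‖ ≤ (1 + ‖z + v‖) * (1 + ‖z + u‖) := by
      have := one_add_norm_le_mul (z + v) (-(z + u))
      rw [norm_neg] at this
      rwa [show z + v + -(z + u) = v - u by abel] at this
    rw [norm_mul, RCLike.norm_conj]
    calc _ ≤ C / (1 + ‖z + v‖) ^ (s + 5) * (C' / (1 + ‖z + u‖) ^ s) :=
          mul_le_mul (hx z) (hy z) (norm_nonneg _) (by positivity)
      _ = C * C' * (1 / ((1 + ‖z + v‖) * (1 + ‖z + u‖)) ^ s) * (1 / (1 + ‖z + v‖) ^ 5) := by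
          rw [pow_add, mul_pow]; field_simp
      _ ≤ C * C' * (1 / (1 + ‖v - u‖) ^ s) * (1 / (1 + ‖z + v‖) ^ 5) := by gcongr
      _ = _ := by ring
  have hint : Integrable fun z : Fin 2 → ℂ =>
      C * C' / (1 + ‖v - u‖) ^ s * (1 / (1 + ‖z + v‖) ^ 5) :=
    (integrable_inv_one_add_norm_pow.comp_add_right v).const_mul _
  rw [inner_eq_integral_gauged, norm_mul, Complex.norm_real,
    Real.norm_of_nonneg (by positivity : (0 : ℝ) ≤ (freq θ / Real.pi) ^ 2)]
  calc _ ≤ (freq θ / Real.pi) ^ 2 *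
        ∫ z : Fin 2 → ℂ, C * C' / (1 + ‖v - u‖) ^ s * (1 / (1 + ‖z + v‖) ^ 5) := by
        gcongr
        exact norm_integral_le_of_norm_le hint (ae_of_all _ hpt)
    _ = _ := by
        rw [integral_const_mul,
          integral_add_right_eq_self (fun z : Fin 2 → ℂ => 1 / (1 + ‖z‖) ^ 5) v, innerConst]
        ring

theorem Decay.norm_gauged_translation_le {s : ℕ} {C : ℝ} {φ : BargmannSpace θ} (h : Decay s C φ)
    (v z : Fin 2 → ℂ) : ‖gauged θ (toFun (translation θ v φ)) z‖ ≤ C / (1 + ‖z + v‖) ^ s := by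
  rw [toFun_translation, norm_gauged_transFun]
  exact h.norm_gauged_le _

theorem norm_inner_translation_le {s : ℕ} {C C' : ℝ} {x y : BargmannSpace θ}
    (hx : Decay (s + 5) C x) (hy : Decay s C' y) (v u : Fin 2 → ℂ) :
    ‖⟪translation θ v x, translation θ u y⟫_ℂ‖ ≤
      innerConst θ * (C * C') / (1 + ‖v - u‖) ^ s :=
  norm_inner_le_of_gauged hx.nonneg hy.nonneg (hx.norm_gauged_translation_le v)
    (hy.norm_gauged_translation_le u)

theorem pairing_eq_inner_actU (χ φ : BargmannSpace θ) (γ : Lattice) :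
    pairing χ φ γ = ⟪actU χ γ, φ⟫_ℂ := by
  rw [pairing_apply, actU, latticePoint_neg, inner_translation_neg, actU]

theorem pairing_neg_eq_conj (χ φ : BargmannSpace θ) (γ : Lattice) :
    pairing χ φ (-γ) = conj (pairing φ χ γ) := by
  rw [pairing_apply, pairing_eq_inner_actU, neg_neg, inner_conj_symm]

theorem norm_pairing_le {s : ℕ} {C C' : ℝ} {χ φ : BargmannSpace θ}
    (hχ : Decay (s + 5) C χ) (hφ : Decay s C' φ) (γ : Lattice) :
    ‖pairing χ φ γ‖ ≤ innerConst θ * (C * C') / (1 + ‖latticePoint θ γ‖) ^ s := by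
  rw [pairing_apply]
  have h := norm_inner_le_of_gauged (v := 0) hχ.nonneg hφ.nonneg
    (fun z => by rw [add_zero]; exact hχ.norm_gauged_le z)
    (hφ.norm_gauged_translation_le (latticePoint θ (-γ)))
  rwa [zero_sub, latticePoint_neg, neg_neg, ← latticePoint_neg] at h

theorem norm_pairing_le' {s : ℕ} {C C' : ℝ} {χ φ : BargmannSpace θ}
    (hχ : Decay s C χ) (hφ : Decay (s + 5) C' φ) (γ : Lattice) :
    ‖pairing χ φ γ‖ ≤ innerConst θ * (C * C') / (1 + ‖latticePoint θ γ‖) ^ s := by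
  have h := norm_pairing_le hφ hχ (-γ)
  rwa [pairing_neg_eq_conj, RCLike.norm_conj, latticePoint_neg, norm_neg, mul_comm C'] at h

theorem norm_translation (v : Fin 2 → ℂ) (φ : BargmannSpace θ) : ‖translation θ v φ‖ = ‖φ‖ := by
  have h := inner_translation_translation v φ φ
  rw [inner_self_eq_norm_sq_to_K, inner_self_eq_norm_sq_to_K] at h
  have h' : ‖translation θ v φ‖ ^ 2 = ‖φ‖ ^ 2 := by exact_mod_cast h
  exact (pow_left_inj₀ (norm_nonneg _) (norm_nonneg _) two_ne_zero).1 h'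

theorem norm_actU (φ : BargmannSpace θ) (γ : Lattice) : ‖actU φ γ‖ = ‖φ‖ := norm_translation _ _

/-- The rapid decay that is used of the elements of the smooth module. The order `20` exceeds
`6 + 8 + 5`: decay of order `6` is propagated through a vertex, `8` powers make a sum over the lattice
converge, and `5` an integral over phase space. -/
def Nice (φ : BargmannSpace θ) : Prop := ∃ C, Decay 20 C φ

theorem Nice.J {φ : BargmannSpace θ} (h : Nice φ) : Nice (J φ) :=
  let ⟨C, hC⟩ := h; ⟨C, hC.J⟩

/-- The translates of a rapidly decaying function over the lattice form a Bessel system. -/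
theorem Nice.exists_gram {φ : BargmannSpace θ} (h : Nice φ) : ∃ g : Lattice → ℝ, Summable g ∧
    (∀ γ, 0 ≤ g γ) ∧ ∀ γ γ', ‖⟪actU φ γ, actU φ γ'⟫_ℂ‖ ≤ g (γ - γ') := by
  obtain ⟨C, hC⟩ := h
  have hC0 := hC.nonneg
  have hA := innerConst_nonneg θ
  refine ⟨fun γ => innerConst θ * (C * C) * (1 / (1 + ‖latticePoint θ γ‖) ^ 8),
    summable_lattice_inv_pow.mul_left _, fun γ => by positivity, fun γ γ' => ?_⟩
  show _ ≤ innerConst θ * (C * C) * (1 / (1 + ‖latticePoint θ (γ - γ')‖) ^ 8)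
  rw [latticePoint_sub, mul_one_div]
  exact norm_inner_translation_le (s := 8) (hC.mono (by norm_num) le_rfl)
    (hC.mono (by norm_num) le_rfl) _ _

/-- The coefficients are absolutely summable, and the translations are isometries. -/
theorem summable_pairing_smul_actU {χ φ : BargmannSpace θ} (hχ : Nice χ) (hφ : Nice φ)
    (η : BargmannSpace θ) : Summable fun γ => pairing χ φ γ • actU η γ := by
  obtain ⟨C, hC⟩ := hχ
  obtain ⟨C', hC'⟩ := hφ
  refine Summable.of_norm_bounded (g := fun γ => innerConst θ * (C * C') * ‖η‖ *
    (1 / (1 + ‖latticePoint θ γ‖) ^ 8)) (summable_lattice_inv_pow.mul_left _) fun γ => ?_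
  rw [norm_smul, norm_actU]
  have := norm_pairing_le (s := 8) (hC.mono (by norm_num) le_rfl)
    (hC'.mono (by norm_num) le_rfl) γ
  calc _ ≤ innerConst θ * (C * C') / (1 + ‖latticePoint θ γ‖) ^ 8 * ‖η‖ := by gcongr
    _ = _ := by ring

/-- The coefficients are square summable by Bessel's inequality for the translates of `χ`, and the
translates of `φ` form a Bessel system. -/
theorem summable_pairing_smul_actU_right {χ φ : BargmannSpace θ} (hχ : Nice χ) (hφ : Nice φ)
    (η : BargmannSpace θ) : Summable fun γ => pairing χ η γ • actU φ γ := by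
  obtain ⟨g, hg, hg0, h⟩ := hφ.exists_gram
  obtain ⟨g', hg', hg0', h'⟩ := hχ.exists_gram
  refine summable_smul_of_gram (E := BargmannSpace θ) (v := actU φ) hg hg0 h ?_
  simp only [pairing_eq_inner_actU]
  exact summable_norm_inner_sq (E := BargmannSpace θ) (v := actU χ) hg' hg0' h' η

theorem summable_pairing_smul_actU_left {χ φ : BargmannSpace θ} (hχ : Nice χ) (hφ : Nice φ)
    (η : BargmannSpace θ) : Summable fun γ => pairing η χ γ • actU φ γ := by
  obtain ⟨g, hg, hg0, h⟩ := hφ.exists_gram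
  obtain ⟨g', hg', hg0', h'⟩ := hχ.exists_gram
  refine summable_smul_of_gram (E := BargmannSpace θ) (v := actU φ) hg hg0 h ?_
  have h1 := ((Equiv.neg Lattice).summable_iff).2 (summable_norm_inner_sq (E := BargmannSpace θ) (v := actU χ) hg' hg0' h' η)
  refine h1.congr fun γ => ?_
  rw [Function.comp_apply, Equiv.neg_apply, ← pairing_eq_inner_actU, pairing_neg_eq_conj,
    RCLike.norm_conj]

/-! ### The trilinear product -/

/-- The product `a (b̄, c)_A`, made linear in all three arguments by means of the conjugation. -/
noncomputable def tri (a b c : BargmannSpace θ) : BargmannSpace θ := act a (pairing (J b) c)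

/-- Convergence of the lattice sum that defines the trilinear product. -/
def TriSummable (a b c : BargmannSpace θ) : Prop :=
  Summable fun γ => pairing (J b) c γ • actU a γ

theorem triSummable₁ (a : BargmannSpace θ) {b c : BargmannSpace θ} (hb : Nice b) (hc : Nice c) :
    TriSummable a b c := summable_pairing_smul_actU hb.J hc a

theorem triSummable₂ {a : BargmannSpace θ} (b : BargmannSpace θ) {c : BargmannSpace θ}
    (ha : Nice a) (hc : Nice c) : TriSummable a b c := summable_pairing_smul_actU_left hc ha _

theorem triSummable₃ {a b : BargmannSpace θ} (c : BargmannSpace θ) (ha : Nice a) (hb : Nice b) :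
    TriSummable a b c := summable_pairing_smul_actU_right hb.J ha c

theorem TriSummable.hasSum {a b c : BargmannSpace θ} (h : TriSummable a b c) :
    HasSum (fun γ => pairing (J b) c γ • actU a γ) (tri a b c) := Summable.hasSum h

theorem actU_add (φ ψ : BargmannSpace θ) (γ : Lattice) :
    actU (φ + ψ) γ = actU φ γ + actU ψ γ := translation_add _ _ _

theorem actU_smul (c : ℂ) (φ : BargmannSpace θ) (γ : Lattice) :
    actU (c • φ) γ = c • actU φ γ := translation_smul _ _ _

theorem pairing_add_right (χ φ ψ : BargmannSpace θ) (γ : Lattice) :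
    pairing χ (φ + ψ) γ = pairing χ φ γ + pairing χ ψ γ := by
  rw [pairing_apply, actU_add, inner_add_right]; rfl

theorem pairing_smul_right (χ : BargmannSpace θ) (c : ℂ) (φ : BargmannSpace θ) (γ : Lattice) :
    pairing χ (c • φ) γ = c * pairing χ φ γ := by
  rw [pairing_apply, actU_smul, inner_smul_bargmann_right]; rfl

theorem pairing_J_add (b b' φ : BargmannSpace θ) (γ : Lattice) :
    pairing (J (b + b')) φ γ = pairing (J b) φ γ + pairing (J b') φ γ := by
  rw [pairing_apply, J_add, inner_add_left]; rfl

theorem pairing_J_smul (c : ℂ) (b φ : BargmannSpace θ) (γ : Lattice) :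
    pairing (J (c • b)) φ γ = c * pairing (J b) φ γ := by
  rw [pairing_apply, J_smul, inner_smul_bargmann_left, Complex.conj_conj]; rfl

theorem tri_add₁ {a a' b c : BargmannSpace θ} (h : TriSummable a b c) (h' : TriSummable a' b c) :
    tri (a + a') b c = tri a b c + tri a' b c :=
  (hasSum_of_eq (h.hasSum.add h'.hasSum) fun γ => by rw [actU_add, smul_add]).tsum_eq

theorem tri_add₂ {a b b' c : BargmannSpace θ} (h : TriSummable a b c) (h' : TriSummable a b' c) :
    tri a (b + b') c = tri a b c + tri a b' c :=
  (hasSum_of_eq (h.hasSum.add h'.hasSum) fun γ => by rw [pairing_J_add, add_smul]).tsum_eq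

theorem tri_add₃ {a b c c' : BargmannSpace θ} (h : TriSummable a b c) (h' : TriSummable a b c') :
    tri a b (c + c') = tri a b c + tri a b c' :=
  (hasSum_of_eq (h.hasSum.add h'.hasSum) fun γ => by rw [pairing_add_right, add_smul]).tsum_eq

theorem tri_smul₁ {a b c : BargmannSpace θ} (h : TriSummable a b c) (r : ℂ) :
    tri (r • a) b c = r • tri a b c :=
  (hasSum_of_eq (h.hasSum.const_smul r) fun γ => by rw [actU_smul, smul_comm]).tsum_eq

theorem tri_smul₂ {a b c : BargmannSpace θ} (h : TriSummable a b c) (r : ℂ) :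
    tri a (r • b) c = r • tri a b c :=
  (hasSum_of_eq (h.hasSum.const_smul r) fun γ => by rw [pairing_J_smul, mul_smul]).tsum_eq

theorem tri_smul₃ {a b c : BargmannSpace θ} (h : TriSummable a b c) (r : ℂ) :
    tri a b (r • c) = r • tri a b c :=
  (hasSum_of_eq (h.hasSum.const_smul r) fun γ => by rw [pairing_smul_right, mul_smul]).tsum_eq

/-- Complex conjugation of the index lattice. -/
def latticeConj : Lattice ≃ Lattice := (Equiv.refl _).prodCongr (Equiv.neg _)

theorem latticePoint_latticeConj (γ : Lattice) :
    latticePoint θ (latticeConj γ) = fun i => conj (latticePoint θ γ i) := by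
  funext i
  simp [latticePoint, latticeConj]

theorem J_translation (v : Fin 2 → ℂ) (φ : BargmannSpace θ) :
    J (translation θ v φ) = translation θ (fun i => conj (v i)) (J φ) := by
  apply toFun_injective
  funext z
  rw [toFun_J, toFun_translation, toFun_translation, transFun, transFun, toFun_J, map_mul,
    ← Complex.exp_conj]
  congr 2
  · rw [map_sub, map_neg, Complex.conj_ofReal, map_mul, Complex.conj_ofReal, map_sum]
    simp only [map_mul, Complex.conj_conj, RCLike.norm_conj]
  · congr 1; funext i; simp

theorem J_actU (φ : BargmannSpace θ) (γ : Lattice) :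
    J (actU φ γ) = actU (J φ) (latticeConj γ) := by
  rw [actU, J_translation, actU, latticePoint_latticeConj]

theorem conj_pairing (χ φ : BargmannSpace θ) (γ : Lattice) :
    conj (pairing χ φ γ) = pairing (J χ) (J φ) (latticeConj γ) := by
  rw [pairing_eq_inner_actU, pairing_eq_inner_actU, ← inner_J_J, J_actU]

/-- The trilinear product commutes with complex conjugation. -/
theorem J_act {a b c : BargmannSpace θ} (h : TriSummable a b c) :
    J (act (J a) (pairing b (J c))) = tri a b c := by
  have h1 := latticeConj.hasSum_iff.2 h.hasSum
  have h2 : HasSum (fun γ => J (pairing b (J c) γ • actU (J a) γ)) (tri a b c) := by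
    refine hasSum_of_eq h1 fun γ => ?_
    rw [J_smul, J_actU, J_J, conj_pairing, J_J, Function.comp_apply]
  have h3 := h2.mapL (Jₗᵢ (θ := θ)).toContinuousLinearMap
  have h4 : HasSum (fun γ => pairing b (J c) γ • actU (J a) γ) (J (tri a b c)) := by
    refine hasSum_of_eq h3 fun γ => ?_
    exact (J_J _).symm
  rw [act, h4.tsum_eq, J_J]

/-- A lattice sum of translates inherits decay from a weighted bound on its terms. -/
theorem decay_of_hasSum {s : ℕ} {C : ℝ} {φ Φ : BargmannSpace θ} {a : Lattice → ℂ}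
    (h : HasSum (fun γ => a γ • actU φ γ) Φ)
    (hb : ∀ z : Fin 2 → ℂ, ∃ f : Lattice → ℝ, Summable f ∧ ∑' γ, f γ ≤ C ∧
      ∀ γ, (1 + ‖z‖) ^ s * (‖a γ‖ * ‖gauged θ (toFun φ) (z + latticePoint θ γ)‖) ≤ f γ) :
    Decay s C Φ := by
  intro z
  obtain ⟨f, hf, hfC, hle⟩ := hb z
  have h1 := hasSum_toFun h z
  have h2 : HasSum (fun γ => gauged θ (toFun (a γ • actU φ γ)) z) (gauged θ (toFun Φ) z) :=
    h1.mul_left _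
  have hn : ∀ γ, (1 + ‖z‖) ^ s * ‖gauged θ (toFun (a γ • actU φ γ)) z‖ ≤ f γ := fun γ => by
    refine le_trans (le_of_eq ?_) (hle γ)
    rw [← norm_gauged_transFun, ← toFun_translation, toFun_smul, ← norm_mul]
    congr 2
    simp only [gauged, Pi.smul_apply, smul_eq_mul, actU]; ring
  have h3 : ∀ γ, ‖((1 + ‖z‖) ^ s : ℝ) • gauged θ (toFun (a γ • actU φ γ)) z‖ ≤ f γ := fun γ => by
    rw [norm_smul, Real.norm_of_nonneg (by positivity)]; exact hn γ
  have h4 := (h2.const_smul ((1 + ‖z‖) ^ s : ℝ)).tsum_eq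
  have h5 := tsum_of_norm_bounded hf.hasSum h3
  rw [h4, norm_smul, Real.norm_of_nonneg (by positivity), norm_gauged, Real.exp_neg] at h5
  have h6 := h5.trans hfC
  rw [← mul_assoc, mul_comm _ (Real.exp _)⁻¹, mul_assoc, inv_mul_le_iff₀ (Real.exp_pos _)] at h6
  linarith

theorem one_add_pow_le_peetre (s : ℕ) (z v : Fin 2 → ℂ) :
    (1 + ‖z‖) ^ s ≤ (1 + ‖v‖) ^ s * (1 + ‖z + v‖) ^ s := by
  rw [← mul_pow]
  gcongr
  have := one_add_norm_le_mul (z + v) (-v)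
  rw [norm_neg, add_neg_cancel_right] at this
  linarith

/-- The trilinear product has the decay of any one of its arguments, if the other two decay
rapidly. -/
theorem exists_decay_tri (θ : ℝ) [hθ : Fact (0 < θ)] : ∃ A : ℝ, 0 ≤ A ∧
    ∀ s ≤ 6, ∀ (Ca Cb Cc : ℝ) (a b c : BargmannSpace θ),
      (Decay s Ca a ∧ Decay 20 Cb b ∧ Decay 20 Cc c) ∨
      (Decay 20 Ca a ∧ Decay s Cb b ∧ Decay 20 Cc c) ∨
      (Decay 20 Ca a ∧ Decay 20 Cb b ∧ Decay s Cc c) →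
      Decay s (A * (Ca * Cb * Cc)) (tri a b c) := by
  obtain ⟨B, hB, hBw⟩ := exists_tsum_lattice_le θ
  have hI := innerConst_nonneg θ
  refine ⟨innerConst θ * B, by positivity, fun s hs Ca Cb Cc a b c h => ?_⟩
  have hCa : 0 ≤ Ca := by rcases h with h | h | h <;> exact h.1.nonneg
  have hCb : 0 ≤ Cb := by rcases h with h | h | h <;> exact h.2.1.nonneg
  have hCc : 0 ≤ Cc := by rcases h with h | h | h <;> exact h.2.2.nonneg
  -- either the coefficients decay fast, or the translated function does
  have hcases : TriSummable a b c ∧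
      ((Decay s Ca a ∧ ∀ γ, ‖pairing (J b) c γ‖ ≤
        innerConst θ * (Cb * Cc) / (1 + ‖latticePoint θ γ‖) ^ (s + 8)) ∨
      (Decay (s + 8) Ca a ∧ ∀ γ, ‖pairing (J b) c γ‖ ≤
        innerConst θ * (Cb * Cc) / (1 + ‖latticePoint θ γ‖) ^ s)) := by
    rcases h with ⟨ha, hb, hc⟩ | ⟨ha, hb, hc⟩ | ⟨ha, hb, hc⟩
    · exact ⟨triSummable₁ _ ⟨_, hb⟩ ⟨_, hc⟩, Or.inl ⟨ha, norm_pairing_le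
        (hb.J.mono (by omega) le_rfl) (hc.mono (by omega) le_rfl)⟩⟩
    · exact ⟨triSummable₂ _ ⟨_, ha⟩ ⟨_, hc⟩, Or.inr ⟨ha.mono (by omega) le_rfl, norm_pairing_le'
        hb.J (hc.mono (by omega) le_rfl)⟩⟩
    · exact ⟨triSummable₃ _ ⟨_, ha⟩ ⟨_, hb⟩, Or.inr ⟨ha.mono (by omega) le_rfl, norm_pairing_le
        (hb.J.mono (by omega) le_rfl) hc⟩⟩
  obtain ⟨hsum, hcase⟩ := hcases
  refine decay_of_hasSum hsum.hasSum fun z => ?_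
  set D := innerConst θ * (Cb * Cc) * Ca with hD
  have hD0 : 0 ≤ D := by positivity
  have hfin : ∀ w : Fin 2 → ℂ,
      ∑' γ : Lattice, D * (1 / (1 + ‖w + latticePoint θ γ‖) ^ 8) ≤
        innerConst θ * B * (Ca * Cb * Cc) := fun w => by
    rw [tsum_mul_left]
    calc _ ≤ D * B := by gcongr; exact (hBw w).2
      _ = _ := by rw [hD]; ring
  rcases hcase with ⟨ha, hp⟩ | ⟨ha, hp⟩
  · refine ⟨fun γ => D * (1 / (1 + ‖0 + latticePoint θ γ‖) ^ 8), (hBw 0).1.mul_left _, hfin 0,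
      fun γ => ?_⟩
    show _ ≤ D * (1 / (1 + ‖0 + latticePoint θ γ‖) ^ 8)
    rw [zero_add]
    have h1 := one_add_pow_le_peetre s z (latticePoint θ γ)
    have h2 := ha.norm_gauged_le (z + latticePoint θ γ)
    calc _ ≤ ((1 + ‖latticePoint θ γ‖) ^ s * (1 + ‖z + latticePoint θ γ‖) ^ s) *
          (innerConst θ * (Cb * Cc) / (1 + ‖latticePoint θ γ‖) ^ (s + 8) *
            (Ca / (1 + ‖z + latticePoint θ γ‖) ^ s)) := by
          gcongr; exact hp γ
      _ = _ := by rw [hD, pow_add]; field_simp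
  · refine ⟨fun γ => D * (1 / (1 + ‖z + latticePoint θ γ‖) ^ 8), (hBw z).1.mul_left _, hfin z,
      fun γ => ?_⟩
    have h1 := one_add_pow_le_peetre s z (latticePoint θ γ)
    have h2 := ha.norm_gauged_le (z + latticePoint θ γ)
    calc _ ≤ ((1 + ‖latticePoint θ γ‖) ^ s * (1 + ‖z + latticePoint θ γ‖) ^ s) *
          (innerConst θ * (Cb * Cc) / (1 + ‖latticePoint θ γ‖) ^ s *
            (Ca / (1 + ‖z + latticePoint θ γ‖) ^ (s + 8))) := by
          gcongr; exact hp γ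
      _ = _ := by rw [hD, pow_add]; field_simp

end

/-! ### Estimates for the normalized monomials -/

section
variable {θ : ℝ} [hθ : Fact (0 < θ)]

/-- The modulus of a gauged normalized monomial in one variable. -/
noncomputable def gMono (θ : ℝ) (n : ℕ) (w : ℂ) : ℝ :=
  ‖mono₁ θ n w‖ * Real.exp (-(freq θ / 2 * ‖w‖ ^ 2))

theorem gMono_nonneg (n : ℕ) (w : ℂ) : 0 ≤ gMono θ n w :=
  mul_nonneg (norm_nonneg _) (Real.exp_pos _).le

theorem continuous_gMono (n : ℕ) : Continuous (gMono θ n) := by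
  have := continuous_mono₁ (θ := θ) n
  unfold gMono; fun_prop

theorem gMono_eq (n : ℕ) (w : ℂ) : gMono θ n w =
    Real.sqrt (freq θ ^ n / n.factorial) * (‖w‖ ^ n * Real.exp (-(freq θ / 2 * ‖w‖ ^ 2))) := by
  rw [gMono, norm_mono₁, mul_assoc]

/-- The square is a Poisson weight. -/
theorem gMono_sq (n : ℕ) (w : ℂ) : gMono θ n w ^ 2 =
    (freq θ * ‖w‖ ^ 2) ^ n / n.factorial * Real.exp (-(freq θ * ‖w‖ ^ 2)) := by
  rw [gMono, mul_pow, norm_mono₁_sq, ← Real.exp_nat_mul]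
  congr 2
  push_cast; ring

theorem norm_gauged_monomialState (n : ℕ × ℕ) (z : Fin 2 → ℂ) :
    ‖gauged θ (toFun (monomialState θ n)) z‖ = gMono θ n.1 (z 0) * gMono θ n.2 (z 1) := by
  rw [norm_gauged, toFun_monomialState, mono, norm_mul, gMono, gMono, sqNorm, Fin.sum_univ_two,
    mul_add, neg_add, Real.exp_add]
  ring

theorem pow_div_factorial_mul_exp_neg_le_one {x : ℝ} (hx : 0 ≤ x) (n : ℕ) :
    x ^ n / n.factorial * Real.exp (-x) ≤ 1 := by
  rw [Real.exp_neg, ← div_eq_mul_inv, div_le_one (Real.exp_pos _)]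
  exact Real.pow_div_factorial_le_exp x hx n

/-- Multiplication by `xᴷ` turns the Poisson weight of `n` into that of `n + K`, up to the ratio of
the factorials. -/
theorem pow_mul_poisson_le {x : ℝ} (hx : 0 ≤ x) (K n : ℕ) :
    x ^ K * (x ^ n / n.factorial * Real.exp (-x)) ≤ ((K + 1) * (n + 1) : ℝ) ^ K := by
  have h1 := pow_div_factorial_mul_exp_neg_le_one hx (n + K)
  have h2 : ((n + K).factorial : ℝ) ≤ n.factorial * ((K + 1) * (n + 1) : ℝ) ^ K := by
    have h3 : (n + K).factorial ≤ n.factorial * (n + K) ^ K := by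
      calc (n + K).factorial = n.factorial * (n + 1).ascFactorial K :=
            (Nat.factorial_mul_ascFactorial n K).symm
        _ ≤ n.factorial * (n + K) ^ K := by
            gcongr
            exact Nat.ascFactorial_le_pow_add _ _
    have h5 : (n + K) ^ K ≤ ((K + 1) * (n + 1)) ^ K := by
      gcongr; nlinarith
    exact_mod_cast h3.trans (Nat.mul_le_mul_left _ h5)
  have h0 : (0 : ℝ) < n.factorial := by positivity
  calc x ^ K * (x ^ n / n.factorial * Real.exp (-x))
      = (x ^ (n + K) / (n + K).factorial * Real.exp (-x)) *
        ((n + K).factorial / n.factorial) := by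
        rw [pow_add]; field_simp
    _ ≤ 1 * ((n + K).factorial / n.factorial) := by gcongr
    _ ≤ _ := by rw [one_mul, div_le_iff₀ h0]; linarith

/-- Powers of `n` are exchanged for powers of `x`: `nʲ` times the Poisson weight of `n` is comparable
to `xʲ` times that of `n - j`. -/
theorem poisson_mul_pow_le {x : ℝ} (hx : 0 ≤ x) (j n : ℕ) :
    (n + 1 : ℝ) ^ j * (x ^ n / n.factorial * Real.exp (-x)) ≤ ((j + 1) * (1 + x)) ^ j := by
  rcases lt_or_ge n j with h | h
  · have h1 := pow_div_factorial_mul_exp_neg_le_one hx n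
    have h2 : (n + 1 : ℝ) ≤ j + 1 := by
      have : (n : ℝ) ≤ j := by exact_mod_cast h.le
      linarith
    calc _ ≤ ((j : ℝ) + 1) ^ j * 1 := by gcongr
      _ ≤ _ := by
        rw [mul_one]; gcongr; nlinarith [(Nat.cast_nonneg j : (0 : ℝ) ≤ j)]
  · obtain ⟨k, rfl⟩ := Nat.exists_eq_add_of_le' h
    have h1 := pow_div_factorial_mul_exp_neg_le_one hx k
    have h2 : ((k : ℝ) + j + 1) ≤ (j + 1) * (k + 1) := by
      nlinarith [(Nat.cast_nonneg j : (0 : ℝ) ≤ j), (Nat.cast_nonneg k : (0 : ℝ) ≤ k)]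
    have h3 : (k.factorial : ℝ) * (k + 1) ^ j ≤ (k + j).factorial := by
      exact_mod_cast Nat.factorial_mul_pow_le_factorial
    have h0 : (0 : ℝ) < k.factorial := by positivity
    have h00 : (0 : ℝ) < (k + j).factorial := by positivity
    push_cast
    calc ((k : ℝ) + j + 1) ^ j * (x ^ (k + j) / (k + j).factorial * Real.exp (-x))
        ≤ ((j + 1) * (k + 1)) ^ j * (x ^ (k + j) / (k + j).factorial * Real.exp (-x)) := by
          gcongr
      _ = ((j : ℝ) + 1) ^ j * x ^ j * (x ^ k / k.factorial * Real.exp (-x)) *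
          ((k.factorial * (k + 1) ^ j) / (k + j).factorial) := by
          rw [pow_add, mul_pow]; field_simp
      _ ≤ ((j : ℝ) + 1) ^ j * x ^ j * 1 * 1 := by
          gcongr
          rw [div_le_one h00]; exact h3
      _ ≤ ((j : ℝ) + 1) ^ j * (1 + x) ^ j := by
          rw [mul_one, mul_one]; gcongr; linarith
      _ = _ := by rw [mul_pow]

/-- In weighted supremum norms the normalized monomials grow at most polynomially in their degree. -/
theorem exists_one_add_pow_mul_gMono_le (θ : ℝ) [hθ : Fact (0 < θ)] (K : ℕ) : ∃ C : ℝ, 0 < C ∧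
    ∀ n w, (1 + ‖w‖) ^ K * gMono θ n w ≤ C * (n + 1) ^ K := by
  have hω := freq_pos θ
  set c := 1 + 1 / freq θ with hc
  have hc0 : 0 < c := by positivity
  -- `c` is chosen such that `(1 + r)² ≤ 2c(1 + ωr²)`
  refine ⟨(2 * c) ^ K * ((K + 1) ^ K + 1) * 2 ^ K, by positivity, fun n w => ?_⟩
  set x := freq θ * ‖w‖ ^ 2 with hx
  have hx0 : 0 ≤ x := by positivity
  have h1 : (1 + ‖w‖) ^ 2 ≤ 2 * c * (1 + x) := by
    have e1 : ‖w‖ ^ 2 = 1 / freq θ * x := by rw [hx]; field_simp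
    have e2 : 0 ≤ 1 / freq θ := by positivity
    have e3 : (1 + ‖w‖) ^ 2 ≤ 2 * (1 + ‖w‖ ^ 2) := by nlinarith [sq_nonneg (1 - ‖w‖)]
    rw [hc]
    nlinarith
  have h2 : (1 + x) ^ K * (x ^ n / n.factorial * Real.exp (-x)) ≤
      2 ^ K * (((K + 1) * (n + 1) : ℝ) ^ K + 1) := by
    have e1 : (1 + x) ^ K ≤ 2 ^ K * (1 + x ^ K) := by
      calc (1 + x) ^ K ≤ 2 ^ (K - 1) * (1 ^ K + x ^ K) := add_pow_le zero_le_one hx0 K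
        _ ≤ 2 ^ K * (1 + x ^ K) := by
          rw [one_pow]; gcongr
          · norm_num
          · omega
    have e2 := pow_mul_poisson_le hx0 K n
    have e3 := pow_div_factorial_mul_exp_neg_le_one hx0 n
    calc _ ≤ 2 ^ K * (1 + x ^ K) * (x ^ n / n.factorial * Real.exp (-x)) := by gcongr
      _ = 2 ^ K * (x ^ n / n.factorial * Real.exp (-x) +
          x ^ K * (x ^ n / n.factorial * Real.exp (-x))) := by ring
      _ ≤ _ := by gcongr 2 ^ K * ?_; linarith
  have hn1 : (1 : ℝ) ≤ n + 1 := by linarith [(Nat.cast_nonneg n : (0 : ℝ) ≤ n)]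
  have h3 : ((1 + ‖w‖) ^ K * gMono θ n w) ^ 2 ≤
      (2 * c) ^ K * ((K + 1) ^ K + 1) * 2 ^ K * (n + 1) ^ K := by
    calc ((1 + ‖w‖) ^ K * gMono θ n w) ^ 2
        = ((1 + ‖w‖) ^ 2) ^ K * (x ^ n / n.factorial * Real.exp (-x)) := by
          rw [mul_pow, gMono_sq, ← pow_mul, ← pow_mul, mul_comm K]
      _ ≤ (2 * c * (1 + x)) ^ K * (x ^ n / n.factorial * Real.exp (-x)) := by gcongr
      _ = (2 * c) ^ K * ((1 + x) ^ K * (x ^ n / n.factorial * Real.exp (-x))) := by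
          rw [mul_pow]; ring
      _ ≤ (2 * c) ^ K * (2 ^ K * (((K + 1) * (n + 1) : ℝ) ^ K + 1)) := by gcongr
      _ ≤ (2 * c) ^ K * (2 ^ K * (((K + 1) * (n + 1) : ℝ) ^ K + (n + 1) ^ K)) := by
          gcongr; exact one_le_pow₀ hn1
      _ = _ := by rw [mul_pow ((K : ℝ) + 1)]; ring
  set D := (2 * c) ^ K * ((K + 1) ^ K + 1) * 2 ^ K with hD
  have hD1 : 1 ≤ D := by
    have a1 : 1 ≤ (2 * c) ^ K := one_le_pow₀ (by
      have : 0 ≤ 1 / freq θ := by positivity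
      linarith)
    have a2 : (1 : ℝ) ≤ (K + 1) ^ K + 1 := by
      have : (0 : ℝ) ≤ (K + 1) ^ K := by positivity
      linarith
    have a3 : (1 : ℝ) ≤ 2 ^ K := one_le_pow₀ one_le_two
    exact one_le_mul_of_one_le_of_one_le (one_le_mul_of_one_le_of_one_le a1 a2) a3
  refine le_of_sq_le_sq (h3.trans ?_) (by positivity)
  have hp1 : (1 : ℝ) ≤ (n + 1) ^ K := one_le_pow₀ hn1
  rw [mul_pow, sq, sq]
  gcongr
  · nlinarith
  · nlinarith

/-- A weight in the variable buys decay in the degree. -/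
theorem exists_gMono_le (θ : ℝ) [hθ : Fact (0 < θ)] (m : ℕ) : ∃ C : ℝ, 0 < C ∧
    ∀ n w, gMono θ n w ≤ C / (n + 1) ^ m * (1 + ‖w‖) ^ (2 * m) := by
  have hω := freq_pos θ
  refine ⟨((2 * m + 1) * (1 + freq θ)) ^ m, by positivity, fun n w => ?_⟩
  have h1 := poisson_mul_pow_le (x := freq θ * ‖w‖ ^ 2) (by positivity) (2 * m) n
  rw [← gMono_sq] at h1
  have h2 : 1 + freq θ * ‖w‖ ^ 2 ≤ (1 + freq θ) * (1 + ‖w‖) ^ 2 := by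
    nlinarith [norm_nonneg w, mul_nonneg hω.le (norm_nonneg w)]
  have h3 : ((n + 1 : ℝ) ^ m * gMono θ n w) ^ 2 ≤
      (((2 * m + 1) * (1 + freq θ)) ^ m * (1 + ‖w‖) ^ (2 * m)) ^ 2 := by
    calc ((n + 1 : ℝ) ^ m * gMono θ n w) ^ 2 = (n + 1 : ℝ) ^ (2 * m) * gMono θ n w ^ 2 := by ring
      _ ≤ _ := h1
      _ ≤ (((2 * m : ℕ) + 1) * ((1 + freq θ) * (1 + ‖w‖) ^ 2)) ^ (2 * m) := by gcongr
      _ = _ := by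
        push_cast
        rw [← mul_assoc, mul_pow, mul_pow _ (_ ^ (2 * m)) 2, ← pow_mul, ← pow_mul, ← pow_mul,
          mul_comm 2 (2 * m), mul_comm m 2]
  have h4 := le_of_sq_le_sq h3 (by positivity)
  rw [div_mul_eq_mul_div, le_div_iff₀ (by positivity)]
  linarith

/-! ### The traces of decaying rank one pieces -/

/-- The radial moments of the Gaussian on the plane. -/
noncomputable def moment (θ : ℝ) (m : ℕ) : ℝ :=
  ∫ w : ℂ, ‖w‖ ^ m * Real.exp (-(freq θ / 2 * ‖w‖ ^ 2))

theorem moment_eq (m : ℕ) : moment θ m =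
    2 * Real.pi / 2 * (freq θ / 2) ^ (-((m : ℝ) + 2) / 2) * Real.Gamma (((m : ℝ) + 2) / 2) := by
  have hω := freq_pos θ
  rw [← Complex.integral_rpow_mul_exp_neg_mul_rpow (by norm_num) (by
    have : (0 : ℝ) ≤ m := Nat.cast_nonneg m
    linarith) (by positivity)]
  refine integral_congr_ae (ae_of_all _ fun w => ?_)
  simp only [Real.rpow_natCast, Real.rpow_ofNat, neg_mul]

theorem moment_pos (m : ℕ) : 0 < moment θ m := by
  have hω := freq_pos θ
  have h := Real.Gamma_pos_of_pos (s := ((m : ℝ) + 2) / 2) (by positivity)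
  have hpi := Real.pi_pos
  rw [moment_eq]
  positivity

theorem integrable_moment (m : ℕ) :
    Integrable fun w : ℂ => ‖w‖ ^ m * Real.exp (-(freq θ / 2 * ‖w‖ ^ 2)) := by
  -- a function with nonzero Bochner integral is integrable
  by_contra h
  exact (moment_pos (θ := θ) m).ne' (integral_undef h)

theorem moment_add_two (m : ℕ) : moment θ (m + 2) = (m + 2) / freq θ * moment θ m := by
  have hω := freq_pos θ
  rw [moment_eq, moment_eq]
  have h1 : ((m + 2 : ℕ) : ℝ) + 2 = (m + 2) + 2 := by push_cast; ring
  have h2 : -(((m : ℝ) + 2) + 2) / 2 = -((m : ℝ) + 2) / 2 - 1 := by ring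
  have h3 : (((m : ℝ) + 2) + 2) / 2 = ((m : ℝ) + 2) / 2 + 1 := by ring
  rw [h1, h2, h3, Real.rpow_sub_one (by positivity), Real.Gamma_add_one (by positivity)]
  field_simp

/-- A majorant of the weighted `L¹` norm of the monomial of degree `m + 3`: the weight
`(1 + ‖w‖)⁻³` lowers the power of `‖w‖` by three. -/
noncomputable def momentSeq (θ : ℝ) (m : ℕ) : ℝ :=
  Real.sqrt (freq θ ^ (m + 3) / (m + 3).factorial) * moment θ m

theorem momentSeq_pos (m : ℕ) : 0 < momentSeq θ m := by
  have hω := freq_pos θ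
  exact mul_pos (Real.sqrt_pos.2 (by positivity)) (moment_pos m)

theorem momentSeq_add_two_le (m : ℕ) :
    momentSeq θ (m + 2) ≤ (m + 2) / (m + 4.4) * momentSeq θ m := by
  have hω := freq_pos θ
  have h1 : freq θ ^ (m + 2 + 3) / ((m + 2 + 3).factorial : ℝ) =
      (freq θ ^ 2 / ((m + 4) * (m + 5))) * (freq θ ^ (m + 3) / (m + 3).factorial) := by
    rw [show m + 2 + 3 = (m + 3) + 1 + 1 by ring, Nat.factorial_succ, Nat.factorial_succ]
    push_cast
    field_simp
    ring
  -- `(m + 4.4)² ≤ (m + 4)(m + 5)`, and `4.4 > 4` leaves the room that Kummer's test needs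
  have h2 : Real.sqrt (freq θ ^ 2 / ((m + 4) * (m + 5))) ≤ freq θ / (m + 4.4) := by
    refine Real.sqrt_le_iff.2 ⟨by positivity, ?_⟩
    rw [div_pow]
    gcongr
    nlinarith [(Nat.cast_nonneg m : (0 : ℝ) ≤ m)]
  have hp := moment_pos (θ := θ) m
  rw [momentSeq, momentSeq, moment_add_two, h1, Real.sqrt_mul (by positivity)]
  calc _ ≤ freq θ / (m + 4.4) * Real.sqrt (freq θ ^ (m + 3) / (m + 3).factorial) *
        ((m + 2) / freq θ * moment θ m) := by gcongr
    _ = _ := by field_simp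

/-- Kummer's test, with the weights `m + 3`. The ratio of terms two apart is about `1 - 5/(2m)`,
which corresponds to a decay like `m^{-5/4}`. -/
theorem summable_momentSeq : Summable (momentSeq θ) := by
  have hstep : ∀ m : ℕ, 0.4 * momentSeq θ m + (m + 5) * momentSeq θ (m + 2) ≤
      (m + 3) * momentSeq θ m := by
    intro m
    have h1 := momentSeq_add_two_le (θ := θ) m
    have hp := momentSeq_pos (θ := θ) m
    have hm : (0 : ℝ) ≤ m := Nat.cast_nonneg m
    have h2 : ((m : ℝ) + 5) * ((m + 2) / (m + 4.4)) ≤ m + 3 - 0.4 := by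
      rw [mul_div_assoc', div_le_iff₀ (by positivity)]
      nlinarith
    calc _ ≤ 0.4 * momentSeq θ m + (m + 5) * ((m + 2) / (m + 4.4) * momentSeq θ m) := by gcongr
      _ = 0.4 * momentSeq θ m + ((m + 5) * ((m + 2) / (m + 4.4))) * momentSeq θ m := by ring
      _ ≤ 0.4 * momentSeq θ m + (m + 3 - 0.4) * momentSeq θ m := by gcongr
      _ = _ := by ring
  have hind : ∀ k : ℕ, 0.4 * ∑ m ∈ Finset.range k, momentSeq θ m +
      (k + 3) * momentSeq θ k + (k + 4) * momentSeq θ (k + 1) ≤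
      3 * momentSeq θ 0 + 4 * momentSeq θ 1 := by
    intro k
    induction k with
    | zero => simp
    | succ k ih =>
      rw [Finset.sum_range_succ]
      have := hstep k
      push_cast
      have e1 : (k : ℝ) + 1 + 3 = k + 4 := by ring
      have e2 : (k : ℝ) + 1 + 4 = k + 5 := by ring
      rw [e1, e2]
      linarith
  refine summable_of_sum_range_le (c := (3 * momentSeq θ 0 + 4 * momentSeq θ 1) / 0.4)
    (fun m => (momentSeq_pos m).le) fun k => ?_
  rw [le_div_iff₀ (by norm_num)]
  have h1 := hind k
  have h2 := momentSeq_pos (θ := θ) k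
  have h3 := momentSeq_pos (θ := θ) (k + 1)
  have h4 : 0 ≤ ((k : ℝ) + 3) * momentSeq θ k := by positivity
  have h5 : 0 ≤ ((k : ℝ) + 4) * momentSeq θ (k + 1) := by positivity
  linarith

/-- The weighted `L¹` norm of a gauged monomial in one variable. -/
noncomputable def traceWeight₁ (θ : ℝ) (n : ℕ) : ℝ := ∫ w : ℂ, gMono θ n w * (1 / (1 + ‖w‖) ^ 3)

theorem integrable_gMono (n : ℕ) : Integrable (gMono θ n) := by
  refine ((integrable_moment (θ := θ) n).const_mul
    (Real.sqrt (freq θ ^ n / n.factorial))).congr (ae_of_all _ fun w => ?_)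
  exact (gMono_eq n w).symm

theorem integrable_traceWeight₁ (n : ℕ) :
    Integrable fun w : ℂ => gMono θ n w * (1 / (1 + ‖w‖) ^ 3) := by
  refine (integrable_gMono (θ := θ) n).mono' ?_ (ae_of_all _ fun w => ?_)
  · refine Continuous.aestronglyMeasurable ?_
    have h := continuous_gMono (θ := θ) n
    have h2 : ∀ w : ℂ, (1 + ‖w‖) ^ 3 ≠ 0 := fun w => by positivity
    fun_prop (disch := assumption)
  · have h0 := gMono_nonneg (θ := θ) n w
    rw [Real.norm_of_nonneg (by positivity)]
    refine mul_le_of_le_one_right h0 ?_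
    rw [div_le_one (by positivity)]
    exact one_le_pow₀ (by linarith [norm_nonneg w])

theorem traceWeight₁_nonneg (n : ℕ) : 0 ≤ traceWeight₁ θ n :=
  integral_nonneg fun w => mul_nonneg (gMono_nonneg n w) (by positivity)

theorem summable_traceWeight₁ : Summable (traceWeight₁ θ) := by
  refine (summable_nat_add_iff 3).1 ?_
  refine Summable.of_nonneg_of_le (fun m => traceWeight₁_nonneg _) (fun m => ?_)
    (summable_momentSeq (θ := θ))
  rw [momentSeq, moment, ← integral_const_mul]
  refine integral_mono (integrable_traceWeight₁ _) ((integrable_moment m).const_mul _) fun w => ?_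
  have h1 : ‖w‖ ^ (m + 3) * (1 / (1 + ‖w‖) ^ 3) ≤ ‖w‖ ^ m := by
    rw [mul_one_div, div_le_iff₀ (by positivity), pow_add]
    gcongr; linarith
  show gMono θ (m + 3) w * (1 / (1 + ‖w‖) ^ 3) ≤ _
  rw [gMono_eq]
  calc _ = Real.sqrt (freq θ ^ (m + 3) / (m + 3).factorial) *
        ((‖w‖ ^ (m + 3) * (1 / (1 + ‖w‖) ^ 3)) * Real.exp (-(freq θ / 2 * ‖w‖ ^ 2))) := by ring
    _ ≤ _ := by gcongr

/-- The bound on the overlap of a monomial with a function of decay order `6`. -/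
noncomputable def traceWeight (θ : ℝ) (n : ℕ × ℕ) : ℝ :=
  (freq θ / Real.pi) ^ 2 * (traceWeight₁ θ n.1 * traceWeight₁ θ n.2)

theorem traceWeight_nonneg (n : ℕ × ℕ) : 0 ≤ traceWeight θ n :=
  mul_nonneg (by positivity) (mul_nonneg (traceWeight₁_nonneg _) (traceWeight₁_nonneg _))

theorem summable_traceWeight : Summable (traceWeight θ) :=
  (summable_mul_prod (summable_traceWeight₁ (θ := θ)) summable_traceWeight₁ traceWeight₁_nonneg
    traceWeight₁_nonneg).mul_left _

/-- The factor `(1 + ‖z‖)⁻⁶` is shared evenly by the two variables, which leaves an inverse third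
power in each. -/
theorem Decay.norm_inner_monomialState_le {C : ℝ} {x : BargmannSpace θ} (h : Decay 6 C x)
    (n : ℕ × ℕ) : ‖⟪monomialState θ n, x⟫_ℂ‖ ≤ C * traceWeight θ n := by
  have hC := h.nonneg
  set g : Fin 2 → ℂ → ℝ := fun i w => gMono θ (![n.1, n.2] i) w * (1 / (1 + ‖w‖) ^ 3) with hg
  have hint : Integrable fun z : Fin 2 → ℂ => C * ∏ i, g i (z i) :=
    (Integrable.fintype_prod (f := g) fun i => integrable_traceWeight₁ _).const_mul C
  have hpt : ∀ z, ‖conj (gauged θ (toFun (monomialState θ n)) z) * gauged θ (toFun x) z‖ ≤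
      C * ∏ i, g i (z i) := by
    intro z
    rw [norm_mul, RCLike.norm_conj, norm_gauged_monomialState, Fin.prod_univ_two]
    have h1 := h.norm_gauged_le z
    have h2 := norm_le_pi_norm z 0
    have h3 := norm_le_pi_norm z 1
    have g1 := gMono_nonneg (θ := θ) n.1 (z 0)
    have g2 := gMono_nonneg (θ := θ) n.2 (z 1)
    have h4 : (1 + ‖z 0‖) ^ 3 * (1 + ‖z 1‖) ^ 3 ≤ (1 + ‖z‖) ^ 6 := by
      calc _ ≤ (1 + ‖z‖) ^ 3 * (1 + ‖z‖) ^ 3 := by gcongr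
        _ = _ := by ring
    calc _ ≤ gMono θ n.1 (z 0) * gMono θ n.2 (z 1) *
          (C / ((1 + ‖z 0‖) ^ 3 * (1 + ‖z 1‖) ^ 3)) := by
          gcongr
          exact h1.trans (by gcongr)
      _ = _ := by simp only [hg, Matrix.cons_val_zero, Matrix.cons_val_one]; field_simp
  rw [inner_eq_integral_gauged, norm_mul, Complex.norm_real,
    Real.norm_of_nonneg (by positivity : (0 : ℝ) ≤ (freq θ / Real.pi) ^ 2)]
  calc _ ≤ (freq θ / Real.pi) ^ 2 * ∫ z : Fin 2 → ℂ, C * ∏ i, g i (z i) := by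
        gcongr
        exact norm_integral_le_of_norm_le hint (ae_of_all _ hpt)
    _ = _ := by
        rw [integral_const_mul, integral_fintype_prod_volume_eq_prod, Fin.prod_univ_two,
          traceWeight]
        simp only [hg, Matrix.cons_val_zero, Matrix.cons_val_one, traceWeight₁]
        ring

end

/-! ### Background fields with absolutely summable coefficients -/

/-- The absolutely summable coefficient sequences. -/
abbrev Coeffs : Type := lp (fun _ : ℕ × ℕ => ℂ) 1

theorem hasSum_norm_coeffs (a : Coeffs) : HasSum (fun n => ‖a n‖) ‖a‖ := by
  simpa using lp.hasSum_norm (p := 1) (by norm_num) a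

section
variable {θ : ℝ} [hθ : Fact (0 < θ)]

/-- A constant such that `basisWeight` bounds the decay of the monomials, chosen to be at least `1`. -/
noncomputable def basisConst (θ : ℝ) [hθ : Fact (0 < θ)] : ℝ :=
  (exists_one_add_pow_mul_gMono_le θ 20).choose + 1

/-- A bound for the monomials in the norm of rapid decay. -/
noncomputable def basisWeight (θ : ℝ) [hθ : Fact (0 < θ)] (n : ℕ × ℕ) : ℝ :=
  basisConst θ ^ 2 * ((n.1 + 1) ^ 20 * (n.2 + 1) ^ 20)

theorem one_le_basisConst (θ : ℝ) [hθ : Fact (0 < θ)] : 1 ≤ basisConst θ := by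
  have := (exists_one_add_pow_mul_gMono_le θ 20).choose_spec.1
  rw [basisConst]; linarith

theorem one_le_basisWeight (n : ℕ × ℕ) : 1 ≤ basisWeight θ n := by
  have h1 : ∀ k : ℕ, (1 : ℝ) ≤ (k + 1) ^ 20 := fun k =>
    one_le_pow₀ (by linarith [(Nat.cast_nonneg k : (0 : ℝ) ≤ k)])
  exact one_le_mul_of_one_le_of_one_le (one_le_pow₀ (one_le_basisConst θ))
    (one_le_mul_of_one_le_of_one_le (h1 _) (h1 _))

theorem basisWeight_pos (n : ℕ × ℕ) : 0 < basisWeight θ n :=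
  zero_lt_one.trans_le (one_le_basisWeight n)

theorem one_add_norm_le_prod (z : Fin 2 → ℂ) : 1 + ‖z‖ ≤ (1 + ‖z 0‖) * (1 + ‖z 1‖) := by
  have h : ‖z‖ ≤ ‖z 0‖ + ‖z 1‖ := by
    rw [pi_norm_le_iff_of_nonneg (by positivity)]
    intro i
    fin_cases i
    · exact le_add_of_nonneg_right (norm_nonneg _)
    · exact le_add_of_nonneg_left (norm_nonneg _)
  nlinarith [mul_nonneg (norm_nonneg (z 0)) (norm_nonneg (z 1))]

theorem decay_of_gauged {s : ℕ} {C : ℝ} {φ : BargmannSpace θ}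
    (h : ∀ z, (1 + ‖z‖) ^ s * ‖gauged θ (toFun φ) z‖ ≤ C) : Decay s C φ := fun z => by
  have := h z
  rw [norm_gauged, Real.exp_neg, ← mul_assoc, mul_comm _ (Real.exp _)⁻¹, mul_assoc,
    inv_mul_le_iff₀ (Real.exp_pos _)] at this
  linarith

theorem decay_monomialState (n : ℕ × ℕ) :
    Decay 20 (basisWeight θ n) (monomialState θ n) := by
  refine decay_of_gauged fun z => ?_
  have hC := (exists_one_add_pow_mul_gMono_le θ 20).choose_spec
  set C := (exists_one_add_pow_mul_gMono_le θ 20).choose with hCdef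
  have h0 := hC.2 n.1 (z 0)
  have h1 := hC.2 n.2 (z 1)
  have g0 := gMono_nonneg (θ := θ) n.1 (z 0)
  have g1 := gMono_nonneg (θ := θ) n.2 (z 1)
  have hCpos := hC.1
  rw [norm_gauged_monomialState]
  calc _ ≤ ((1 + ‖z 0‖) * (1 + ‖z 1‖)) ^ 20 * (gMono θ n.1 (z 0) * gMono θ n.2 (z 1)) := by
        gcongr; exact one_add_norm_le_prod z
    _ = ((1 + ‖z 0‖) ^ 20 * gMono θ n.1 (z 0)) * ((1 + ‖z 1‖) ^ 20 * gMono θ n.2 (z 1)) := by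
        rw [mul_pow]; ring
    _ ≤ (C * (n.1 + 1) ^ 20) * (C * (n.2 + 1) ^ 20) := by gcongr
    _ = C ^ 2 * ((n.1 + 1) ^ 20 * (n.2 + 1) ^ 20) := by ring
    _ ≤ _ := by rw [basisWeight, basisConst, ← hCdef]; gcongr; linarith

theorem summable_synth (a : Coeffs) :
    Summable fun n => (a n / basisWeight θ n) • monomialState θ n := by
  refine Summable.of_norm_bounded (hasSum_norm_coeffs a).summable fun n => ?_
  rw [norm_smul, norm_monomialState, mul_one, norm_div, Complex.norm_real,
    Real.norm_of_nonneg (basisWeight_pos n).le]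
  exact div_le_self (norm_nonneg _) (one_le_basisWeight n)

/-- The background field with given coefficients in the monomials, which are normalized in the norm
of rapid decay. -/
noncomputable def synth (θ : ℝ) [hθ : Fact (0 < θ)] : Coeffs →ₗ[ℂ] BargmannSpace θ where
  toFun a := ∑' n, (a n / basisWeight θ n) • monomialState θ n
  map_add' a b := (hasSum_of_eq ((summable_synth a).hasSum.add (summable_synth b).hasSum)
    fun n => by rw [lp.coeFn_add, Pi.add_apply, add_div, add_smul]).tsum_eq
  map_smul' c a := (hasSum_of_eq ((summable_synth a).hasSum.const_smul c)
    fun n => by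
      rw [lp.coeFn_smul, Pi.smul_apply, smul_eq_mul, mul_div_assoc, mul_smul]).tsum_eq

theorem hasSum_synth (a : Coeffs) :
    HasSum (fun n => (a n / basisWeight θ n) • monomialState θ n) (synth θ a) :=
  (summable_synth a).hasSum

theorem decay_synth (a : Coeffs) : Decay 20 ‖a‖ (synth θ a) := by
  refine decay_of_gauged fun z => ?_
  have h1 : HasSum (fun n => gauged θ (toFun ((a n / basisWeight θ n) • monomialState θ n)) z)
      (gauged θ (toFun (synth θ a)) z) := (hasSum_toFun (hasSum_synth a) z).mul_left _
  have h2 : ∀ n, ‖((1 + ‖z‖) ^ 20 : ℝ) •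
      gauged θ (toFun ((a n / basisWeight θ n) • monomialState θ n)) z‖ ≤ ‖a n‖ := by
    intro n
    have h3 := ((decay_monomialState (θ := θ) n).smul (a n / basisWeight θ n)).norm_gauged_le z
    rw [le_div_iff₀ (by positivity), norm_div, Complex.norm_real,
      Real.norm_of_nonneg (basisWeight_pos n).le, div_mul_cancel₀ _ (basisWeight_pos n).ne'] at h3
    rw [norm_smul, Real.norm_of_nonneg (by positivity)]
    linarith
  have h4 := (h1.const_smul ((1 + ‖z‖) ^ 20 : ℝ)).tsum_eq
  have h5 := tsum_of_norm_bounded (hasSum_norm_coeffs a) h2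
  rwa [h4, norm_smul, Real.norm_of_nonneg (by positivity)] at h5

theorem nice_synth (a : Coeffs) : Nice (synth θ a) := ⟨_, decay_synth a⟩

/-- An element whose coefficients are summable against `basisWeight` is a background field. -/
theorem exists_synth_eq {φ : BargmannSpace θ}
    (h : Summable fun n => basisWeight θ n * ‖⟪monomialState θ n, φ⟫_ℂ‖) :
    ∃ a : Coeffs, (∀ n, a n = basisWeight θ n * ⟪monomialState θ n, φ⟫_ℂ) ∧ synth θ a = φ := by
  have hm : Memℓp (fun n => (basisWeight θ n : ℂ) * ⟪monomialState θ n, φ⟫_ℂ) 1 := by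
    refine memℓp_gen ?_
    simpa [Real.norm_of_nonneg (basisWeight_pos _).le, abs_of_pos (basisWeight_pos _)] using h
  refine ⟨⟨_, hm⟩, fun n => rfl, ?_⟩
  refine HasSum.unique (hasSum_synth _) (hasSum_of_eq (hasSum_inner_smul_monomialState φ)
    fun n => ?_)
  have hb : (basisWeight θ n : ℂ) ≠ 0 := by exact_mod_cast (basisWeight_pos n).ne'
  show (((basisWeight θ n : ℂ) * ⟪monomialState θ n, φ⟫_ℂ) / basisWeight θ n) • _ = _
  rw [mul_div_cancel_left₀ _ hb]

/-! ### The Hessian as a bilinear function of the background -/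

/-- The first component of the polarized Hessian, in linear coordinates: the conjugate fields are
replaced by their images under `J`. -/
noncomputable def vertexFst (w w' p : BargmannSpace θ × BargmannSpace θ) : BargmannSpace θ :=
  tri p.1 w.2 w'.1 + tri w.1 w'.2 p.1 + tri w.1 p.2 w'.1

/-- Rapid decay of both members of a pair. -/
def NicePair (w : BargmannSpace θ × BargmannSpace θ) : Prop := Nice w.1 ∧ Nice w.2

theorem vertexFst_add₁ {v w w' : BargmannSpace θ × BargmannSpace θ} (hv : NicePair v)
    (hw : NicePair w) (hw' : NicePair w') (p : BargmannSpace θ × BargmannSpace θ) :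
    vertexFst (v + w) w' p = vertexFst v w' p + vertexFst w w' p := by
  simp only [vertexFst, Prod.fst_add, Prod.snd_add]
  rw [tri_add₂ (triSummable₁ _ hv.2 hw'.1) (triSummable₁ _ hw.2 hw'.1),
    tri_add₁ (triSummable₃ _ hv.1 hw'.2) (triSummable₃ _ hw.1 hw'.2),
    tri_add₁ (triSummable₂ _ hv.1 hw'.1) (triSummable₂ _ hw.1 hw'.1)]
  abel

theorem vertexFst_add₂ {w v w' : BargmannSpace θ × BargmannSpace θ} (hw : NicePair w)
    (hv : NicePair v) (hw' : NicePair w') (p : BargmannSpace θ × BargmannSpace θ) :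
    vertexFst w (v + w') p = vertexFst w v p + vertexFst w w' p := by
  simp only [vertexFst, Prod.fst_add, Prod.snd_add]
  rw [tri_add₃ (triSummable₁ _ hw.2 hv.1) (triSummable₁ _ hw.2 hw'.1),
    tri_add₂ (triSummable₃ _ hw.1 hv.2) (triSummable₃ _ hw.1 hw'.2),
    tri_add₃ (triSummable₂ _ hw.1 hv.1) (triSummable₂ _ hw.1 hw'.1)]
  abel

theorem vertexFst_add₃ {w w' : BargmannSpace θ × BargmannSpace θ} (hw : NicePair w)
    (hw' : NicePair w') (p q : BargmannSpace θ × BargmannSpace θ) :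
    vertexFst w w' (p + q) = vertexFst w w' p + vertexFst w w' q := by
  simp only [vertexFst, Prod.fst_add, Prod.snd_add]
  rw [tri_add₁ (triSummable₁ _ hw.2 hw'.1) (triSummable₁ _ hw.2 hw'.1),
    tri_add₃ (triSummable₃ _ hw.1 hw'.2) (triSummable₃ _ hw.1 hw'.2),
    tri_add₂ (triSummable₂ _ hw.1 hw'.1) (triSummable₂ _ hw.1 hw'.1)]
  abel

theorem vertexFst_smul₁ {w w' : BargmannSpace θ × BargmannSpace θ} (hw : NicePair w)
    (hw' : NicePair w') (c : ℂ) (p : BargmannSpace θ × BargmannSpace θ) :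
    vertexFst (c • w) w' p = c • vertexFst w w' p := by
  simp only [vertexFst, Prod.smul_fst, Prod.smul_snd]
  rw [tri_smul₂ (triSummable₁ _ hw.2 hw'.1), tri_smul₁ (triSummable₃ _ hw.1 hw'.2),
    tri_smul₁ (triSummable₂ _ hw.1 hw'.1), smul_add, smul_add]

theorem vertexFst_smul₂ {w w' : BargmannSpace θ × BargmannSpace θ} (hw : NicePair w)
    (hw' : NicePair w') (c : ℂ) (p : BargmannSpace θ × BargmannSpace θ) :
    vertexFst w (c • w') p = c • vertexFst w w' p := by
  simp only [vertexFst, Prod.smul_fst, Prod.smul_snd]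
  rw [tri_smul₃ (triSummable₁ _ hw.2 hw'.1), tri_smul₂ (triSummable₃ _ hw.1 hw'.2),
    tri_smul₃ (triSummable₂ _ hw.1 hw'.1), smul_add, smul_add]

theorem vertexFst_smul₃ {w w' : BargmannSpace θ × BargmannSpace θ} (hw : NicePair w)
    (hw' : NicePair w') (c : ℂ) (p : BargmannSpace θ × BargmannSpace θ) :
    vertexFst w w' (c • p) = c • vertexFst w w' p := by
  simp only [vertexFst, Prod.smul_fst, Prod.smul_snd]
  rw [tri_smul₁ (triSummable₁ _ hw.2 hw'.1), tri_smul₃ (triSummable₃ _ hw.1 hw'.2),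
    tri_smul₂ (triSummable₂ _ hw.1 hw'.1), smul_add, smul_add]

/-- A pair of background fields. -/
noncomputable def synthPair (θ : ℝ) [hθ : Fact (0 < θ)] :
    Coeffs × Coeffs →ₗ[ℂ] BargmannSpace θ × BargmannSpace θ := (synth θ).prodMap (synth θ)

theorem nicePair_synthPair (w : Coeffs × Coeffs) : NicePair (synthPair θ w) :=
  ⟨nice_synth w.1, nice_synth w.2⟩

/-- The polarized Hessian at a fixed pair of backgrounds. -/
noncomputable def vertexEnd (w w' : Coeffs × Coeffs) :
    BargmannSpace θ × BargmannSpace θ →ₗ[ℂ] BargmannSpace θ where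
  toFun p := vertexFst (synthPair θ w) (synthPair θ w') p
  map_add' := vertexFst_add₃ (nicePair_synthPair w) (nicePair_synthPair w')
  map_smul' := vertexFst_smul₃ (nicePair_synthPair w) (nicePair_synthPair w')

/-- `vertexFst` as a multilinear map. -/
noncomputable def vertexLin (θ : ℝ) [hθ : Fact (0 < θ)] : Coeffs × Coeffs →ₗ[ℂ]
    Coeffs × Coeffs →ₗ[ℂ] BargmannSpace θ × BargmannSpace θ →ₗ[ℂ] BargmannSpace θ :=
  LinearMap.mk₂ ℂ vertexEnd
    (fun v w w' => LinearMap.ext fun p => by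
      show vertexFst (synthPair θ (v + w)) (synthPair θ w') p =
        vertexFst (synthPair θ v) (synthPair θ w') p + vertexFst (synthPair θ w) (synthPair θ w') p
      rw [map_add]
      exact vertexFst_add₁ (nicePair_synthPair v) (nicePair_synthPair w) (nicePair_synthPair w') p)
    (fun c w w' => LinearMap.ext fun p => by
      show vertexFst (synthPair θ (c • w)) (synthPair θ w') p =
        c • vertexFst (synthPair θ w) (synthPair θ w') p
      rw [map_smul]
      exact vertexFst_smul₁ (nicePair_synthPair w) (nicePair_synthPair w') c p)
    (fun w v w' => LinearMap.ext fun p => by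
      show vertexFst (synthPair θ w) (synthPair θ (v + w')) p =
        vertexFst (synthPair θ w) (synthPair θ v) p + vertexFst (synthPair θ w) (synthPair θ w') p
      rw [map_add]
      exact vertexFst_add₂ (nicePair_synthPair w) (nicePair_synthPair v) (nicePair_synthPair w') p)
    (fun c w w' => LinearMap.ext fun p => by
      show vertexFst (synthPair θ w) (synthPair θ (c • w')) p =
        c • vertexFst (synthPair θ w) (synthPair θ w') p
      rw [map_smul]
      exact vertexFst_smul₂ (nicePair_synthPair w) (nicePair_synthPair w') c p)

/-- The regularized propagator as a linear map. -/
noncomputable def propLin (θ μ₀ : ℝ) [hθ : Fact (0 < θ)] {ε : ℝ} (hε : 0 ≤ ε) :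
    BargmannSpace θ →ₗ[ℂ] BargmannSpace θ where
  toFun := propagator μ₀ ε
  map_add' := propagator_add μ₀ hε
  map_smul' := propagator_smul μ₀ hε

/-- Exchange of the two components of a pair. -/
noncomputable def swapLin (V : Type*) [AddCommGroup V] [Module ℂ V] : V × V →ₗ[ℂ] V × V :=
  (LinearMap.snd ℂ V V).prod (LinearMap.fst ℂ V V)

/-- One factor of the loop: propagator times polarized Hessian, in linear coordinates. In these
coordinates the second component is the first one with the two kinds of fields exchanged. -/
noncomputable def loopStep (θ μ₀ : ℝ) [hθ : Fact (0 < θ)] {ε : ℝ} (hε : 0 ≤ ε) :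
    Coeffs × Coeffs →ₗ[ℂ] Coeffs × Coeffs →ₗ[ℂ]
      Module.End ℂ (BargmannSpace θ × BargmannSpace θ) :=
  LinearMap.mk₂ ℂ
    (fun w w' => (propLin θ μ₀ hε ∘ₗ vertexLin θ w w').prod
      (propLin θ μ₀ hε ∘ₗ vertexLin θ (swapLin _ w) (swapLin _ w') ∘ₗ swapLin _))
    (fun v w w' => by
      refine LinearMap.ext fun p => Prod.ext ?_ ?_
      · show propLin θ μ₀ hε (vertexLin θ (v + w) w' p) =
          propLin θ μ₀ hε (vertexLin θ v w' p) + propLin θ μ₀ hε (vertexLin θ w w' p)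
        simp only [map_add, LinearMap.add_apply]
      · show propLin θ μ₀ hε (vertexLin θ (swapLin _ (v + w)) (swapLin _ w') (swapLin _ p)) =
          propLin θ μ₀ hε (vertexLin θ (swapLin _ v) (swapLin _ w') (swapLin _ p)) +
            propLin θ μ₀ hε (vertexLin θ (swapLin _ w) (swapLin _ w') (swapLin _ p))
        simp only [map_add, LinearMap.add_apply])
    (fun c w w' => by
      refine LinearMap.ext fun p => Prod.ext ?_ ?_
      · show propLin θ μ₀ hε (vertexLin θ (c • w) w' p) =
          c • propLin θ μ₀ hε (vertexLin θ w w' p)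
        simp only [map_smul, LinearMap.smul_apply]
      · show propLin θ μ₀ hε (vertexLin θ (swapLin _ (c • w)) (swapLin _ w') (swapLin _ p)) =
          c • propLin θ μ₀ hε (vertexLin θ (swapLin _ w) (swapLin _ w') (swapLin _ p))
        simp only [map_smul, LinearMap.smul_apply])
    (fun w v w' => by
      refine LinearMap.ext fun p => Prod.ext ?_ ?_
      · show propLin θ μ₀ hε (vertexLin θ w (v + w') p) =
          propLin θ μ₀ hε (vertexLin θ w v p) + propLin θ μ₀ hε (vertexLin θ w w' p)
        simp only [map_add, LinearMap.add_apply]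
      · show propLin θ μ₀ hε (vertexLin θ (swapLin _ w) (swapLin _ (v + w')) (swapLin _ p)) =
          propLin θ μ₀ hε (vertexLin θ (swapLin _ w) (swapLin _ v) (swapLin _ p)) +
            propLin θ μ₀ hε (vertexLin θ (swapLin _ w) (swapLin _ w') (swapLin _ p))
        simp only [map_add, LinearMap.add_apply])
    (fun c w w' => by
      refine LinearMap.ext fun p => Prod.ext ?_ ?_
      · show propLin θ μ₀ hε (vertexLin θ w (c • w') p) =
          c • propLin θ μ₀ hε (vertexLin θ w w' p)
        simp only [map_smul, LinearMap.smul_apply]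
      · show propLin θ μ₀ hε (vertexLin θ (swapLin _ w) (swapLin _ (c • w')) (swapLin _ p)) =
          c • propLin θ μ₀ hε (vertexLin θ (swapLin _ w) (swapLin _ w') (swapLin _ p))
        simp only [map_smul, LinearMap.smul_apply])

theorem loopStep_apply (μ₀ : ℝ) {ε : ℝ} (hε : 0 ≤ ε) (w w' : Coeffs × Coeffs)
    (p : BargmannSpace θ × BargmannSpace θ) : loopStep θ μ₀ hε w w' p =
      (propagator μ₀ ε (vertexFst (synthPair θ w) (synthPair θ w') p),
        propagator μ₀ ε (vertexFst (synthPair θ w).swap (synthPair θ w').swap p.swap)) := rfl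

attribute [irreducible] loopStep

/-- In linear coordinates the operator `H_ε⁻¹ B` is `loopStep`. -/
theorem loopOperator_eq (μ₀ : ℝ) {ε : ℝ} (hε : 0 ≤ ε) (w : Coeffs × Coeffs)
    (p : BargmannSpace θ × BargmannSpace θ) :
    loopOperator μ₀ ε (synth θ w.1) (J (synth θ w.2)) (p.1, J p.2) =
      ((loopStep θ μ₀ hε w w p).1, J (loopStep θ μ₀ hε w w p).2) := by
  have n1 := nice_synth (θ := θ) w.1
  have n2 := nice_synth (θ := θ) w.2
  rw [loopStep_apply]
  refine Prod.ext rfl ?_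
  show propagator μ₀ ε (hessian _ _ _).2 = J (propagator μ₀ ε _)
  rw [← propagator_J μ₀ hε]
  congr 1
  have h : J (hessian (synth θ w.1) (J (synth θ w.2)) (p.1, J p.2)).2 =
      vertexFst (synthPair θ w).swap (synthPair θ w).swap p.swap := by
    simp only [hessian, J_add, vertexFst, Prod.swap, synthPair, LinearMap.prodMap_apply]
    rw [J_act (triSummable₁ _ n1 n2), J_act (triSummable₃ _ n2 n1), J_act (triSummable₂ _ n2 n2)]
  rw [← h, J_J]

theorem end_pow_succ_apply {M : Type*} [AddCommGroup M] [Module ℂ M] (T : Module.End ℂ M) (N : ℕ)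
    (p : M) : (T ^ (N + 1)) p = T ((T ^ N) p) := by
  rw [pow_succ', Module.End.mul_apply]

theorem iterate_loopOperator_eq (μ₀ : ℝ) {ε : ℝ} (hε : 0 ≤ ε) (w : Coeffs × Coeffs) (N : ℕ)
    (p : BargmannSpace θ × BargmannSpace θ) :
    (loopOperator μ₀ ε (synth θ w.1) (J (synth θ w.2)))^[N] (p.1, J p.2) =
      (((loopStep θ μ₀ hε w w ^ N) p).1, J ((loopStep θ μ₀ hε w w ^ N) p).2) := by
  induction N with
  | zero => rfl
  | succ N ih =>
    have h := loopOperator_eq μ₀ hε w ((loopStep θ μ₀ hε w w ^ N) p)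
    have h' := end_pow_succ_apply (loopStep θ μ₀ hε w w) N p
    rw [Function.iterate_succ_apply', ih]
    exact h.trans (congrArg (fun x => (x.1, J x.2)) h'.symm)

theorem J_zero : J (0 : BargmannSpace θ) = 0 := by
  have := J_smul (θ := θ) 0 0
  rwa [zero_smul, map_zero, zero_smul] at this

theorem loopBlock_eq (μ₀ : ℝ) {ε : ℝ} (hε : 0 ≤ ε) (w : Coeffs × Coeffs) (N : ℕ)
    (η : BargmannSpace θ) :
    loopBlock μ₀ ε N (synth θ w.1) (J (synth θ w.2)) η =
      ((loopStep θ μ₀ hε w w ^ N) (η, 0)).1 := by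
  have h := iterate_loopOperator_eq μ₀ hε w N (η, 0)
  simp only [J_zero] at h
  rw [loopBlock, h]

theorem loopBlockConj_eq (μ₀ : ℝ) {ε : ℝ} (hε : 0 ≤ ε) (w : Coeffs × Coeffs) (N : ℕ)
    (ζ : BargmannSpace θ) :
    loopBlockConj μ₀ ε N (synth θ w.1) (J (synth θ w.2)) ζ =
      J ((loopStep θ μ₀ hε w w ^ N) (0, J ζ)).2 := by
  have h := iterate_loopOperator_eq μ₀ hε w N (0, J ζ)
  simp only [J_J] at h
  rw [loopBlockConj, h]

end

/-! ### Decay of iterated loop factors and the trace class property -/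

section
variable {θ : ℝ} [hθ : Fact (0 < θ)]

/-- Decay of both members of a pair. -/
def PDecay (s : ℕ) (C : ℝ) (p : BargmannSpace θ × BargmannSpace θ) : Prop :=
  Decay s C p.1 ∧ Decay s C p.2

theorem PDecay.mono {s s' : ℕ} {C C' : ℝ} {p : BargmannSpace θ × BargmannSpace θ}
    (h : PDecay s C p) (hs : s' ≤ s) (hC : C ≤ C') : PDecay s' C' p :=
  ⟨h.1.mono hs hC, h.2.mono hs hC⟩

theorem PDecay.add {s : ℕ} {C C' : ℝ} {p q : BargmannSpace θ × BargmannSpace θ}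
    (h : PDecay s C p) (h' : PDecay s C' q) : PDecay s (C + C') (p + q) :=
  ⟨h.1.add h'.1, h.2.add h'.2⟩

theorem PDecay.swap {s : ℕ} {C : ℝ} {p : BargmannSpace θ × BargmannSpace θ}
    (h : PDecay s C p) : PDecay s C p.swap := ⟨h.2, h.1⟩

theorem pdecay_synthPair (w : Coeffs × Coeffs) : PDecay 20 ‖w‖ (synthPair θ w) :=
  ⟨(decay_synth w.1).mono le_rfl (norm_fst_le w), (decay_synth w.2).mono le_rfl (norm_snd_le w)⟩

theorem exists_decay_vertexFst (θ : ℝ) [hθ : Fact (0 < θ)] : ∃ A : ℝ, 0 ≤ A ∧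
    ∀ s ≤ 6, ∀ (C C' D : ℝ) (w w' p : BargmannSpace θ × BargmannSpace θ), PDecay 20 C w →
      PDecay 20 C' w' → PDecay s D p → Decay s (A * (C * C') * D) (vertexFst w w' p) := by
  obtain ⟨A, hA, h⟩ := exists_decay_tri θ
  refine ⟨3 * A, by positivity, fun s hs C C' D w w' p hw hw' hp => ?_⟩
  have h1 := h s hs D C C' p.1 w.2 w'.1 (Or.inl ⟨hp.1, hw.2, hw'.1⟩)
  have h2 := h s hs C C' D w.1 w'.2 p.1 (Or.inr (Or.inr ⟨hw.1, hw'.2, hp.1⟩))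
  have h3 := h s hs C D C' w.1 p.2 w'.1 (Or.inr (Or.inl ⟨hw.1, hp.2, hw'.1⟩))
  exact ((h1.add h2).add h3).mono le_rfl (by apply le_of_eq; ring)

/-- Every loop factor improves the decay by two orders, up to the order `6`. -/
theorem exists_decay_loopStep (θ μ₀ : ℝ) [hθ : Fact (0 < θ)] : ∃ K : ℝ, 0 ≤ K ∧
    ∀ (ε : ℝ) (hε : 0 ≤ ε), ∀ s ≤ 6, ∀ (D : ℝ) (w w' : Coeffs × Coeffs)
      (p : BargmannSpace θ × BargmannSpace θ), PDecay s D p →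
      PDecay (min (s + 2) 6) (K * (‖w‖ * ‖w'‖) * D) (loopStep θ μ₀ hε w w' p) := by
  obtain ⟨A, hA, h⟩ := exists_decay_vertexFst θ
  choose B hB hBd using exists_decay_propagator θ μ₀
  refine ⟨(∑ s ∈ Finset.range 7, B s) * A,
    mul_nonneg (Finset.sum_nonneg fun s _ => hB s) hA, fun ε hε s hs D w w' p hp => ?_⟩
  have hD : 0 ≤ D := hp.1.nonneg
  have hle : B s ≤ ∑ s ∈ Finset.range 7, B s :=
    Finset.single_le_sum (f := B) (fun s _ => hB s) (Finset.mem_range.2 (by omega))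
  have hC : B s * (A * (‖w‖ * ‖w'‖) * D) ≤
      (∑ s ∈ Finset.range 7, B s) * A * (‖w‖ * ‖w'‖) * D := by
    calc B s * (A * (‖w‖ * ‖w'‖) * D) ≤ (∑ s ∈ Finset.range 7, B s) * (A * (‖w‖ * ‖w'‖) * D) :=
          mul_le_mul_of_nonneg_right hle (by positivity)
      _ = _ := by ring
  have hw := pdecay_synthPair (θ := θ) w
  have hw' := pdecay_synthPair (θ := θ) w'
  rw [loopStep_apply]
  exact ⟨(hBd s ε hε _ _ (h s hs _ _ _ _ _ _ hw hw' hp)).mono (min_le_left _ _) hC,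
    (hBd s ε hε _ _ (h s hs _ _ _ _ _ _ hw.swap hw'.swap hp.swap)).mono (min_le_left _ _) hC⟩

/-- The product of the loop factors for a list of pairs of backgrounds. -/
noncomputable def loopProd (θ μ₀ : ℝ) [hθ : Fact (0 < θ)] {ε : ℝ} (hε : 0 ≤ ε)
    (L : List ((Coeffs × Coeffs) × (Coeffs × Coeffs))) :
    Module.End ℂ (BargmannSpace θ × BargmannSpace θ) :=
  (L.map fun x => loopStep θ μ₀ hε x.1 x.2).prod

theorem loopProd_cons_apply (μ₀ : ℝ) {ε : ℝ} (hε : 0 ≤ ε)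
    (x : (Coeffs × Coeffs) × (Coeffs × Coeffs))
    (L : List ((Coeffs × Coeffs) × (Coeffs × Coeffs))) (p : BargmannSpace θ × BargmannSpace θ) :
    loopProd θ μ₀ hε (x :: L) p = loopStep θ μ₀ hε x.1 x.2 (loopProd θ μ₀ hε L p) := by
  unfold loopProd
  rw [List.map_cons, List.prod_cons]
  rfl

theorem loopProd_nil_apply (μ₀ : ℝ) {ε : ℝ} (hε : 0 ≤ ε) (p : BargmannSpace θ × BargmannSpace θ) :
    loopProd θ μ₀ hε [] p = p := rfl

/-- The product of the norms of the backgrounds in a list. -/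
noncomputable def listNorm (L : List ((Coeffs × Coeffs) × (Coeffs × Coeffs))) : ℝ :=
  (L.map fun x => ‖x.1‖ * ‖x.2‖).prod

theorem listNorm_nonneg (L : List ((Coeffs × Coeffs) × (Coeffs × Coeffs))) : 0 ≤ listNorm L := by
  refine List.prod_nonneg fun a ha => ?_
  obtain ⟨x, -, rfl⟩ := List.mem_map.1 ha
  positivity

theorem listNorm_cons (x : (Coeffs × Coeffs) × (Coeffs × Coeffs))
    (L : List ((Coeffs × Coeffs) × (Coeffs × Coeffs))) :
    listNorm (x :: L) = ‖x.1‖ * ‖x.2‖ * listNorm L := by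
  simp [listNorm]

/-- The constant of `exists_decay_loopStep`. -/
noncomputable def loopConst (θ μ₀ : ℝ) [hθ : Fact (0 < θ)] : ℝ :=
  (exists_decay_loopStep θ μ₀).choose

theorem loopConst_nonneg (θ μ₀ : ℝ) [hθ : Fact (0 < θ)] : 0 ≤ loopConst θ μ₀ :=
  (exists_decay_loopStep θ μ₀).choose_spec.1

/-- Three loop factors suffice for the decay order `6`, whatever the order at the start. -/
theorem pdecay_loopProd (μ₀ : ℝ) {ε : ℝ} (hε : 0 ≤ ε)
    (L : List ((Coeffs × Coeffs) × (Coeffs × Coeffs))) {D : ℝ}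
    {p : BargmannSpace θ × BargmannSpace θ} (hp : PDecay 0 D p) :
    PDecay (min (2 * L.length) 6) (loopConst θ μ₀ ^ L.length * listNorm L * D)
      (loopProd θ μ₀ hε L p) := by
  induction L with
  | nil =>
    rw [loopProd_nil_apply]
    refine hp.mono (by simp) (by simp [listNorm])
  | cons x L ih =>
    rw [loopProd_cons_apply]
    have h := (exists_decay_loopStep θ μ₀).choose_spec.2 ε hε _ (min_le_right _ _) _ x.1 x.2 _ ih
    refine h.mono ?_ (le_of_eq ?_)
    · rw [List.length_cons]; omega
    · rw [listNorm_cons, List.length_cons, pow_succ, loopConst]; ring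

theorem pdecay_loopProd_zero (μ₀ : ℝ) {ε : ℝ} (hε : 0 ≤ ε)
    (L : List ((Coeffs × Coeffs) × (Coeffs × Coeffs))) {D : ℝ}
    {p : BargmannSpace θ × BargmannSpace θ} (hp : PDecay 0 D p) :
    PDecay 0 (loopConst θ μ₀ ^ L.length * listNorm L * D) (loopProd θ μ₀ hε L p) :=
  (pdecay_loopProd μ₀ hε L hp).mono (Nat.zero_le _) le_rfl

theorem end_apply_sub_apply {M : Type*} [AddCommGroup M] [Module ℂ M] (T U : Module.End ℂ M)
    (x y : M) : T x - U y = T x - U x + U (x - y) := by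
  rw [map_sub]; abel

/-- The regularized loop products converge, at a linear rate. -/
theorem exists_pdecay_loopProd_sub (μ₀ : ℝ) (L : List ((Coeffs × Coeffs) × (Coeffs × Coeffs)))
    {D : ℝ} {p : BargmannSpace θ × BargmannSpace θ} (hp : PDecay 0 D p) :
    ∃ C : ℝ, ∀ (ε : ℝ) (hε : 0 ≤ ε),
      PDecay 0 (C * ε) (loopProd θ μ₀ hε L p - loopProd θ μ₀ le_rfl L p) := by
  induction L with
  | nil =>
    refine ⟨0, fun ε hε => ?_⟩
    rw [loopProd_nil_apply, loopProd_nil_apply, sub_self, zero_mul]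
    have h : Decay 0 0 (0 : BargmannSpace θ) := by
      have := decay_zero (0 : BargmannSpace θ); rwa [norm_zero] at this
    exact ⟨h, h⟩
  | cons x L ih =>
    obtain ⟨C, hC⟩ := ih
    obtain ⟨A, hA, hAd⟩ := exists_decay_vertexFst θ
    set M := loopConst θ μ₀ ^ L.length * listNorm L * D with hM
    set E := Real.exp (1 + 1 / (4 * (freq θ / 4))) with hE
    refine ⟨E * (A * (‖x.1‖ * ‖x.2‖) * M) + loopConst θ μ₀ * (‖x.1‖ * ‖x.2‖) * C,
      fun ε hε => ?_⟩
    have hx1 := pdecay_synthPair (θ := θ) x.1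
    have hx2 := pdecay_synthPair (θ := θ) x.2
    have hb := pdecay_loopProd_zero μ₀ hε L hp
    have h1 := hAd 0 (by norm_num) _ _ _ _ _ _ hx1 hx2 hb
    have h2 := hAd 0 (by norm_num) _ _ _ _ _ _ hx1.swap hx2.swap hb.swap
    have h3 : PDecay 0 (E * (A * (‖x.1‖ * ‖x.2‖) * M) * ε)
        (loopStep θ μ₀ hε x.1 x.2 (loopProd θ μ₀ hε L p) -
          loopStep θ μ₀ le_rfl x.1 x.2 (loopProd θ μ₀ hε L p)) := by
      rw [loopStep_apply, loopStep_apply]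
      exact ⟨decay_propagator_sub μ₀ hε h1, decay_propagator_sub μ₀ hε h2⟩
    have h4 := (exists_decay_loopStep θ μ₀).choose_spec.2 0 le_rfl 0 (by norm_num) _ x.1 x.2 _
      (hC ε hε)
    have h5 := h3.add (h4.mono (Nat.zero_le _) le_rfl)
    rw [loopProd_cons_apply, loopProd_cons_apply]
    have h6 := end_apply_sub_apply (loopStep θ μ₀ hε x.1 x.2) (loopStep θ μ₀ le_rfl x.1 x.2)
      (loopProd θ μ₀ hε L p) (loopProd θ μ₀ le_rfl L p)
    rw [h6]
    refine h5.mono le_rfl (le_of_eq ?_)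
    rw [loopConst]; ring

/-- A linear map into the functions of decay order `6` is of trace class: its matrix rows with
respect to the monomials have summable norms. -/
theorem isTraceClass_of_decay (T : BargmannSpace θ →ₗ[ℂ] BargmannSpace θ) {K : ℝ} (hK : 0 ≤ K)
    (h : ∀ η, Decay 6 (K * ‖η‖) (T η)) : IsTraceClass T := by
  have hb : ∀ n η, ‖⟪monomialState θ n, T η⟫_ℂ‖ ≤ K * traceWeight θ n * ‖η‖ := fun n η => by
    have := (h η).norm_inner_monomialState_le n
    linarith
  let ℓ : ℕ × ℕ → BargmannSpace θ →L[ℂ] ℂ := fun n =>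
    LinearMap.mkContinuous
      { toFun := fun η => ⟪monomialState θ n, T η⟫_ℂ
        map_add' := fun η ξ => by rw [map_add, inner_add_right]
        map_smul' := fun c η => by
          rw [map_smul, inner_smul_bargmann_right, RingHom.id_apply, smul_eq_mul] }
      (K * traceWeight θ n) (hb n)
  have hℓ : ∀ n, ‖ℓ n‖ ≤ K * traceWeight θ n := fun n =>
    LinearMap.mkContinuous_norm_le _ (mul_nonneg hK (traceWeight_nonneg n)) _
  let x : ℕ × ℕ → BargmannSpace θ := fun n =>
    (InnerProductSpace.toDual ℂ (BargmannSpace θ)).symm (ℓ n)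
  have hx : ∀ n η, ⟪x n, η⟫_ℂ = ⟪monomialState θ n, T η⟫_ℂ := fun n η =>
    InnerProductSpace.toDual_symm_apply
  have hxn : ∀ n, ‖x n‖ ≤ K * traceWeight θ n := fun n => by
    rw [LinearIsometryEquiv.norm_map]; exact hℓ n
  let e : ℕ ≃ ℕ × ℕ := Nat.pairEquiv.symm
  refine ⟨fun k => x (e k), fun k => monomialState θ (e k), ?_, fun η => ?_⟩
  · refine Summable.of_nonneg_of_le (fun k => by positivity) (fun k => ?_)
      ((e.summable_iff (f := fun n => K * traceWeight θ n)).2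
        ((summable_traceWeight (θ := θ)).mul_left K))
    rw [norm_monomialState, mul_one]
    exact hxn _
  · have h1 := (e.hasSum_iff).2 (hasSum_inner_smul_monomialState (T η))
    exact hasSum_of_eq h1 fun k => by rw [hx, Function.comp_apply]

theorem IsTraceClass.conj_J {T : BargmannSpace θ → BargmannSpace θ} (h : IsTraceClass T) :
    IsTraceClass fun ζ => J (T (J ζ)) := by
  obtain ⟨x, y, hs, hT⟩ := h
  refine ⟨fun n => J (x n), fun n => J (y n), by simpa only [norm_J] using hs, fun ζ => ?_⟩
  have h1 := (hT (J ζ)).mapL (Jₗᵢ (θ := θ)).toContinuousLinearMap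
  refine hasSum_of_eq h1 fun n => ?_
  show _ = J (⟪x n, J ζ⟫_ℂ • y n)
  rw [J_smul, ← inner_J_J, J_J]

theorem loopProd_replicate (μ₀ : ℝ) {ε : ℝ} (hε : 0 ≤ ε) (w : Coeffs × Coeffs) (N : ℕ) :
    loopProd θ μ₀ hε (List.replicate N (w, w)) = loopStep θ μ₀ hε w w ^ N := by
  rw [loopProd, List.map_replicate, List.prod_replicate]

theorem pdecay_inl (η : BargmannSpace θ) :
    PDecay 0 ‖η‖ ((η, 0) : BargmannSpace θ × BargmannSpace θ) :=
  ⟨decay_zero η, (decay_zero 0).mono le_rfl (by rw [norm_zero]; positivity)⟩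

theorem pdecay_inr (η : BargmannSpace θ) :
    PDecay 0 ‖η‖ ((0, η) : BargmannSpace θ × BargmannSpace θ) := (pdecay_inl η).swap

theorem decay_six_loopProd (μ₀ : ℝ) {ε : ℝ} (hε : 0 ≤ ε)
    {L : List ((Coeffs × Coeffs) × (Coeffs × Coeffs))} (hL : 2 < L.length) {D : ℝ}
    {p : BargmannSpace θ × BargmannSpace θ} (hp : PDecay 0 D p) :
    PDecay 6 (loopConst θ μ₀ ^ L.length * listNorm L * D) (loopProd θ μ₀ hε L p) :=
  (pdecay_loopProd μ₀ hε L hp).mono (by omega) le_rfl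

theorem isTraceClass_loopBlock (μ₀ : ℝ) {ε : ℝ} (hε : 0 ≤ ε) (w : Coeffs × Coeffs) {N : ℕ}
    (hN : 2 < N) : IsTraceClass (loopBlock μ₀ ε N (synth θ w.1) (J (synth θ w.2))) := by
  have h := isTraceClass_of_decay (LinearMap.fst ℂ _ _ ∘ₗ
    loopProd θ μ₀ hε (List.replicate N (w, w)) ∘ₗ LinearMap.inl ℂ _ _)
    (K := loopConst θ μ₀ ^ (List.replicate N (w, w)).length *
      listNorm (List.replicate N (w, w)))
    (mul_nonneg (pow_nonneg (loopConst_nonneg θ μ₀) _) (listNorm_nonneg _))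
    fun η => (decay_six_loopProd μ₀ hε (by rwa [List.length_replicate]) (pdecay_inl η)).1
  convert h using 1
  funext η
  rw [loopBlock_eq μ₀ hε, ← loopProd_replicate]
  rfl

theorem isTraceClass_loopBlockConj (μ₀ : ℝ) {ε : ℝ} (hε : 0 ≤ ε) (w : Coeffs × Coeffs) {N : ℕ}
    (hN : 2 < N) : IsTraceClass (loopBlockConj μ₀ ε N (synth θ w.1) (J (synth θ w.2))) := by
  have h := isTraceClass_of_decay (LinearMap.snd ℂ _ _ ∘ₗ
    loopProd θ μ₀ hε (List.replicate N (w, w)) ∘ₗ LinearMap.inr ℂ _ _)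
    (K := loopConst θ μ₀ ^ (List.replicate N (w, w)).length *
      listNorm (List.replicate N (w, w)))
    (mul_nonneg (pow_nonneg (loopConst_nonneg θ μ₀) _) (listNorm_nonneg _))
    fun η => (decay_six_loopProd μ₀ hε (by rwa [List.length_replicate]) (pdecay_inr η)).2
  convert h.conj_J using 1
  funext η
  rw [loopBlockConj_eq μ₀ hε, ← loopProd_replicate]
  rfl

/-! ### The diagonal matrix elements of a loop -/

/-- The contribution of a basis vector, in both copies of the Bargmann space, to the trace of a
loop. -/
noncomputable def traceTerm (θ μ₀ : ℝ) [hθ : Fact (0 < θ)] {ε : ℝ} (hε : 0 ≤ ε)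
    (L : List ((Coeffs × Coeffs) × (Coeffs × Coeffs))) (n : ℕ × ℕ) : ℂ :=
  ⟪monomialState θ n, (loopProd θ μ₀ hε L (monomialState θ n, 0)).1⟫_ℂ +
    ⟪monomialState θ n, (loopProd θ μ₀ hε L (0, monomialState θ n)).2⟫_ℂ

theorem norm_traceTerm_fst_le (μ₀ : ℝ) {ε : ℝ} (hε : 0 ≤ ε)
    {L : List ((Coeffs × Coeffs) × (Coeffs × Coeffs))} (hL : 2 < L.length) (n : ℕ × ℕ) :
    ‖⟪monomialState θ n, (loopProd θ μ₀ hε L (monomialState θ n, 0)).1⟫_ℂ‖ ≤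
      loopConst θ μ₀ ^ L.length * listNorm L * traceWeight θ n := by
  have := (decay_six_loopProd μ₀ hε hL (pdecay_inl (monomialState θ n))).1
  rw [norm_monomialState, mul_one] at this
  exact this.norm_inner_monomialState_le n

theorem norm_traceTerm_snd_le (μ₀ : ℝ) {ε : ℝ} (hε : 0 ≤ ε)
    {L : List ((Coeffs × Coeffs) × (Coeffs × Coeffs))} (hL : 2 < L.length) (n : ℕ × ℕ) :
    ‖⟪monomialState θ n, (loopProd θ μ₀ hε L (0, monomialState θ n)).2⟫_ℂ‖ ≤
      loopConst θ μ₀ ^ L.length * listNorm L * traceWeight θ n := by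
  have := (decay_six_loopProd μ₀ hε hL (pdecay_inr (monomialState θ n))).2
  rw [norm_monomialState, mul_one] at this
  exact this.norm_inner_monomialState_le n

theorem norm_traceTerm_le (μ₀ : ℝ) {ε : ℝ} (hε : 0 ≤ ε)
    {L : List ((Coeffs × Coeffs) × (Coeffs × Coeffs))} (hL : 2 < L.length) (n : ℕ × ℕ) :
    ‖traceTerm θ μ₀ hε L n‖ ≤
      2 * (loopConst θ μ₀ ^ L.length * listNorm L) * traceWeight θ n := by
  have := norm_add_le_of_le (norm_traceTerm_fst_le (θ := θ) μ₀ hε hL n)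
    (norm_traceTerm_snd_le (θ := θ) μ₀ hε hL n)
  rw [traceTerm]
  linarith

/-- The effective action of a background field as a sum of diagonal matrix elements of the loop. The
complex conjugation of the trace of the second block is undone by the passage to linear
coordinates. -/
theorem effectiveAction_eq (μ₀ lam : ℝ) {ε : ℝ} (hε : 0 ≤ ε) (w : Coeffs × Coeffs) {N : ℕ}
    (hN : 2 < N) : effectiveAction μ₀ lam ε N (synth θ w.1) (J (synth θ w.2)) =
      1 / 2 * ((-1) ^ (N + 1) * (lam : ℂ) ^ N / (N : ℂ)) *
        ∑' n, traceTerm θ μ₀ hε (List.replicate N (w, w)) n := by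
  have hL : 2 < (List.replicate N (w, w)).length := by rwa [List.length_replicate]
  have s1 := Summable.of_norm_bounded ((summable_traceWeight (θ := θ)).mul_left _)
    (norm_traceTerm_fst_le μ₀ hε hL)
  have s2 := Summable.of_norm_bounded ((summable_traceWeight (θ := θ)).mul_left _)
    (norm_traceTerm_snd_le μ₀ hε hL)
  have h1 : opTrace (loopBlock μ₀ ε N (synth θ w.1) (J (synth θ w.2))) =
      ∑' n, ⟪monomialState θ n,
        (loopProd θ μ₀ hε (List.replicate N (w, w)) (monomialState θ n, 0)).1⟫_ℂ := by
    rw [opTrace_eq]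
    exact tsum_congr fun n => by rw [loopBlock_eq μ₀ hε, ← loopProd_replicate]
  have h2 : conj (opTrace (loopBlockConj μ₀ ε N (synth θ w.1) (J (synth θ w.2)))) =
      ∑' n, ⟪monomialState θ n,
        (loopProd θ μ₀ hε (List.replicate N (w, w)) (0, monomialState θ n)).2⟫_ℂ := by
    rw [opTrace_eq, Complex.conj_tsum]
    exact tsum_congr fun n => by
      rw [loopBlockConj_eq μ₀ hε, ← loopProd_replicate, J_monomialState, inner_monomialState_J,
        Complex.conj_conj]
  rw [effectiveAction, h1, h2, ← s1.tsum_add s2]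
  simp only [traceTerm]
  ring

theorem tendsto_inner_of_decay {x : NNReal → BargmannSpace θ} {y : BargmannSpace θ} {C : ℝ}
    (h : ∀ e : NNReal, Decay 0 (C * e) (x e - y)) (n : ℕ × ℕ) :
    Tendsto (fun e => ⟪monomialState θ n, x e⟫_ℂ) (𝓝 0) (𝓝 ⟪monomialState θ n, y⟫_ℂ) := by
  rw [tendsto_iff_norm_sub_tendsto_zero]
  have hb : ∀ e : NNReal, ‖⟪monomialState θ n, x e⟫_ℂ - ⟪monomialState θ n, y⟫_ℂ‖ ≤
      innerConst θ * basisWeight θ n * C * e := fun e => by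
    have h1 := norm_inner_translation_le (s := 0)
      ((decay_monomialState (θ := θ) n).mono (by norm_num) le_rfl) (h e) 0 0
    have h0 : ∀ φ : BargmannSpace θ, translation θ 0 φ = φ := fun φ => by
      apply toFun_injective
      rw [toFun_translation]
      funext z
      simp [transFun]
    rw [h0, h0, inner_sub_right, pow_zero, div_one] at h1
    linarith
  refine squeeze_zero (fun e => norm_nonneg _) hb ?_
  have h2 : Continuous fun e : NNReal => innerConst θ * basisWeight θ n * C * (e : ℝ) := by fun_prop
  simpa using h2.tendsto 0

theorem tendsto_traceTerm (μ₀ : ℝ) (L : List ((Coeffs × Coeffs) × (Coeffs × Coeffs)))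
    (n : ℕ × ℕ) : Tendsto (fun e : NNReal => traceTerm θ μ₀ e.2 L n) (𝓝 0)
      (𝓝 (traceTerm θ μ₀ (0 : NNReal).2 L n)) := by
  obtain ⟨C, hC⟩ := exists_pdecay_loopProd_sub (θ := θ) μ₀ L (pdecay_inl (monomialState θ n))
  obtain ⟨C', hC'⟩ := exists_pdecay_loopProd_sub (θ := θ) μ₀ L (pdecay_inr (monomialState θ n))
  exact (tendsto_inner_of_decay (fun e => (hC e e.2).1) n).add
    (tendsto_inner_of_decay (fun e => (hC' e e.2).2) n)

end

/-! ### Polarization -/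

section
variable {κ I W G A : Type*} [AddCommGroup W] [Module ℂ W] [AddCommGroup G] [Module ℂ G]

/-- Inclusion and exclusion over the subsets that contain the range of `r`. -/
theorem sum_superset_neg_one_pow [Fintype κ] [Fintype I] [DecidableEq I] (r : κ → I) :
    ∑ U : Finset I, (if ∀ k, r k ∈ U then (-1 : ℂ) ^ Uᶜ.card else 0) =
      if Function.Surjective r then 1 else 0 := by
  have h0 : ∀ f : Finset I → ℂ, ∑ U, f U = ∑ T, f Tᶜ := fun f =>
    (Equiv.sum_comp (Function.Involutive.toPerm (compl : Finset I → Finset I)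
      compl_involutive) f).symm
  rw [h0]
  have h1 : ∀ T : Finset I, (∀ k, r k ∈ Tᶜ) ↔ T ∈ (Finset.univ.image r)ᶜ.powerset := by
    intro T
    rw [Finset.mem_powerset]
    constructor
    · intro h i hi
      rw [Finset.mem_compl, Finset.mem_image]
      rintro ⟨k, -, rfl⟩
      exact (Finset.mem_compl.1 (h k)) hi
    · intro h k
      rw [Finset.mem_compl]
      intro hk
      exact Finset.mem_compl.1 (h hk) (Finset.mem_image_of_mem _ (Finset.mem_univ _))
  have h2 : ∀ T : Finset I, (if ∀ k, r k ∈ Tᶜ then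
      (-1 : ℂ) ^ Tᶜᶜ.card else 0) =
      if T ∈ (Finset.univ.image r)ᶜ.powerset then (-1 : ℂ) ^ T.card else 0 := by
    intro T
    rw [compl_compl]
    exact if_congr (h1 T) rfl rfl
  rw [Finset.sum_congr rfl fun T _ => h2 T, ← Finset.sum_filter, Finset.filter_mem_eq_inter,
    Finset.univ_inter]
  have h3 := Finset.sum_powerset_neg_one_pow_card (x := (Finset.univ.image r)ᶜ)
  have h4 : ∑ T ∈ (Finset.univ.image r)ᶜ.powerset, (-1 : ℂ) ^ T.card =
      ((∑ T ∈ (Finset.univ.image r)ᶜ.powerset, (-1 : ℤ) ^ T.card : ℤ) : ℂ) := by push_cast; rfl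
  rw [h4, h3]
  have h5 : (Finset.univ.image r)ᶜ = ∅ ↔ Function.Surjective r := by
    rw [Finset.compl_eq_empty_iff, Finset.eq_univ_iff_forall]
    simp [Function.Surjective]
  by_cases h : Function.Surjective r
  · rw [if_pos (h5.2 h), if_pos h, Int.cast_one]
  · rw [if_neg (fun h' => h (h5.1 h')), if_neg h, Int.cast_zero]

/-- The alternating sum over all partial sums extracts the terms of a multilinear expression in
which every vector occurs. -/
theorem sum_polarization [Fintype κ] [DecidableEq κ] [Fintype I] [DecidableEq I]
    (D : MultilinearMap ℂ (fun _ : κ => W) G) (x : I → W)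
    (hcard : Fintype.card κ = Fintype.card I) :
    ∑ U : Finset I, (-1 : ℂ) ^ Uᶜ.card • D (fun _ => ∑ i ∈ U, x i) =
      ∑ e : κ ≃ I, D fun k => x (e k) := by
  have h1 : ∀ U : Finset I, (-1 : ℂ) ^ Uᶜ.card • D (fun _ => ∑ i ∈ U, x i) =
      ∑ r : κ → I, (if ∀ k, r k ∈ U then (-1 : ℂ) ^ Uᶜ.card else 0) • D fun k => x (r k) := by
    intro U
    rw [D.map_sum_finset (fun _ i => x i) fun _ => U, Finset.smul_sum]
    have : Fintype.piFinset (fun _ : κ => U) =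
        Finset.univ.filter fun r : κ → I => ∀ k, r k ∈ U := by
      ext r; simp
    rw [this, Finset.sum_filter]
    refine Finset.sum_congr rfl fun r _ => ?_
    split_ifs <;> simp
  rw [Finset.sum_congr rfl fun U _ => h1 U, Finset.sum_comm]
  simp_rw [← Finset.sum_smul, sum_superset_neg_one_pow, ite_smul, one_smul, zero_smul]
  rw [← Finset.sum_filter]
  symm
  refine Finset.sum_bij (fun e _ => (e : κ → I)) (fun e _ => by simp [e.surjective])
    (fun e _ e' _ h => DFunLike.coe_injective h) (fun r hr => ?_) (fun e _ => rfl)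
  have hr' : Function.Surjective r := (Finset.mem_filter.1 hr).2
  exact ⟨Equiv.ofBijective r ((Fintype.bijective_iff_surjective_and_card r).2 ⟨hr', hcard⟩),
    Finset.mem_univ _, rfl⟩

/-- The product of the values of a bilinear map on consecutive pairs of arguments. -/
noncomputable def pairProd [Ring A] [Algebra ℂ A] (N : ℕ) (B : W →ₗ[ℂ] W →ₗ[ℂ] A) :
    MultilinearMap ℂ (fun _ : Fin N × Bool => W) A where
  toFun w := MultilinearMap.mkPiAlgebraFin ℂ N A fun k => B (w (k, false)) (w (k, true))
  map_update_add' := by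
    intro _ m i x y
    -- only the factor with the index `i.1` depends on the argument with the index `i`
    have key : ∀ x, (fun k => B (Function.update m i x (k, false))
        (Function.update m i x (k, true))) =
        Function.update (fun k => B (m (k, false)) (m (k, true))) i.1
          (if i.2 then B (m (i.1, false)) x else B x (m (i.1, true))) := by
      intro x
      obtain ⟨k, b⟩ := i
      funext k'
      by_cases hk : k' = k
      · subst hk
        cases b <;> simp
      · simp [hk]
    simp only [key]
    rw [← MultilinearMap.map_update_add]
    congr 2
    split_ifs <;> simp
  map_update_smul' := by
    intro _ m i c x
    -- only the factor with the index `i.1` depends on the argument with the index `i`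
    have key : ∀ x, (fun k => B (Function.update m i x (k, false))
        (Function.update m i x (k, true))) =
        Function.update (fun k => B (m (k, false)) (m (k, true))) i.1
          (if i.2 then B (m (i.1, false)) x else B x (m (i.1, true))) := by
      intro x
      obtain ⟨k, b⟩ := i
      funext k'
      by_cases hk : k' = k
      · subst hk
        cases b <;> simp
      · simp [hk]
    simp only [key]
    rw [← MultilinearMap.map_update_smul]
    congr 2
    split_ifs <;> simp

theorem pairProd_apply [Ring A] [Algebra ℂ A] (N : ℕ) (B : W →ₗ[ℂ] W →ₗ[ℂ] A)
    (w : Fin N × Bool → W) :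
    pairProd N B w = (List.ofFn fun k => B (w (k, false)) (w (k, true))).prod :=
  MultilinearMap.mkPiAlgebraFin_apply (R := ℂ) _

/-- A pointwise convergent series of multilinear maps. -/
noncomputable def tsumMultilinear {J : Type*} {V : κ → Type*} [∀ k, AddCommGroup (V k)]
    [∀ k, Module ℂ (V k)] (D : J → MultilinearMap ℂ V ℂ) (h : ∀ w, Summable fun n => D n w) :
    MultilinearMap ℂ V ℂ where
  toFun w := ∑' n, D n w
  map_update_add' := by
    intro _ m i x y
    simp only [MultilinearMap.map_update_add]
    exact (h _).tsum_add (h _)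
  map_update_smul' := by
    intro _ m i c x
    simp only [MultilinearMap.map_update_smul]
    exact tsum_const_smul'' c

end

/-! ### The loop trace as a multilinear form -/

section
variable {θ : ℝ} [hθ : Fact (0 < θ)]

/-- The list of consecutive pairs of a family of backgrounds. -/
def pairList {N : ℕ} (w : Fin N × Bool → Coeffs × Coeffs) :
    List ((Coeffs × Coeffs) × (Coeffs × Coeffs)) :=
  List.ofFn fun k => (w (k, false), w (k, true))

theorem length_pairList {N : ℕ} (w : Fin N × Bool → Coeffs × Coeffs) :
    (pairList w).length = N := List.length_ofFn

theorem listNorm_pairList {N : ℕ} (w : Fin N × Bool → Coeffs × Coeffs) :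
    listNorm (pairList w) = ∏ i, ‖w i‖ := by
  rw [listNorm, pairList, List.map_ofFn, List.prod_ofFn, Fintype.prod_prod_type]
  refine Finset.prod_congr rfl fun k _ => ?_
  rw [Fintype.prod_bool, mul_comm]
  rfl

/-- The matrix element functional of `traceTerm`. -/
noncomputable def traceFunctional (θ : ℝ) (n : ℕ × ℕ) :
    Module.End ℂ (BargmannSpace θ × BargmannSpace θ) →ₗ[ℂ] ℂ where
  toFun T := ⟪monomialState θ n, (T (monomialState θ n, 0)).1⟫_ℂ +
    ⟪monomialState θ n, (T (0, monomialState θ n)).2⟫_ℂ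
  map_add' T U := by
    rw [LinearMap.add_apply, LinearMap.add_apply, Prod.fst_add, Prod.snd_add, inner_add_right,
      inner_add_right]
    ring
  map_smul' c T := by
    rw [LinearMap.smul_apply, LinearMap.smul_apply, Prod.smul_fst, Prod.smul_snd,
      inner_smul_bargmann_right, inner_smul_bargmann_right, RingHom.id_apply, smul_eq_mul]
    ring

/-- `traceTerm` as a multilinear form. -/
noncomputable def traceTermMulti (θ μ₀ : ℝ) [hθ : Fact (0 < θ)] (e : NNReal) (N : ℕ) (n : ℕ × ℕ) :
    MultilinearMap ℂ (fun _ : Fin N × Bool => Coeffs × Coeffs) ℂ :=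
  (traceFunctional θ n).compMultilinearMap (pairProd N (loopStep θ μ₀ e.2))

theorem traceTermMulti_apply (μ₀ : ℝ) (e : NNReal) (N : ℕ) (n : ℕ × ℕ)
    (w : Fin N × Bool → Coeffs × Coeffs) :
    traceTermMulti θ μ₀ e N n w = traceTerm θ μ₀ e.2 (pairList w) n := by
  have h : pairProd N (loopStep θ μ₀ e.2) w = loopProd θ μ₀ e.2 (pairList w) := by
    rw [pairProd_apply, loopProd, pairList, List.map_ofFn]
    rfl
  show traceFunctional θ n (pairProd N (loopStep θ μ₀ e.2) w) = _
  rw [h]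
  rfl

/-- The constant in the bound on the trace of a loop, uniform in the regularization. -/
noncomputable def traceConst (θ μ₀ : ℝ) [hθ : Fact (0 < θ)] (N : ℕ) : ℝ :=
  2 * loopConst θ μ₀ ^ N * ∑' n, traceWeight θ n

theorem norm_traceTermMulti_le (μ₀ : ℝ) (e : NNReal) {N : ℕ} (hN : 2 < N)
    (w : Fin N × Bool → Coeffs × Coeffs) (n : ℕ × ℕ) :
    ‖traceTermMulti θ μ₀ e N n w‖ ≤
      2 * (loopConst θ μ₀ ^ N * ∏ i, ‖w i‖) * traceWeight θ n := by
  rw [traceTermMulti_apply]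
  have := norm_traceTerm_le (θ := θ) μ₀ e.2 (L := pairList w) (by rwa [length_pairList]) n
  rwa [length_pairList, listNorm_pairList] at this

theorem summable_traceTermMulti (μ₀ : ℝ) (e : NNReal) {N : ℕ} (hN : 2 < N)
    (w : Fin N × Bool → Coeffs × Coeffs) :
    Summable fun n => traceTermMulti θ μ₀ e N n w :=
  Summable.of_norm_bounded ((summable_traceWeight (θ := θ)).mul_left _)
    (norm_traceTermMulti_le μ₀ e hN w)

/-- The trace of a loop as a multilinear form in the backgrounds at its vertices. -/
noncomputable def loopTrace (θ μ₀ : ℝ) [hθ : Fact (0 < θ)] (e : NNReal) {N : ℕ} (hN : 2 < N) :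
    MultilinearMap ℂ (fun _ : Fin N × Bool => Coeffs × Coeffs) ℂ :=
  tsumMultilinear (traceTermMulti θ μ₀ e N) (summable_traceTermMulti μ₀ e hN)

theorem loopTrace_apply (μ₀ : ℝ) (e : NNReal) {N : ℕ} (hN : 2 < N)
    (w : Fin N × Bool → Coeffs × Coeffs) :
    loopTrace θ μ₀ e hN w = ∑' n, traceTermMulti θ μ₀ e N n w := rfl

theorem norm_loopTrace_le (μ₀ : ℝ) (e : NNReal) {N : ℕ} (hN : 2 < N)
    (w : Fin N × Bool → Coeffs × Coeffs) :
    ‖loopTrace θ μ₀ e hN w‖ ≤ traceConst θ μ₀ N * ∏ i, ‖w i‖ := by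
  rw [loopTrace_apply]
  refine (tsum_of_norm_bounded ((summable_traceWeight (θ := θ)).mul_left _).hasSum
    (norm_traceTermMulti_le μ₀ e hN w)).trans (le_of_eq ?_)
  rw [tsum_mul_left, traceConst]
  ring

theorem tendsto_loopTrace (μ₀ : ℝ) {N : ℕ} (hN : 2 < N) (w : Fin N × Bool → Coeffs × Coeffs) :
    Tendsto (fun e => loopTrace θ μ₀ e hN w) (𝓝 0) (𝓝 (loopTrace θ μ₀ 0 hN w)) := by
  simp only [loopTrace_apply]
  refine tendsto_tsum_of_dominated_convergence
    (bound := fun n => 2 * (loopConst θ μ₀ ^ N * ∏ i, ‖w i‖) * traceWeight θ n)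
    ((summable_traceWeight (θ := θ)).mul_left _) (fun n => ?_)
    (Eventually.of_forall fun e n => norm_traceTermMulti_le μ₀ e hN w n)
  simp only [traceTermMulti_apply]
  exact tendsto_traceTerm μ₀ _ n

/-- An external field, placed in the first or the second component of the background. -/
noncomputable def externalField {N : ℕ} (i : Fin N ⊕ Fin N) : Coeffs →ₗ[ℂ] Coeffs × Coeffs :=
  i.elim (fun _ => LinearMap.inl ℂ Coeffs Coeffs) fun _ => LinearMap.inr ℂ Coeffs Coeffs

theorem norm_externalField {N : ℕ} (i : Fin N ⊕ Fin N) (a : Coeffs) :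
    ‖externalField i a‖ = ‖a‖ := by
  cases i
  · show ‖((a, 0) : Coeffs × Coeffs)‖ = _
    rw [Prod.norm_mk, norm_zero, max_eq_left (norm_nonneg _)]
  · show ‖((0, a) : Coeffs × Coeffs)‖ = _
    rw [Prod.norm_mk, norm_zero, max_eq_right (norm_nonneg _)]

/-- The Green's function without its prefactor: the sum of the loop traces over all ways of
attaching the external fields to the loop. -/
noncomputable def greenLin (θ μ₀ : ℝ) [hθ : Fact (0 < θ)] (e : NNReal) {N : ℕ} (hN : 2 < N) :
    MultilinearMap ℂ (fun _ : Fin N ⊕ Fin N => Coeffs) ℂ :=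
  ∑ σ : (Fin N × Bool) ≃ (Fin N ⊕ Fin N),
    ((loopTrace θ μ₀ e hN).domDomCongr σ).compLinearMap externalField

theorem greenLin_apply (μ₀ : ℝ) (e : NNReal) {N : ℕ} (hN : 2 < N)
    (a : Fin N ⊕ Fin N → Coeffs) : greenLin θ μ₀ e hN a =
      ∑ σ : (Fin N × Bool) ≃ (Fin N ⊕ Fin N),
        loopTrace θ μ₀ e hN fun k => externalField (σ k) (a (σ k)) := by
  rw [greenLin, sum_apply]
  rfl

/-- The constant in the bound on the Green's functions, uniform in the regularization. -/
noncomputable def greenConst (θ μ₀ : ℝ) [hθ : Fact (0 < θ)] (N : ℕ) : ℝ :=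
  Fintype.card ((Fin N × Bool) ≃ (Fin N ⊕ Fin N)) * traceConst θ μ₀ N

theorem norm_greenLin_le (μ₀ : ℝ) (e : NNReal) {N : ℕ} (hN : 2 < N)
    (a : Fin N ⊕ Fin N → Coeffs) :
    ‖greenLin θ μ₀ e hN a‖ ≤ greenConst θ μ₀ N * ∏ i, ‖a i‖ := by
  rw [greenLin_apply]
  refine (norm_sum_le _ _).trans ?_
  have h : ∀ σ : (Fin N × Bool) ≃ (Fin N ⊕ Fin N),
      ‖loopTrace θ μ₀ e hN fun k => externalField (σ k) (a (σ k))‖ ≤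
        traceConst θ μ₀ N * ∏ i, ‖a i‖ := fun σ => by
    refine (norm_loopTrace_le μ₀ e hN _).trans (le_of_eq ?_)
    simp only [norm_externalField]
    rw [σ.prod_comp fun i => ‖a i‖]
  refine (Finset.sum_le_sum fun σ _ => h σ).trans (le_of_eq ?_)
  rw [Finset.sum_const, Finset.card_univ, nsmul_eq_mul, greenConst, mul_assoc]

theorem tendsto_greenLin (μ₀ : ℝ) {N : ℕ} (hN : 2 < N) (a : Fin N ⊕ Fin N → Coeffs) :
    Tendsto (fun e => greenLin θ μ₀ e hN a) (𝓝 0) (𝓝 (greenLin θ μ₀ 0 hN a)) := by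
  simp only [greenLin_apply]
  exact tendsto_finsetSum _ fun σ _ => tendsto_loopTrace μ₀ hN _

/-- The prefactor of the Green's functions. -/
noncomputable def greenPrefactor (lam : ℝ) (N : ℕ) : ℂ :=
  1 / 2 * ((-1) ^ (N + 1) * (lam : ℂ) ^ N / (N : ℂ))

theorem J_sum {ι : Type*} (S : Finset ι) (f : ι → BargmannSpace θ) :
    J (∑ i ∈ S, f i) = ∑ i ∈ S, J (f i) := map_sum (Jₗᵢ (θ := θ)) f S

/-- The alternating sum over two families of subsets that defines the Green's function is a
polarization over the disjoint union of the two index sets. -/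
theorem green_eq_greenLin (μ₀ lam : ℝ) (e : NNReal) {N : ℕ} (hN : 2 < N)
    (a : Fin N ⊕ Fin N → Coeffs) :
    green μ₀ lam e N (fun i => synth θ (a (Sum.inl i))) (fun j => J (synth θ (a (Sum.inr j)))) =
      greenPrefactor lam N * greenLin θ μ₀ e hN a := by
  have hcard : Fintype.card (Fin N × Bool) = Fintype.card (Fin N ⊕ Fin N) := by
    simp [mul_two]
  have h1 := sum_polarization (loopTrace θ μ₀ e hN) (fun i => externalField i (a i)) hcard
  rw [greenLin_apply, ← h1, ← Equiv.sum_comp Finset.sumEquiv.symm.toEquiv, Fintype.sum_prod_type,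
    green, Finset.mul_sum]
  refine Finset.sum_congr rfl fun S _ => ?_
  rw [Finset.mul_sum]
  refine Finset.sum_congr rfl fun T _ => ?_
  have h2 : ∑ i ∈ Finset.sumEquiv.symm (S, T), externalField i (a i) =
      (∑ i ∈ S, a (Sum.inl i), ∑ j ∈ T, a (Sum.inr j)) := by
    show ∑ i ∈ S.disjSum T, externalField i (a i) = _
    rw [Finset.sum_disjSum]
    show ∑ i ∈ S, ((a (Sum.inl i), 0) : Coeffs × Coeffs) +
      ∑ j ∈ T, ((0, a (Sum.inr j)) : Coeffs × Coeffs) = _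
    refine Prod.ext ?_ ?_ <;> simp [Prod.fst_sum, Prod.snd_sum]
  have h3 : (Finset.sumEquiv.symm (S, T) : Finset (Fin N ⊕ Fin N))ᶜ.card = Sᶜ.card + Tᶜ.card := by
    rw [Finset.card_compl, Finset.card_compl, Finset.card_compl]
    show _ - (S.disjSum T).card = _
    rw [Finset.card_disjSum, Fintype.card_sum]
    have := S.card_le_univ
    have := T.card_le_univ
    omega
  show _ = greenPrefactor lam N * ((-1 : ℂ) ^ (Finset.sumEquiv.symm (S, T))ᶜ.card •
    loopTrace θ μ₀ e hN fun _ => ∑ i ∈ Finset.sumEquiv.symm (S, T), externalField i (a i))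
  rw [h2, h3, ← map_sum, ← J_sum, ← map_sum]
  have h4 := effectiveAction_eq μ₀ lam e.2
    (∑ i ∈ S, a (Sum.inl i), ∑ j ∈ T, a (Sum.inr j)) (θ := θ) hN
  have h5 : ∀ w : Coeffs × Coeffs, pairList (fun _ : Fin N × Bool => w) =
      List.replicate N (w, w) := fun w => List.ofFn_const _ _
  rw [loopTrace_apply]
  simp only [traceTermMulti_apply, h5]
  rw [smul_eq_mul, mul_left_comm]
  exact congrArg _ h4

/-- The multilinear form of the Green's function as a continuous multilinear map. -/
noncomputable def greenCLM (θ μ₀ : ℝ) [hθ : Fact (0 < θ)] (e : NNReal) {N : ℕ} (hN : 2 < N) :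
    ContinuousMultilinearMap ℂ (fun _ : Fin N ⊕ Fin N => Coeffs) ℂ :=
  (greenLin θ μ₀ e hN).mkContinuous (greenConst θ μ₀ N) (norm_greenLin_le μ₀ e hN)

/-- The value of the Green's function, without its prefactor, on basis sequences. -/
noncomputable def greenCoeff (θ μ₀ : ℝ) [hθ : Fact (0 < θ)] (e : NNReal) {N : ℕ} (hN : 2 < N)
    (k : Fin N ⊕ Fin N → ℕ × ℕ) : ℂ :=
  greenLin θ μ₀ e hN fun i => lp.single 1 (k i) (1 : ℂ)

theorem norm_greenCoeff_le (μ₀ : ℝ) (e : NNReal) {N : ℕ} (hN : 2 < N)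
    (k : Fin N ⊕ Fin N → ℕ × ℕ) : ‖greenCoeff θ μ₀ e hN k‖ ≤ greenConst θ μ₀ N := by
  refine (norm_greenLin_le μ₀ e hN _).trans (le_of_eq ?_)
  have h : ∀ n : ℕ × ℕ, ‖(lp.single 1 n (1 : ℂ) : Coeffs)‖ = 1 := fun n => by
    rw [lp.norm_single (by norm_num)]; simp
  simp only [h, Finset.prod_const_one, mul_one]

theorem tendsto_greenCoeff (μ₀ : ℝ) {N : ℕ} (hN : 2 < N) (k : Fin N ⊕ Fin N → ℕ × ℕ) :
    Tendsto (fun e => greenCoeff θ μ₀ e hN k) (𝓝 0) (𝓝 (greenCoeff θ μ₀ 0 hN k)) :=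
  tendsto_greenLin μ₀ hN _

/-- The Green's function is determined by its values on basis sequences. -/
theorem greenLin_eq_tsum (μ₀ : ℝ) (e : NNReal) {N : ℕ} (hN : 2 < N)
    (a : Fin N ⊕ Fin N → Coeffs)
    (hs : Summable fun k : Fin N ⊕ Fin N → ℕ × ℕ => (∏ i, a i (k i)) * greenCoeff θ μ₀ e hN k) :
    greenLin θ μ₀ e hN a =
      ∑' k : Fin N ⊕ Fin N → ℕ × ℕ, (∏ i, a i (k i)) * greenCoeff θ μ₀ e hN k := by
  have hsingle : ∀ i n, (lp.single 1 n (a i n) : Coeffs) = a i n • lp.single 1 n (1 : ℂ) :=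
    fun i n => by rw [← lp.single_smul, smul_eq_mul, mul_one]
  have h1 : Tendsto (fun s : Finset (ℕ × ℕ) =>
      greenCLM θ μ₀ e hN fun i => ∑ n ∈ s, (lp.single 1 n (a i n) : Coeffs)) atTop
      (𝓝 (greenCLM θ μ₀ e hN a)) := by
    refine ((greenCLM θ μ₀ e hN).cont.tendsto a).comp (tendsto_pi_nhds.2 fun i => ?_)
    exact lp.hasSum_single (by norm_num) (a i)
  have h2 : ∀ s : Finset (ℕ × ℕ),
      greenCLM θ μ₀ e hN (fun i => ∑ n ∈ s, (lp.single 1 n (a i n) : Coeffs)) =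
        ∑ k ∈ Fintype.piFinset fun _ : Fin N ⊕ Fin N => s,
          (∏ i, a i (k i)) * greenCoeff θ μ₀ e hN k := by
    intro s
    show greenLin θ μ₀ e hN (fun i => ∑ n ∈ s, (lp.single 1 n (a i n) : Coeffs)) = _
    rw [(greenLin θ μ₀ e hN).map_sum_finset (fun i n => (lp.single 1 n (a i n) : Coeffs))
      fun _ => s]
    refine Finset.sum_congr rfl fun k _ => ?_
    simp only [hsingle]
    rw [MultilinearMap.map_smul_univ, smul_eq_mul, greenCoeff]
  have h3 : Tendsto (fun s : Finset (ℕ × ℕ) => Fintype.piFinset fun _ : Fin N ⊕ Fin N => s) atTop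
      atTop := by
    refine tendsto_atTop_finset_of_monotone
      (fun s t hst => Fintype.piFinset_subset _ _ fun _ => hst) fun k => ?_
    exact ⟨Finset.univ.image k, Fintype.mem_piFinset.2 fun i =>
      Finset.mem_image_of_mem _ (Finset.mem_univ _)⟩
  have h4 := hs.hasSum.comp h3
  have h5 := h1.congr h2
  exact tendsto_nhds_unique h5 h4

end

/-! ### The Bargmann transform of Schwartz functions -/

section
variable {E σ : Type*} [NormedAddCommGroup E] [NormedSpace ℝ E] [FiniteDimensional ℝ E]
  [MeasureSpace E] [BorelSpace E] [(volume : Measure E).IsAddHaarMeasure]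
  [Fintype σ] [DecidableEq σ]

/-- The kernel of the Bargmann transform, for a space `E` with coordinate functions `X s`. -/
noncomputable def btKernel (ω : ℝ) (X : σ → E →L[ℝ] ℝ) (z : σ → ℂ) (x : E) : ℂ :=
  Complex.exp (∑ s, (-((ω : ℂ) / 2) * ((X s x : ℂ) ^ 2 + z s ^ 2) +
    (Real.sqrt 2 : ℂ) * (ω : ℂ) * (z s * (X s x : ℂ))))

/-- The Bargmann transform without its normalization factor. -/
noncomputable def bt (ω : ℝ) (X : σ → E →L[ℝ] ℝ) (f : E → ℂ) (z : σ → ℂ) : ℂ :=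
  ∫ x, btKernel ω X z x * f x

/-- The creation operator `(x_s - ∂_s/ω)/√2`, which the Bargmann transform turns into
multiplication by `z_s`. -/
noncomputable def creation (ω : ℝ) (X : σ → E →L[ℝ] ℝ) (v : σ → E) (s : σ) :
    𝓢(E, ℂ) →L[ℂ] 𝓢(E, ℂ) :=
  (1 / (Real.sqrt 2 : ℂ)) • (SchwartzMap.smulLeftCLM ℂ (fun x => (X s x : ℂ)) -
    (1 / (ω : ℂ)) • LineDeriv.lineDerivOpCLM ℂ 𝓢(E, ℂ) (v s))

theorem hasTemperateGrowth_coord (X : σ → E →L[ℝ] ℝ) (s : σ) :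
    Function.HasTemperateGrowth fun x => (X s x : ℂ) :=
  (Complex.ofRealCLM ∘L X s).hasTemperateGrowth

theorem creation_apply (ω : ℝ) (X : σ → E →L[ℝ] ℝ) (v : σ → E) (s : σ) (f : 𝓢(E, ℂ)) (x : E) :
    creation ω X v s f x =
      1 / (Real.sqrt 2 : ℂ) * ((X s x : ℂ) * f x - 1 / (ω : ℂ) * fderiv ℝ f x (v s)) := by
  show (1 / (Real.sqrt 2 : ℂ)) * ((SchwartzMap.smulLeftCLM ℂ (fun x => (X s x : ℂ)) f) x -
    (1 / (ω : ℂ)) * fderiv ℝ f x (v s)) = _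
  rw [SchwartzMap.smulLeftCLM_apply_apply (hasTemperateGrowth_coord X s), smul_eq_mul]

theorem norm_btKernel_le {ω : ℝ} (hω : 0 < ω) (X : σ → E →L[ℝ] ℝ) (z : σ → ℂ) (x : E) :
    ‖btKernel ω X z x‖ ≤ Real.exp (ω / 2 * ∑ s, ‖z s‖ ^ 2) := by
  rw [btKernel, Complex.norm_exp, Real.exp_le_exp, Complex.re_sum, Finset.mul_sum]
  refine Finset.sum_le_sum fun s _ => ?_
  have h1 : (-((ω : ℂ) / 2) * ((X s x : ℂ) ^ 2 + z s ^ 2) +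
      (Real.sqrt 2 : ℂ) * (ω : ℂ) * (z s * (X s x : ℂ))).re =
      -(ω / 2) * (X s x ^ 2 + ((z s).re ^ 2 - (z s).im ^ 2)) +
        Real.sqrt 2 * ω * ((z s).re * X s x) := by
    simp [pow_two]
  have h2 : ‖z s‖ ^ 2 = (z s).re ^ 2 + (z s).im ^ 2 := by
    rw [← Complex.normSq_eq_norm_sq, Complex.normSq_apply]; ring
  rw [h1, h2]
  have h3 : Real.sqrt 2 ^ 2 = 2 := Real.sq_sqrt (by norm_num)
  have h4 : (X s x - Real.sqrt 2 * (z s).re) ^ 2 =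
      X s x ^ 2 - 2 * Real.sqrt 2 * (z s).re * X s x + 2 * (z s).re ^ 2 := by
    rw [sub_sq, mul_pow, h3]; ring
  have h5 := mul_nonneg hω.le (sq_nonneg (X s x - Real.sqrt 2 * (z s).re))
  rw [h4] at h5
  linarith

theorem continuous_btKernel (ω : ℝ) (X : σ → E →L[ℝ] ℝ) :
    Continuous fun p : (σ → ℂ) × E => btKernel ω X p.1 p.2 := by
  unfold btKernel
  fun_prop

theorem integrable_btKernel_mul {ω : ℝ} (hω : 0 < ω) (X : σ → E →L[ℝ] ℝ) (z : σ → ℂ)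
    (f : 𝓢(E, ℂ)) : Integrable fun x => btKernel ω X z x * f x :=
  f.integrable.bdd_mul (Continuous.aestronglyMeasurable (by unfold btKernel; fun_prop))
    (ae_of_all _ (norm_btKernel_le hω X z))

theorem norm_bt_le {ω : ℝ} (hω : 0 < ω) (X : σ → E →L[ℝ] ℝ) (z : σ → ℂ) (f : 𝓢(E, ℂ)) :
    ‖bt ω X f z‖ ≤ (∫ x, ‖f x‖) * Real.exp (ω / 2 * ∑ s, ‖z s‖ ^ 2) := by
  rw [mul_comm, ← integral_const_mul]
  refine norm_integral_le_of_norm_le (f.integrable.norm.const_mul _) (ae_of_all _ fun x => ?_)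
  rw [norm_mul]
  exact mul_le_mul_of_nonneg_right (norm_btKernel_le hω X z x) (norm_nonneg _)

theorem hasFDerivAt_btKernel (ω : ℝ) (X : σ → E →L[ℝ] ℝ) (z : σ → ℂ) (x : E) :
    HasFDerivAt (btKernel ω X z) (btKernel ω X z x •
      ∑ s, (-(ω : ℂ) * (X s x : ℂ) + (Real.sqrt 2 : ℂ) * (ω : ℂ) * z s) •
        (Complex.ofRealCLM ∘L X s)) x := by
  refine HasFDerivAt.cexp (HasFDerivAt.fun_sum fun s _ => ?_)
  have hX : HasFDerivAt (fun x => (X s x : ℂ)) (Complex.ofRealCLM ∘L X s) x :=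
    (Complex.ofRealCLM ∘L X s).hasFDerivAt
  have h1 := (((hX.pow 2).add_const (z s ^ 2)).const_mul (-((ω : ℂ) / 2))).add
    ((hX.const_mul (z s)).const_mul ((Real.sqrt 2 : ℂ) * (ω : ℂ)))
  refine h1.congr_fderiv ?_
  ext y
  simp
  ring

theorem fderiv_btKernel_apply (ω : ℝ) (X : σ → E →L[ℝ] ℝ) {v : σ → E}
    (hXv : ∀ s t, X s (v t) = if s = t then 1 else 0) (z : σ → ℂ) (x : E) (t : σ) :
    fderiv ℝ (btKernel ω X z) x (v t) =
      btKernel ω X z x * (-(ω : ℂ) * (X t x : ℂ) + (Real.sqrt 2 : ℂ) * (ω : ℂ) * z t) := by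
  rw [(hasFDerivAt_btKernel ω X z x).fderiv, smul_apply,
    sum_apply, Finset.sum_eq_single t]
  · simp [hXv]
  · intro s _ hs
    simp [hXv, hs]
  · simp

/-- The Bargmann transform intertwines creation and multiplication. -/
theorem mul_bt_eq_bt_creation {ω : ℝ} (hω : 0 < ω) (X : σ → E →L[ℝ] ℝ) {v : σ → E}
    (hXv : ∀ s t, X s (v t) = if s = t then 1 else 0) (z : σ → ℂ) (t : σ) (f : 𝓢(E, ℂ)) :
    z t * bt ω X f z = bt ω X (creation ω X v t f) z := by
  set K := btKernel ω X z with hK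
  set Xf : 𝓢(E, ℂ) := SchwartzMap.smulLeftCLM ℂ (fun x => (X t x : ℂ)) f with hXf
  have hXf' : ∀ x, Xf x = (X t x : ℂ) * f x := fun x => by
    rw [hXf, SchwartzMap.smulLeftCLM_apply_apply (hasTemperateGrowth_coord X t), smul_eq_mul]
  set Df : 𝓢(E, ℂ) := LineDeriv.lineDerivOpCLM ℂ 𝓢(E, ℂ) (v t) f with hDf
  have hDf' : ∀ x, Df x = fderiv ℝ f x (v t) := fun x => rfl
  have i1 := integrable_btKernel_mul hω X z f
  have i2 := integrable_btKernel_mul hω X z Xf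
  have i3 := integrable_btKernel_mul hω X z Df
  have hd : ∀ x, fderiv ℝ K x (v t) * f x =
      -(ω : ℂ) * (K x * Xf x) + (Real.sqrt 2 : ℂ) * (ω : ℂ) * z t * (K x * f x) := fun x => by
    rw [fderiv_btKernel_apply ω X hXv, hXf']; ring
  have i4 : Integrable fun x => fderiv ℝ K x (v t) * f x := by
    simp only [hd]
    exact (i2.const_mul _).add (i1.const_mul _)
  have hparts := integral_mul_fderiv_eq_neg_fderiv_mul_of_integrable (μ := volume) (f := K)
    (g := f) (v := v t) i4 i3 i1 (fun x _ => (hasFDerivAt_btKernel ω X z x).differentiableAt)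
    (fun x _ => f.differentiableAt)
  simp only [hd] at hparts
  rw [integral_add (i2.const_mul _) (i1.const_mul _), integral_const_mul, integral_const_mul]
    at hparts
  have hc : bt ω X (creation ω X v t f) z = 1 / (Real.sqrt 2 : ℂ) *
      ((∫ x, K x * Xf x) - 1 / (ω : ℂ) * ∫ x, K x * Df x) := by
    rw [← integral_const_mul, ← integral_sub i2 (i3.const_mul _), ← integral_const_mul, bt]
    refine integral_congr_ae (ae_of_all _ fun x => ?_)
    simp only [creation_apply, hXf', hDf', ← hK]
    ring
  have h2 : (Real.sqrt 2 : ℂ) ≠ 0 := by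
    rw [Complex.ofReal_ne_zero]; positivity
  have hω' : (ω : ℂ) ≠ 0 := by exact_mod_cast hω.ne'
  have hparts' : (∫ x, K x * Df x) = _ := hparts
  rw [hc, hparts', bt]
  field_simp
  ring

/-- The seminorms that control the decay of the Bargmann transform. -/
noncomputable def btBound (ω : ℝ) (X : σ → E →L[ℝ] ℝ) (v : σ → E) : List σ → 𝓢(E, ℂ) → ℝ
  | [], f => ∫ x, ‖f x‖
  | s :: l, f => btBound ω X v l f + btBound ω X v l (creation ω X v s f)

theorem continuous_integral_norm : Continuous fun f : 𝓢(E, ℂ) => ∫ x, ‖f x‖ := by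
  have h : (fun f : 𝓢(E, ℂ) => ∫ x, ‖f x‖) =
      fun f => ‖SchwartzMap.toLpCLM ℂ ℂ 1 volume f‖ := by
    funext f
    rw [SchwartzMap.toLpCLM_apply, SchwartzMap.norm_toLp_one]
  rw [h]
  exact continuous_norm.comp (SchwartzMap.toLpCLM ℂ ℂ 1 volume).continuous

theorem continuous_btBound (ω : ℝ) (X : σ → E →L[ℝ] ℝ) (v : σ → E) (l : List σ) :
    Continuous (btBound ω X v l) := by
  induction l with
  | nil => exact continuous_integral_norm
  | cons s l ih => exact ih.add (ih.comp (creation ω X v s).continuous)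

theorem btBound_zero (ω : ℝ) (X : σ → E →L[ℝ] ℝ) (v : σ → E) (l : List σ) :
    btBound ω X v l 0 = 0 := by
  induction l with
  | nil =>
    show ∫ x, ‖(0 : 𝓢(E, ℂ)) x‖ = 0
    simp
  | cons s l ih =>
    show btBound ω X v l 0 + btBound ω X v l (creation ω X v s 0) = 0
    rw [map_zero, ih, add_zero]

/-- Every factor `1 + ‖z s‖` costs one application of a creation operator. -/
theorem prod_mul_norm_bt_le {ω : ℝ} (hω : 0 < ω) (X : σ → E →L[ℝ] ℝ) {v : σ → E}
    (hXv : ∀ s t, X s (v t) = if s = t then 1 else 0) (z : σ → ℂ) (l : List σ) (f : 𝓢(E, ℂ)) :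
    (l.map fun s => 1 + ‖z s‖).prod * ‖bt ω X f z‖ ≤
      btBound ω X v l f * Real.exp (ω / 2 * ∑ s, ‖z s‖ ^ 2) := by
  induction l generalizing f with
  | nil => simpa [btBound] using norm_bt_le hω X z f
  | cons s l ih =>
    rw [List.map_cons, List.prod_cons]
    calc (1 + ‖z s‖) * (l.map fun s => 1 + ‖z s‖).prod * ‖bt ω X f z‖
        = (l.map fun s => 1 + ‖z s‖).prod * ‖bt ω X f z‖ +
          (l.map fun s => 1 + ‖z s‖).prod * ‖bt ω X (creation ω X v s f) z‖ := by
          rw [← mul_bt_eq_bt_creation hω X hXv, norm_mul]; ring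
      _ ≤ _ := add_le_add (ih f) (ih _)
      _ = _ := (add_mul _ _ _).symm

/-- The list in which every coordinate occurs `m` times. -/
noncomputable def btList (σ : Type*) [Fintype σ] (m : ℕ) : List σ :=
  (List.replicate m (Finset.univ : Finset σ).toList).flatten

theorem prod_map_btList (m : ℕ) (g : σ → ℝ) :
    ((btList σ m).map g).prod = (∏ s, g s) ^ m := by
  rw [btList, List.map_flatten, List.prod_flatten, List.map_map, List.map_replicate,
    List.prod_replicate, Function.comp_apply, Finset.prod_map_toList]

/-- The Bargmann transform of a Schwartz function decays rapidly in all directions. -/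
theorem norm_bt_le_div {ω : ℝ} (hω : 0 < ω) (X : σ → E →L[ℝ] ℝ) {v : σ → E}
    (hXv : ∀ s t, X s (v t) = if s = t then 1 else 0) (z : σ → ℂ) (m : ℕ) (f : 𝓢(E, ℂ)) :
    ‖bt ω X f z‖ ≤ btBound ω X v (btList σ m) f *
      ∏ s, (Real.exp (ω / 2 * ‖z s‖ ^ 2) / (1 + ‖z s‖) ^ m) := by
  have h := prod_mul_norm_bt_le hω X hXv z (btList σ m) f
  have hp : 0 < ∏ s, (1 + ‖z s‖) := Finset.prod_pos fun s _ => by positivity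
  rw [prod_map_btList, ← le_div_iff₀' (by positivity)] at h
  refine h.trans (le_of_eq ?_)
  rw [Finset.prod_div_distrib, ← Real.exp_sum, ← Finset.mul_sum, Finset.prod_pow]
  ring

theorem stronglyMeasurable_bt (ω : ℝ) (X : σ → E →L[ℝ] ℝ) (f : 𝓢(E, ℂ)) :
    StronglyMeasurable (bt ω X f) := by
  have h : Continuous fun p : (σ → ℂ) × E => btKernel ω X p.1 p.2 * f p.2 :=
    (continuous_btKernel ω X).mul (f.continuous.comp continuous_snd)
  exact StronglyMeasurable.integral_prod_right (f := fun z x => btKernel ω X z x * f x)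
    h.stronglyMeasurable

theorem bt_add {ω : ℝ} (hω : 0 < ω) (X : σ → E →L[ℝ] ℝ) (f g : 𝓢(E, ℂ)) (z : σ → ℂ) :
    bt ω X (f + g : 𝓢(E, ℂ)) z = bt ω X f z + bt ω X g z := by
  rw [bt, bt, bt, ← integral_add (integrable_btKernel_mul hω X z f)
    (integrable_btKernel_mul hω X z g)]
  exact integral_congr_ae (ae_of_all _ fun x => mul_add _ _ _)

theorem bt_smul (ω : ℝ) (X : σ → E →L[ℝ] ℝ) (c : ℂ) (f : 𝓢(E, ℂ)) (z : σ → ℂ) :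
    bt ω X (c • f : 𝓢(E, ℂ)) z = c * bt ω X f z := by
  rw [bt, bt, ← integral_const_mul]
  exact integral_congr_ae (ae_of_all _ fun x => mul_left_comm _ _ _)

end

/-! ### Coefficients of rapidly decaying functions -/

section
variable {θ : ℝ} [hθ : Fact (0 < θ)]

/-- A bound for the growth of the Bargmann transforms of Schwartz functions. Of the `47` inverse
powers in each variable, `44` provide the decay of order `22` in the degree of the monomials, of
which `20` compensate `basisWeight` and `2` are left for summability, and the remaining `3` make the
integrals over the plane converge. -/
noncomputable def btWeight (θ : ℝ) (z : Fin 2 → ℂ) : ℝ :=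
  ∏ j, (Real.exp (freq θ / 2 * ‖z j‖ ^ 2) / (1 + ‖z j‖) ^ 47)

theorem btWeight_nonneg (z : Fin 2 → ℂ) : 0 ≤ btWeight θ z :=
  Finset.prod_nonneg fun _ _ => by positivity

theorem integrable_inv_one_add_norm_pow_three :
    Integrable fun w : ℂ => 1 / (1 + ‖w‖) ^ 3 := by
  have h : (Module.finrank ℝ ℂ : ℝ) < 3 := by rw [Complex.finrank_real_complex]; norm_num
  refine (integrable_one_add_norm (μ := volume) h).congr (ae_of_all _ fun w => ?_)
  show (1 + ‖w‖) ^ (-3 : ℝ) = _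
  rw [Real.rpow_neg (by positivity), ← one_div]
  norm_cast

/-- The Gaussian weighted modulus of a monomial in one variable against `btWeight`. -/
noncomputable def coeffDensity₁ (θ : ℝ) (n : ℕ) (w : ℂ) : ℝ :=
  freq θ / Real.pi * (gMono θ n w / (1 + ‖w‖) ^ 47)

theorem coeffDensity₁_nonneg (n : ℕ) (w : ℂ) : 0 ≤ coeffDensity₁ θ n w := by
  have := gMono_nonneg (θ := θ) n w
  have := freq_pos θ
  have := Real.pi_pos
  unfold coeffDensity₁; positivity

theorem exists_coeffDensity₁_le (θ : ℝ) [hθ : Fact (0 < θ)] : ∃ C : ℝ, 0 < C ∧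
    ∀ n w, coeffDensity₁ θ n w ≤ C / (n + 1) ^ 22 * (1 / (1 + ‖w‖) ^ 3) := by
  obtain ⟨C, hC, h⟩ := exists_gMono_le θ 22
  have hω := freq_pos θ
  have hpi := Real.pi_pos
  refine ⟨freq θ / Real.pi * C, by positivity, fun n w => ?_⟩
  have h1 := h n w
  unfold coeffDensity₁
  calc _ ≤ freq θ / Real.pi * (C / (n + 1) ^ 22 * (1 + ‖w‖) ^ (2 * 22) / (1 + ‖w‖) ^ 47) := by
        gcongr
    _ = _ := by
        have : (1 + ‖w‖) ^ 47 = (1 + ‖w‖) ^ (2 * 22) * (1 + ‖w‖) ^ 3 := by ring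
        rw [this]; field_simp

theorem integrable_coeffDensity₁ (n : ℕ) : Integrable (coeffDensity₁ θ n) := by
  obtain ⟨C, hC, h⟩ := exists_coeffDensity₁_le θ
  refine (integrable_inv_one_add_norm_pow_three.const_mul (C / (n + 1) ^ 22)).mono' ?_
    (ae_of_all _ fun w => ?_)
  · have h1 := continuous_gMono (θ := θ) n
    have h2 : ∀ w : ℂ, (1 + ‖w‖) ^ 47 ≠ 0 := fun w => by positivity
    refine Continuous.aestronglyMeasurable ?_
    unfold coeffDensity₁
    exact (h1.div (by fun_prop) h2).const_mul _
  · rw [Real.norm_of_nonneg (coeffDensity₁_nonneg n w)]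
    exact h n w

theorem gaussDensity_mul_mono_btWeight (n : ℕ × ℕ) (z : Fin 2 → ℂ) :
    gaussDensity θ z * (‖mono θ n z‖ * btWeight θ z) =
      ∏ j, coeffDensity₁ θ (![n.1, n.2] j) (z j) := by
  have key : ∀ (k : ℕ) (w : ℂ), freq θ / Real.pi * Real.exp (-(freq θ) * ‖w‖ ^ 2) *
      (‖mono₁ θ k w‖ * (Real.exp (freq θ / 2 * ‖w‖ ^ 2) / (1 + ‖w‖) ^ 47)) =
      coeffDensity₁ θ k w := fun k w => by
    have : Real.exp (-(freq θ) * ‖w‖ ^ 2) * Real.exp (freq θ / 2 * ‖w‖ ^ 2) =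
        Real.exp (-(freq θ / 2 * ‖w‖ ^ 2)) := by rw [← Real.exp_add]; congr 1; ring
    rw [coeffDensity₁, gMono, ← this]; ring
  rw [gaussDensity_eq_prod, btWeight, mono, norm_mul, Fin.prod_univ_two, Fin.prod_univ_two,
    Fin.prod_univ_two]
  show _ = coeffDensity₁ θ n.1 (z 0) * coeffDensity₁ θ n.2 (z 1)
  rw [← key, ← key]; ring

theorem integrable_mono_btWeight (n : ℕ × ℕ) :
    Integrable (fun z => ‖mono θ n z‖ * btWeight θ z) (gaussMeasure θ) := by
  rw [integrable_gaussMeasure_iff]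
  simp only [smul_eq_mul, gaussDensity_mul_mono_btWeight]
  exact Integrable.fintype_prod (f := fun j => coeffDensity₁ θ (![n.1, n.2] j))
    fun j => integrable_coeffDensity₁ _

/-- The bound for the coefficients of a function that is dominated by `btWeight`. -/
noncomputable def coeffWeight (θ : ℝ) (n : ℕ × ℕ) : ℝ :=
  ∫ z, ‖mono θ n z‖ * btWeight θ z ∂gaussMeasure θ

theorem coeffWeight_nonneg (n : ℕ × ℕ) : 0 ≤ coeffWeight θ n :=
  integral_nonneg fun z => mul_nonneg (norm_nonneg _) (btWeight_nonneg z)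

theorem exists_coeffWeight_le (θ : ℝ) [hθ : Fact (0 < θ)] : ∃ C : ℝ, 0 < C ∧
    ∀ n : ℕ × ℕ, coeffWeight θ n ≤ C / ((n.1 + 1) ^ 22 * (n.2 + 1) ^ 22) := by
  obtain ⟨C, hC, h⟩ := exists_coeffDensity₁_le θ
  set I₃ := ∫ w : ℂ, 1 / (1 + ‖w‖) ^ 3 with hI
  have hI0 : 0 ≤ I₃ := integral_nonneg fun _ => by positivity
  have h1 : ∀ k, ∫ w, coeffDensity₁ θ k w ≤ C * (I₃ + 1) / (k + 1) ^ 22 := fun k => by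
    calc _ ≤ ∫ w : ℂ, C / (k + 1) ^ 22 * (1 / (1 + ‖w‖) ^ 3) :=
          integral_mono (integrable_coeffDensity₁ k)
            (integrable_inv_one_add_norm_pow_three.const_mul _) (h k)
      _ = C / (k + 1) ^ 22 * I₃ := integral_const_mul _ _
      _ ≤ C / (k + 1) ^ 22 * (I₃ + 1) := by gcongr; linarith
      _ = _ := by ring
  refine ⟨(C * (I₃ + 1)) ^ 2, by positivity, fun n => ?_⟩
  rw [coeffWeight, integral_gaussMeasure]
  simp only [smul_eq_mul, gaussDensity_mul_mono_btWeight]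
  rw [integral_fintype_prod_volume_eq_prod (fun j => coeffDensity₁ θ (![n.1, n.2] j)),
    Fin.prod_univ_two]
  calc (∫ w, coeffDensity₁ θ n.1 w) * ∫ w, coeffDensity₁ θ n.2 w
      ≤ C * (I₃ + 1) / (n.1 + 1) ^ 22 * (C * (I₃ + 1) / (n.2 + 1) ^ 22) := by
        refine mul_le_mul (h1 _) (h1 _) (integral_nonneg (coeffDensity₁_nonneg _)) (by positivity)
    _ = _ := by field_simp

theorem summable_basisWeight_mul_coeffWeight :
    Summable fun n => basisWeight θ n * coeffWeight θ n := by
  obtain ⟨C, hC, h⟩ := exists_coeffWeight_le θ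
  have hs : Summable fun k : ℕ => 1 / ((k : ℝ) + 1) ^ 2 := by
    have h1 := (summable_nat_add_iff 1).2 (Real.summable_one_div_nat_pow.2 one_lt_two)
    refine h1.congr fun k => ?_
    push_cast; rfl
  obtain ⟨f, hf⟩ : ∃ f : ℕ → ℝ, ∀ k, f k = 1 / ((k : ℝ) + 1) ^ 2 := ⟨_, fun _ => rfl⟩
  have hfs : Summable f := hs.congr fun k => (hf k).symm
  have hf0 : ∀ k, 0 ≤ f k := fun k => by rw [hf]; positivity
  refine Summable.of_nonneg_of_le (fun n => mul_nonneg (basisWeight_pos n).le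
    (coeffWeight_nonneg n)) (fun n => ?_)
    ((summable_mul_prod hfs hfs hf0 hf0).mul_left (basisConst θ ^ 2 * C))
  have hb := (one_le_basisConst θ)
  rw [basisWeight, hf, hf]
  calc _ ≤ basisConst θ ^ 2 * ((n.1 + 1) ^ 20 * (n.2 + 1) ^ 20) *
        (C / ((n.1 + 1) ^ 22 * (n.2 + 1) ^ 22)) := by gcongr; exact h n
    _ = _ := by
      have e1 : ((n.1 : ℝ) + 1) ^ 22 = (n.1 + 1) ^ 20 * (n.1 + 1) ^ 2 := by ring
      have e2 : ((n.2 : ℝ) + 1) ^ 22 = (n.2 + 1) ^ 20 * (n.2 + 1) ^ 2 := by ring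
      rw [e1, e2]; field_simp

/-! ### The smooth Heisenberg module -/

/-- The coordinate functions of the plane. -/
def coord (i : Fin 2) : (Fin 2 → ℝ) →L[ℝ] ℝ := ContinuousLinearMap.proj i

theorem coord_single (s t : Fin 2) :
    coord s (Pi.single t 1) = if s = t then 1 else 0 := by
  simp [coord, Pi.single_apply]

/-- The normalization of the Bargmann transform. -/
noncomputable def btNorm (θ : ℝ) : ℝ := Real.sqrt (freq θ / Real.pi)

theorem btNorm_nonneg : 0 ≤ btNorm θ := Real.sqrt_nonneg _

theorem bargmann_eq_ofFun (f : (Fin 2 → ℝ) → ℂ) :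
    bargmann θ f = ofFun θ fun z => (btNorm θ : ℂ) * bt (freq θ) coord f z := by
  rw [bargmann]
  congr 1
  funext z
  rw [btNorm, bt]
  congr 1
  refine integral_congr_ae (ae_of_all _ fun x => ?_)
  show _ = btKernel (freq θ) coord z x * f x
  rw [btKernel, Finset.sum_add_distrib, ← Finset.mul_sum, ← Finset.mul_sum]
  rfl

theorem differentiable_bt_coord (f : 𝓢(Fin 2 → ℝ, ℂ)) :
    Differentiable ℂ (bt (freq θ) coord f) := by
  have hω := freq_pos θ
  set l : (Fin 2 → ℝ) → Fin 2 → ℂ :=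
    fun x i => (Real.sqrt 2 : ℂ) * (freq θ : ℂ) * (x i : ℂ) with hl
  set h : (Fin 2 → ℝ) → ℂ :=
    fun x => Complex.exp (∑ i, -((freq θ : ℂ) / 2) * (x i : ℂ) ^ 2) * f x with hh
  have hlc : Continuous l := by rw [hl]; fun_prop
  have hhc : Continuous h := by
    have := f.continuous
    rw [hh]; fun_prop
  have hint : ∀ R : ℝ, Integrable (fun x => Real.exp (R * ‖l x‖) * ‖h x‖) := by
    intro R
    refine (f.integrable.norm.const_mul (Real.exp (freq θ * R ^ 2))).mono'
      (Continuous.aestronglyMeasurable (by fun_prop)) (ae_of_all _ fun x => ?_)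
    rw [Real.norm_of_nonneg (by positivity), hh]
    simp only [norm_mul, Complex.norm_exp, ← mul_assoc, ← Real.exp_add]
    refine mul_le_mul_of_nonneg_right (Real.exp_le_exp.2 ?_) (norm_nonneg _)
    have h1 : (∑ i, -((freq θ : ℂ) / 2) * (x i : ℂ) ^ 2).re =
        -(freq θ / 2) * ∑ i, x i ^ 2 := by
      have : (∑ i, -((freq θ : ℂ) / 2) * (x i : ℂ) ^ 2) =
          ((-(freq θ / 2) * ∑ i, x i ^ 2 : ℝ) : ℂ) := by
        push_cast; rw [Finset.mul_sum]
      rw [this, Complex.ofReal_re]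
    have h2 : ‖l x‖ ≤ Real.sqrt 2 * freq θ * ‖x‖ := by
      rw [pi_norm_le_iff_of_nonneg (by positivity)]
      intro i
      rw [hl]
      simp only [norm_mul, Complex.norm_real]
      rw [Real.norm_of_nonneg (Real.sqrt_nonneg 2), Real.norm_of_nonneg hω.le]
      gcongr
      exact norm_le_pi_norm x i
    have h3 : ‖x‖ ^ 2 ≤ ∑ i, x i ^ 2 := by
      obtain ⟨i, hi⟩ : ∃ i, ‖x‖ = ‖x i‖ := by
        obtain ⟨i, -, hi⟩ := Finset.exists_mem_eq_sup' (Finset.univ_nonempty (α := Fin 2))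
          (fun i => ‖x i‖₊)
        refine ⟨i, ?_⟩
        rw [Pi.norm_def, ← Finset.sup'_eq_sup Finset.univ_nonempty, hi]; rfl
      rw [hi, Real.norm_eq_abs, sq_abs]
      exact Finset.single_le_sum (f := fun i => x i ^ 2) (fun _ _ => sq_nonneg _)
        (Finset.mem_univ i)
    have h4 : R * ‖l x‖ ≤ |R| * (Real.sqrt 2 * freq θ * ‖x‖) :=
      (mul_le_mul_of_nonneg_right (le_abs_self R) (norm_nonneg _)).trans
        (mul_le_mul_of_nonneg_left h2 (abs_nonneg R))
    -- completing the square gives the exponent `ωR²` in the bound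
    have h5 : (‖x‖ - Real.sqrt 2 * |R|) ^ 2 = ‖x‖ ^ 2 - 2 * Real.sqrt 2 * |R| * ‖x‖ + 2 * R ^ 2 := by
      rw [sub_sq, mul_pow, Real.sq_sqrt (by norm_num), sq_abs]; ring
    have h6 := mul_nonneg hω.le (sq_nonneg (‖x‖ - Real.sqrt 2 * |R|))
    rw [h5] at h6
    have h7 := mul_le_mul_of_nonneg_left h3 hω.le
    rw [h1]
    linarith
  have hd := differentiable_integral_exp (ν := (volume : Measure (Fin 2 → ℝ))) hlc.measurable
    hhc.aestronglyMeasurable hint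
  have heq : bt (freq θ) coord f = fun z => Complex.exp (∑ i, -((freq θ : ℂ) / 2) * z i ^ 2) *
      ∫ x, Complex.exp (∑ i, z i * l x i) * h x := by
    funext z
    rw [bt, ← integral_const_mul]
    refine integral_congr_ae (ae_of_all _ fun x => ?_)
    simp only [hh, ← mul_assoc, ← Complex.exp_add, ← Finset.sum_add_distrib, btKernel, hl, coord,
      ContinuousLinearMap.proj_apply]
    congr 2
    refine Finset.sum_congr rfl fun i _ => ?_
    ring
  rw [heq]
  refine Differentiable.mul ?_ hd
  fun_prop

/-- The seminorm that controls the growth of the Bargmann transform on the plane. -/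
noncomputable def planeBound (θ : ℝ) (f : 𝓢(Fin 2 → ℝ, ℂ)) : ℝ :=
  btBound (freq θ) coord (fun i => Pi.single i 1) (btList (Fin 2) 47) f

theorem norm_bt_coord_le (f : 𝓢(Fin 2 → ℝ, ℂ)) (z : Fin 2 → ℂ) :
    ‖bt (freq θ) coord f z‖ ≤ planeBound θ f * btWeight θ z :=
  norm_bt_le_div (freq_pos θ) coord coord_single z 47 f

theorem memLp_of_norm_le_btWeight {g : (Fin 2 → ℂ) → ℂ} (hg : Continuous g) {C : ℝ}
    (h : ∀ z, ‖g z‖ ≤ C * btWeight θ z) : MemLp g 2 (gaussMeasure θ) := by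
  rw [memLp_gaussMeasure_iff hg]
  have hint : Integrable fun z : Fin 2 → ℂ => C ^ 2 * ∏ j, (1 / (1 + ‖z j‖) ^ 3) :=
    (Integrable.fintype_prod (f := fun (_ : Fin 2) (w : ℂ) => 1 / (1 + ‖w‖) ^ 3)
      fun _ => integrable_inv_one_add_norm_pow_three).const_mul _
  have hgc : Continuous fun z => ‖gauged θ g z‖ ^ 2 := by
    have := continuous_sqNorm
    unfold gauged; fun_prop
  refine hint.mono' hgc.aestronglyMeasurable (ae_of_all _ fun z => ?_)
  rw [Real.norm_of_nonneg (by positivity)]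
  have h1 : ‖gauged θ g z‖ ≤ C * ∏ j, (1 / (1 + ‖z j‖) ^ 47) := by
    rw [norm_gauged]
    calc _ ≤ (C * btWeight θ z) * Real.exp (-(freq θ / 2 * sqNorm z)) := by
          rw [mul_comm]
          exact mul_le_mul_of_nonneg_right (h z) (Real.exp_pos _).le
      _ = _ := by
          rw [btWeight, sqNorm, Fin.prod_univ_two, Fin.prod_univ_two, Fin.sum_univ_two, mul_add,
            neg_add, Real.exp_add, Real.exp_neg, Real.exp_neg]
          field_simp
  calc ‖gauged θ g z‖ ^ 2 ≤ (C * ∏ j, (1 / (1 + ‖z j‖) ^ 47)) ^ 2 := by gcongr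
    _ = C ^ 2 * ∏ j, ((1 / (1 + ‖z j‖) ^ 47) ^ 2) := by rw [mul_pow, Finset.prod_pow]
    _ ≤ _ := by
      refine mul_le_mul_of_nonneg_left ?_ (sq_nonneg C)
      refine Finset.prod_le_prod (fun _ _ => by positivity) fun j _ => ?_
      rw [div_pow, one_pow, ← pow_mul]
      gcongr
      · linarith [norm_nonneg (z j)]
      · norm_num

theorem toFun_bargmann (f : 𝓢(Fin 2 → ℝ, ℂ)) :
    toFun (bargmann θ f) = fun z => (btNorm θ : ℂ) * bt (freq θ) coord f z := by
  have hd := differentiable_bt_coord (θ := θ) f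
  rw [bargmann_eq_ofFun]
  refine toFun_ofFun (hd.const_mul _) ?_
  exact (memLp_of_norm_le_btWeight hd.continuous (norm_bt_coord_le f)).const_mul _

theorem inner_monomialState_bargmann (n : ℕ × ℕ) (f : 𝓢(Fin 2 → ℝ, ℂ)) :
    ⟪monomialState θ n, bargmann θ f⟫_ℂ = btNorm θ *
      ∫ z, conj (mono θ n z) * bt (freq θ) coord f z ∂gaussMeasure θ := by
  rw [inner_eq_integral, toFun_monomialState, toFun_bargmann, ← integral_const_mul]
  exact integral_congr_ae (ae_of_all _ fun z => mul_left_comm _ _ _)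

theorem norm_inner_monomialState_bargmann_le (n : ℕ × ℕ) (f : 𝓢(Fin 2 → ℝ, ℂ)) :
    ‖⟪monomialState θ n, bargmann θ f⟫_ℂ‖ ≤ btNorm θ * planeBound θ f * coeffWeight θ n := by
  rw [inner_monomialState_bargmann, norm_mul, Complex.norm_real,
    Real.norm_of_nonneg btNorm_nonneg, mul_assoc]
  refine mul_le_mul_of_nonneg_left ?_ btNorm_nonneg
  rw [coeffWeight, ← integral_const_mul]
  refine norm_integral_le_of_norm_le ((integrable_mono_btWeight n).const_mul _)
    (ae_of_all _ fun z => ?_)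
  rw [norm_mul, RCLike.norm_conj]
  calc _ ≤ ‖mono θ n z‖ * (planeBound θ f * btWeight θ z) := by
        gcongr; exact norm_bt_coord_le f z
    _ = _ := by ring

theorem summable_basisWeight_mul_norm_inner (f : 𝓢(Fin 2 → ℝ, ℂ)) :
    Summable fun n => basisWeight θ n * ‖⟪monomialState θ n, bargmann θ f⟫_ℂ‖ := by
  refine Summable.of_nonneg_of_le (fun n => mul_nonneg (basisWeight_pos n).le (norm_nonneg _))
    (fun n => ?_) ((summable_basisWeight_mul_coeffWeight (θ := θ)).mul_left
      (btNorm θ * planeBound θ f))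
  have := mul_le_mul_of_nonneg_left (norm_inner_monomialState_bargmann_le (θ := θ) n f)
    (basisWeight_pos (θ := θ) n).le
  linarith

/-- The smooth module consists of background fields. -/
theorem exists_synth_eq_bargmann (f : 𝓢(Fin 2 → ℝ, ℂ)) : ∃ a : Coeffs,
    (∀ n, a n = basisWeight θ n * ⟪monomialState θ n, bargmann θ f⟫_ℂ) ∧
      synth θ a = bargmann θ f :=
  exists_synth_eq (summable_basisWeight_mul_norm_inner f)

theorem exists_synth_eq_J_bargmann (f : 𝓢(Fin 2 → ℝ, ℂ)) : ∃ a : Coeffs,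
    synth θ a = J (bargmann θ f) := by
  have h : Summable fun n => basisWeight θ n * ‖⟪monomialState θ n, J (bargmann θ f)⟫_ℂ‖ := by
    simpa only [inner_monomialState_J, RCLike.norm_conj] using
      summable_basisWeight_mul_norm_inner f
  obtain ⟨a, -, ha⟩ := exists_synth_eq h
  exact ⟨a, ha⟩

theorem nice_of_mem_smoothModule {φ : BargmannSpace θ} (h : φ ∈ smoothModule θ) : Nice φ := by
  obtain ⟨f, rfl⟩ := h
  obtain ⟨a, -, ha⟩ := exists_synth_eq_bargmann (θ := θ) f
  show Nice (bargmann θ f)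
  rw [← ha]
  exact nice_synth a

/-- The Bargmann transform commutes with complex conjugation. -/
theorem bargmann_conj (g : 𝓢(Fin 2 → ℝ, ℂ)) :
    bargmann θ (fun x => conj (g x)) = J (bargmann θ g) := by
  rw [bargmann_eq_ofFun]
  refine ofFun_eq ?_
  funext z
  rw [toFun_J, toFun_bargmann, map_mul, Complex.conj_ofReal, bt, bt, ← integral_conj]
  congr 1
  refine integral_congr_ae (ae_of_all _ fun x => ?_)
  simp only [map_mul, btKernel, ← Complex.exp_conj, map_sum, map_add, map_neg, map_div₀, map_pow,
    Complex.conj_ofReal, Complex.conj_conj, map_ofNat]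

end

/-! ### Coefficients of Schwartz functions of several particles -/

theorem summable_prod_of_nonneg {I α : Type*} [Fintype I] {p : α → ℝ} (hp : Summable p)
    (hp0 : ∀ n, 0 ≤ p n) : Summable fun k : I → α => ∏ i, p (k i) := by
  classical
  refine summable_of_sum_le (c := ∏ _i : I, ∑' n, p n)
    (fun k => Finset.prod_nonneg fun i _ => hp0 _) fun T => ?_
  have hsub : T ⊆ Fintype.piFinset fun i => T.image fun k => k i := fun k hk =>
    Fintype.mem_piFinset.2 fun i => Finset.mem_image_of_mem (fun k => k i) hk
  calc ∑ k ∈ T, ∏ i, p (k i)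
      ≤ ∑ k ∈ Fintype.piFinset fun i => T.image fun k => k i, ∏ i, p (k i) :=
        Finset.sum_le_sum_of_subset_of_nonneg hsub fun k _ _ =>
          Finset.prod_nonneg fun i _ => hp0 _
    _ = ∏ i, ∑ n ∈ T.image fun k => k i, p n := (Finset.prod_univ_sum _ _).symm
    _ ≤ _ := Finset.prod_le_prod (fun i _ => Finset.sum_nonneg fun n _ => hp0 n)
        fun i _ => hp.sum_le_tsum _ fun n _ => hp0 n

section
variable {θ : ℝ} [hθ : Fact (0 < θ)] {I : Type} [Fintype I] [DecidableEq I]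

/-- The coordinate functions of the configuration space of several particles in the plane. -/
noncomputable def multiCoord (s : I × Fin 2) : (I → Fin 2 → ℝ) →L[ℝ] ℝ :=
  (ContinuousLinearMap.proj s.2 : (Fin 2 → ℝ) →L[ℝ] ℝ) ∘L ContinuousLinearMap.proj s.1

theorem multiCoord_apply (s : I × Fin 2) (x : I → Fin 2 → ℝ) : multiCoord s x = x s.1 s.2 := rfl

theorem multiCoord_single (s t : I × Fin 2) :
    multiCoord s (Pi.single t.1 (Pi.single t.2 1)) = if s = t then 1 else 0 := by
  rw [multiCoord_apply, Pi.single_apply]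
  by_cases h1 : s.1 = t.1
  · rw [if_pos h1, Pi.single_apply]
    by_cases h2 : s.2 = t.2
    · rw [if_pos h2, if_pos (Prod.ext h1 h2)]
    · rw [if_neg h2, if_neg fun h => h2 (congrArg Prod.snd h)]
  · rw [if_neg h1, if_neg fun h => h1 (congrArg Prod.fst h), Pi.zero_apply]

/-- The Bargmann transform in all variables, without its normalization. -/
noncomputable def multiBt (θ : ℝ) (F : (I → Fin 2 → ℝ) → ℂ) (Z : I → Fin 2 → ℂ) : ℂ :=
  bt (freq θ) multiCoord F fun s => Z s.1 s.2

/-- The seminorm that controls the growth of `multiBt`. -/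
noncomputable def multiBound (θ : ℝ) (F : 𝓢(I → Fin 2 → ℝ, ℂ)) : ℝ :=
  btBound (freq θ) multiCoord (fun t => Pi.single t.1 (Pi.single t.2 1)) (btList (I × Fin 2) 47) F

theorem norm_multiBt_le (F : 𝓢(I → Fin 2 → ℝ, ℂ)) (Z : I → Fin 2 → ℂ) :
    ‖multiBt θ F Z‖ ≤ multiBound θ F * ∏ i, btWeight θ (Z i) := by
  have h := norm_bt_le_div (freq_pos θ) (multiCoord (I := I))
    (v := fun t => Pi.single t.1 (Pi.single t.2 1)) multiCoord_single (fun s => Z s.1 s.2) 47 F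
  rw [Fintype.prod_prod_type] at h
  exact h

/-- The Gaussian measure in all variables. -/
noncomputable def multiGauss (θ : ℝ) (I : Type) [Fintype I] : Measure (I → Fin 2 → ℂ) :=
  Measure.pi fun _ => gaussMeasure θ

theorem aestronglyMeasurable_multi (k : I → ℕ × ℕ) (F : 𝓢(I → Fin 2 → ℝ, ℂ)) :
    AEStronglyMeasurable (fun Z => (∏ i, conj (mono θ (k i) (Z i))) * multiBt θ F Z)
      (multiGauss θ I) := by
  have h1 : Continuous fun Z : I → Fin 2 → ℂ => ∏ i, conj (mono θ (k i) (Z i)) :=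
    continuous_finsetProd _ fun i _ => Complex.continuous_conj.comp
      ((differentiable_mono (k i)).continuous.comp (continuous_apply i))
  have h2 : Measurable fun (Z : I → Fin 2 → ℂ) (s : I × Fin 2) => Z s.1 s.2 :=
    measurable_pi_lambda _ fun s => (measurable_pi_apply s.2).comp (measurable_pi_apply s.1)
  have h3 := (stronglyMeasurable_bt (freq θ) (multiCoord (I := I)) F).comp_measurable h2
  have h4 : StronglyMeasurable (multiBt θ F) := h3
  exact h1.aestronglyMeasurable.mul h4.aestronglyMeasurable

theorem norm_multi_le (k : I → ℕ × ℕ) (F : 𝓢(I → Fin 2 → ℝ, ℂ)) (Z : I → Fin 2 → ℂ) :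
    ‖(∏ i, conj (mono θ (k i) (Z i))) * multiBt θ F Z‖ ≤
      multiBound θ F * ∏ i, (‖mono θ (k i) (Z i)‖ * btWeight θ (Z i)) := by
  rw [norm_mul, norm_prod, Finset.prod_mul_distrib]
  simp only [RCLike.norm_conj]
  calc _ ≤ (∏ i, ‖mono θ (k i) (Z i)‖) * (multiBound θ F * ∏ i, btWeight θ (Z i)) :=
        mul_le_mul_of_nonneg_left (norm_multiBt_le F Z)
          (Finset.prod_nonneg fun _ _ => norm_nonneg _)
    _ = _ := by ring

theorem integrable_multi_majorant (k : I → ℕ × ℕ) :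
    Integrable (fun Z => ∏ i, (‖mono θ (k i) (Z i)‖ * btWeight θ (Z i))) (multiGauss θ I) :=
  Integrable.fintype_prod (f := fun i z => ‖mono θ (k i) z‖ * btWeight θ z)
    fun i => integrable_mono_btWeight (k i)

theorem integrable_multi (k : I → ℕ × ℕ) (F : 𝓢(I → Fin 2 → ℝ, ℂ)) :
    Integrable (fun Z => (∏ i, conj (mono θ (k i) (Z i))) * multiBt θ F Z) (multiGauss θ I) :=
  ((integrable_multi_majorant k).const_mul _).mono' (aestronglyMeasurable_multi k F)
    (ae_of_all _ (norm_multi_le k F))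

/-- The coefficients of a function of several variables in the product basis. -/
noncomputable def multiCoeff (θ : ℝ) (k : I → ℕ × ℕ) (F : 𝓢(I → Fin 2 → ℝ, ℂ)) : ℂ :=
  (btNorm θ : ℂ) ^ Fintype.card I *
    ∫ Z, (∏ i, conj (mono θ (k i) (Z i))) * multiBt θ F Z ∂multiGauss θ I

/-- The weight `btWeight` is a product over the particles, and so is the bound. -/
theorem norm_multiCoeff_le (k : I → ℕ × ℕ) (F : 𝓢(I → Fin 2 → ℝ, ℂ)) :
    ‖multiCoeff θ k F‖ ≤
      btNorm θ ^ Fintype.card I * multiBound θ F * ∏ i, coeffWeight θ (k i) := by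
  rw [multiCoeff, norm_mul, norm_pow, Complex.norm_real, Real.norm_of_nonneg btNorm_nonneg,
    mul_assoc]
  refine mul_le_mul_of_nonneg_left ?_ (pow_nonneg btNorm_nonneg _)
  refine (norm_integral_le_of_norm_le ((integrable_multi_majorant k).const_mul _)
    (ae_of_all _ (norm_multi_le k F))).trans (le_of_eq ?_)
  rw [integral_const_mul, multiGauss,
    integral_fintype_prod_eq_prod (fun i z => ‖mono θ (k i) z‖ * btWeight θ z)]
  rfl

theorem multiCoeff_add (k : I → ℕ × ℕ) (F G : 𝓢(I → Fin 2 → ℝ, ℂ)) :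
    multiCoeff θ k (F + G) = multiCoeff θ k F + multiCoeff θ k G := by
  rw [multiCoeff, multiCoeff, multiCoeff, ← mul_add,
    ← integral_add (integrable_multi k F) (integrable_multi k G)]
  congr 1
  refine integral_congr_ae (ae_of_all _ fun Z => ?_)
  have h : multiBt θ (F + G : 𝓢(I → Fin 2 → ℝ, ℂ)) Z = multiBt θ F Z + multiBt θ G Z :=
    bt_add (freq_pos θ) (multiCoord (I := I)) F G fun s => Z s.1 s.2
  show _ * multiBt θ (F + G : 𝓢(I → Fin 2 → ℝ, ℂ)) Z = _
  rw [h, mul_add]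

theorem multiCoeff_smul (k : I → ℕ × ℕ) (c : ℂ) (F : 𝓢(I → Fin 2 → ℝ, ℂ)) :
    multiCoeff θ k (c • F) = c * multiCoeff θ k F := by
  rw [multiCoeff, multiCoeff, mul_left_comm c, ← integral_const_mul c]
  congr 1
  refine integral_congr_ae (ae_of_all _ fun Z => ?_)
  have h : multiBt θ (c • F : 𝓢(I → Fin 2 → ℝ, ℂ)) Z = c * multiBt θ F Z :=
    bt_smul (freq θ) (multiCoord (I := I)) c F fun s => Z s.1 s.2
  show _ * multiBt θ (c • F : 𝓢(I → Fin 2 → ℝ, ℂ)) Z = _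
  rw [h, mul_left_comm]

theorem multiBt_prod (h : I → 𝓢(Fin 2 → ℝ, ℂ)) (F : 𝓢(I → Fin 2 → ℝ, ℂ))
    (hF : ∀ x, F x = ∏ i, h i (x i)) (Z : I → Fin 2 → ℂ) :
    multiBt θ F Z = ∏ i, bt (freq θ) coord (h i) (Z i) := by
  have h1 : ∀ x : I → Fin 2 → ℝ, btKernel (freq θ) multiCoord (fun s => Z s.1 s.2) x * F x =
      ∏ i, (btKernel (freq θ) coord (Z i) (x i) * h i (x i)) := fun x => by
    rw [hF, Finset.prod_mul_distrib, btKernel, Fintype.sum_prod_type, Complex.exp_sum]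
    rfl
  rw [multiBt, bt]
  simp only [h1]
  exact integral_fintype_prod_volume_eq_prod
    (fun i (x : Fin 2 → ℝ) => btKernel (freq θ) coord (Z i) x * h i x)

/-- For a product function the coefficients are the products of the coefficients of the factors. -/
theorem multiCoeff_prod (k : I → ℕ × ℕ) (h : I → 𝓢(Fin 2 → ℝ, ℂ))
    (F : 𝓢(I → Fin 2 → ℝ, ℂ)) (hF : ∀ x, F x = ∏ i, h i (x i)) :
    multiCoeff θ k F = ∏ i, ⟪monomialState θ (k i), bargmann θ (h i)⟫_ℂ := by
  simp only [inner_monomialState_bargmann]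
  rw [multiCoeff, Finset.prod_mul_distrib, Finset.prod_const, Finset.card_univ, multiGauss,
    ← integral_fintype_prod_eq_prod (fun i z => conj (mono θ (k i) z) * bt (freq θ) coord (h i) z)]
  congr 1
  refine integral_congr_ae (ae_of_all _ fun Z => ?_)
  simp only [multiBt_prod h F hF, Finset.prod_mul_distrib]

/-- The coefficients of a Schwartz function with respect to the products of the monomials divided by
`basisWeight`, the basis that underlies `synth`. -/
noncomputable def scaledCoeff (θ : ℝ) [hθ : Fact (0 < θ)] (k : I → ℕ × ℕ)
    (F : 𝓢(I → Fin 2 → ℝ, ℂ)) : ℂ :=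
  (∏ i, (basisWeight θ (k i) : ℂ)) * multiCoeff θ k F

/-- The summable majorant of the coefficients. -/
noncomputable def multiWeight (θ : ℝ) [hθ : Fact (0 < θ)] (k : I → ℕ × ℕ) : ℝ :=
  btNorm θ ^ Fintype.card I * ∏ i, (basisWeight θ (k i) * coeffWeight θ (k i))

theorem summable_multiWeight : Summable fun k : I → ℕ × ℕ => multiWeight θ k := by
  obtain ⟨p, hp⟩ : ∃ p : ℕ × ℕ → ℝ, ∀ n, p n = basisWeight θ n * coeffWeight θ n :=
    ⟨_, fun _ => rfl⟩
  have hs : Summable p :=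
    (summable_basisWeight_mul_coeffWeight (θ := θ)).congr fun n => (hp n).symm
  have h0 : ∀ n, 0 ≤ p n := fun n => by
    rw [hp]
    exact mul_nonneg (basisWeight_pos n).le (coeffWeight_nonneg n)
  have h := (summable_prod_of_nonneg (I := I) hs h0).mul_left (btNorm θ ^ Fintype.card I)
  refine h.congr fun k => ?_
  simp only [multiWeight, hp]

theorem norm_scaledCoeff_le (k : I → ℕ × ℕ) (F : 𝓢(I → Fin 2 → ℝ, ℂ)) :
    ‖scaledCoeff θ k F‖ ≤ multiWeight θ k * multiBound θ F := by
  have h : ‖∏ i, (basisWeight θ (k i) : ℂ)‖ = ∏ i, basisWeight θ (k i) := by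
    rw [norm_prod]
    refine Finset.prod_congr rfl fun i _ => ?_
    rw [Complex.norm_real, Real.norm_of_nonneg (basisWeight_pos _).le]
  rw [scaledCoeff, norm_mul, h, multiWeight, Finset.prod_mul_distrib]
  calc _ ≤ (∏ i, basisWeight θ (k i)) *
        (btNorm θ ^ Fintype.card I * multiBound θ F * ∏ i, coeffWeight θ (k i)) :=
        mul_le_mul_of_nonneg_left (norm_multiCoeff_le k F)
          (Finset.prod_nonneg fun i _ => (basisWeight_pos _).le)
    _ = _ := by ring

theorem norm_scaledCoeff_mul_le {g : (I → ℕ × ℕ) → ℂ} {C : ℝ} (hg : ∀ k, ‖g k‖ ≤ C)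
    (F : 𝓢(I → Fin 2 → ℝ, ℂ)) (k : I → ℕ × ℕ) :
    ‖scaledCoeff θ k F * g k‖ ≤ multiWeight θ k * (multiBound θ F * C) := by
  rw [norm_mul, ← mul_assoc]
  exact mul_le_mul (norm_scaledCoeff_le k F) (hg k) (norm_nonneg _)
    ((norm_nonneg _).trans (norm_scaledCoeff_le k F))

theorem summable_scaledCoeff_mul {g : (I → ℕ × ℕ) → ℂ} {C : ℝ} (hg : ∀ k, ‖g k‖ ≤ C)
    (F : 𝓢(I → Fin 2 → ℝ, ℂ)) : Summable fun k => scaledCoeff θ k F * g k :=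
  Summable.of_norm_bounded (summable_multiWeight.mul_right _) (norm_scaledCoeff_mul_le hg F)

/-- The linear form on Schwartz functions given by a bounded array of coefficients. -/
noncomputable def distLin (θ : ℝ) [hθ : Fact (0 < θ)] {g : (I → ℕ × ℕ) → ℂ} {C : ℝ}
    (hg : ∀ k, ‖g k‖ ≤ C) : 𝓢(I → Fin 2 → ℝ, ℂ) →ₗ[ℂ] ℂ where
  toFun F := ∑' k, scaledCoeff θ k F * g k
  map_add' F G := by
    rw [← (summable_scaledCoeff_mul hg F).tsum_add (summable_scaledCoeff_mul hg G)]
    refine tsum_congr fun k => ?_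
    rw [scaledCoeff, multiCoeff_add, scaledCoeff, scaledCoeff]; ring
  map_smul' c F := by
    rw [RingHom.id_apply, smul_eq_mul, ← tsum_mul_left]
    refine tsum_congr fun k => ?_
    rw [scaledCoeff, multiCoeff_smul, scaledCoeff]; ring

theorem norm_distLin_le {g : (I → ℕ × ℕ) → ℂ} {C : ℝ} (hg : ∀ k, ‖g k‖ ≤ C)
    (F : 𝓢(I → Fin 2 → ℝ, ℂ)) :
    ‖distLin θ hg F‖ ≤ (∑' k, multiWeight θ (k : I → ℕ × ℕ)) * (multiBound θ F * C) := by
  rw [← tsum_mul_right]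
  exact tsum_of_norm_bounded (summable_multiWeight.mul_right _).hasSum
    (norm_scaledCoeff_mul_le hg F)

/-- By linearity it is enough to consider continuity at `0`, where the bound by a continuous function
that vanishes at `0` applies. -/
theorem continuous_distLin {g : (I → ℕ × ℕ) → ℂ} {C : ℝ} (hg : ∀ k, ‖g k‖ ≤ C) :
    Continuous (distLin θ hg) := by
  refine continuous_of_continuousAt_zero (distLin θ hg) ?_
  rw [ContinuousAt, map_zero]
  refine squeeze_zero_norm (norm_distLin_le hg) ?_
  have hc : Continuous (multiBound θ : 𝓢(I → Fin 2 → ℝ, ℂ) → ℝ) := continuous_btBound _ _ _ _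
  have h0 : multiBound θ (0 : 𝓢(I → Fin 2 → ℝ, ℂ)) = 0 := btBound_zero _ _ _ _
  have h1 := ((hc.mul_const C).const_mul (∑' k, multiWeight θ (k : I → ℕ × ℕ))).tendsto 0
  rwa [h0, zero_mul, mul_zero] at h1

/-- The tempered distribution given by a bounded array of coefficients. -/
noncomputable def tempDist (θ : ℝ) [hθ : Fact (0 < θ)] {g : (I → ℕ × ℕ) → ℂ} {C : ℝ}
    (hg : ∀ k, ‖g k‖ ≤ C) : 𝓢'(I → Fin 2 → ℝ, ℂ) :=
  ContinuousLinearMap.toPointwiseConvergenceCLM _ _ _ _ ⟨distLin θ hg, continuous_distLin hg⟩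

theorem tempDist_apply {g : (I → ℕ × ℕ) → ℂ} {C : ℝ} (hg : ∀ k, ‖g k‖ ≤ C)
    (F : 𝓢(I → Fin 2 → ℝ, ℂ)) : tempDist θ hg F = ∑' k, scaledCoeff θ k F * g k := rfl

theorem tendsto_tempDist {ι : Type*} {l : Filter ι} {g : ι → (I → ℕ × ℕ) → ℂ}
    {g₀ : (I → ℕ × ℕ) → ℂ} {C : ℝ} (hg : ∀ e k, ‖g e k‖ ≤ C) (hg₀ : ∀ k, ‖g₀ k‖ ≤ C)
    (h : ∀ k, Tendsto (fun e => g e k) l (𝓝 (g₀ k))) :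
    Tendsto (fun e => tempDist θ (hg e)) l (𝓝 (tempDist θ hg₀)) := by
  rw [PointwiseConvergenceCLM.tendsto_iff_forall_tendsto]
  intro F
  simp only [tempDist_apply]
  exact tendsto_tsum_of_dominated_convergence (summable_multiWeight.mul_right _)
    (fun k => (h k).const_mul _)
    (Eventually.of_forall fun e k => norm_scaledCoeff_mul_le (hg e) F k)

end

/-! ### The Green's functions as tempered distributions -/

section
variable {θ : ℝ} [hθ : Fact (0 < θ)] {N : ℕ}

theorem norm_prefactor_mul_greenCoeff_le (μ₀ lam : ℝ) (hN : 2 < N) (e : NNReal)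
    (k : Fin N ⊕ Fin N → ℕ × ℕ) :
    ‖greenPrefactor lam N * greenCoeff θ μ₀ e hN k‖ ≤
      ‖greenPrefactor lam N‖ * greenConst θ μ₀ N := by
  rw [norm_mul]
  exact mul_le_mul_of_nonneg_left (norm_greenCoeff_le μ₀ e hN k) (norm_nonneg _)

/-- The Green's function as a tempered distribution. The regularization parameter is a nonnegative
real number by its type. -/
noncomputable def greenDist (θ μ₀ lam : ℝ) [hθ : Fact (0 < θ)] (hN : 2 < N) (e : NNReal) :
    𝓢'(Fin N ⊕ Fin N → Fin 2 → ℝ, ℂ) :=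
  tempDist θ (norm_prefactor_mul_greenCoeff_le (θ := θ) μ₀ lam hN e)

theorem tendsto_greenDist (μ₀ lam : ℝ) (hN : 2 < N) :
    Tendsto (greenDist θ μ₀ lam hN) (𝓝 0) (𝓝 (greenDist θ μ₀ lam hN 0)) :=
  tendsto_tempDist (norm_prefactor_mul_greenCoeff_le μ₀ lam hN)
    (norm_prefactor_mul_greenCoeff_le μ₀ lam hN 0)
    fun k => (tendsto_greenCoeff μ₀ hN k).const_mul _

/-- On products of test functions the distribution is the Green's function of their Bargmann
transforms. -/
theorem greenDist_prod (μ₀ lam : ℝ) (hN : 2 < N) (e : NNReal) (f g : Fin N → 𝓢(Fin 2 → ℝ, ℂ))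
    (F : 𝓢(Fin N ⊕ Fin N → Fin 2 → ℝ, ℂ))
    (hF : ∀ x, F x = (∏ i, f i (x (Sum.inl i))) * ∏ j, g j (x (Sum.inr j))) :
    greenDist θ μ₀ lam hN e F = green μ₀ lam e N (fun i => bargmann θ (f i))
      (fun j => bargmann θ (fun x => conj (g j x))) := by
  obtain ⟨h, hhf, hhg⟩ : ∃ h : Fin N ⊕ Fin N → 𝓢(Fin 2 → ℝ, ℂ),
      (∀ i, h (Sum.inl i) = f i) ∧ ∀ j, h (Sum.inr j) = g j :=
    ⟨Sum.elim f g, fun _ => rfl, fun _ => rfl⟩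
  choose a ha hsyn using fun i => exists_synth_eq_bargmann (θ := θ) (h i)
  have hFh : ∀ x, F x = ∏ i, h i (x i) := fun x => by
    rw [hF, Fintype.prod_sum_type]; simp only [hhf, hhg]
  have hc : ∀ k, scaledCoeff θ k F = ∏ i, a i (k i) := fun k => by
    rw [scaledCoeff, multiCoeff_prod (θ := θ) k h F hFh, ← Finset.prod_mul_distrib]
    exact Finset.prod_congr rfl fun i _ => (ha i (k i)).symm
  have hs := summable_scaledCoeff_mul (θ := θ) (norm_greenCoeff_le (θ := θ) μ₀ e hN) F
  simp only [hc] at hs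
  have h1 : (fun i => bargmann θ (f i)) = fun i => synth θ (a (Sum.inl i)) := by
    funext i; rw [hsyn, hhf]
  have h2 : (fun j => bargmann θ (fun x => conj (g j x))) =
      fun j => J (synth θ (a (Sum.inr j))) := by
    funext j; rw [hsyn, hhg, bargmann_conj]
  rw [h1, h2, green_eq_greenLin μ₀ lam e hN a, greenLin_eq_tsum μ₀ e hN a hs, ← tsum_mul_left]
  refine (tempDist_apply _ F).trans (tsum_congr fun k => ?_)
  rw [hc, mul_left_comm]

theorem isTraceClass_of_mem_smoothModule (μ₀ : ℝ) {ε : ℝ} (hε : 0 ≤ ε) (hN : 2 < N)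
    {φ χ : BargmannSpace θ} (hφ : φ ∈ smoothModule θ) (hχ : χ ∈ smoothModule θ) :
    IsTraceClass (loopBlock μ₀ ε N φ χ) ∧ IsTraceClass (loopBlockConj μ₀ ε N φ χ) := by
  obtain ⟨f, rfl⟩ := hφ
  obtain ⟨g, rfl⟩ := hχ
  obtain ⟨a, -, ha⟩ := exists_synth_eq_bargmann (θ := θ) f
  obtain ⟨b, hb⟩ := exists_synth_eq_J_bargmann (θ := θ) g
  have hg : bargmann θ g = J (synth θ b) := by rw [hb, J_J]
  show IsTraceClass (loopBlock μ₀ ε N (bargmann θ f) (bargmann θ g)) ∧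
    IsTraceClass (loopBlockConj μ₀ ε N (bargmann θ f) (bargmann θ g))
  rw [hg, ← ha]
  exact ⟨isTraceClass_loopBlock μ₀ hε (a, b) hN, isTraceClass_loopBlockConj μ₀ hε (a, b) hN⟩

end
end HeisenbergPhi4

theorem mainTheorem3 (θ μ₀ lam : ℝ) (hθ : 0 < θ) (N : ℕ) (hN : 2 < N) :
    -- The lattice sums that define the Hessian converge, and all traces exist,
    -- with the regularized propagator as well as with the propagator itself.
    (∀ φ ∈ smoothModule θ, ∀ χ ∈ smoothModule θ, ∀ η : BargmannSpace θ,
      (Summable fun γ => pairing χ φ γ • actU η γ) ∧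
      (Summable fun γ => pairing χ η γ • actU φ γ) ∧
      (Summable fun γ => pairing η χ γ • actU φ γ)) ∧
    (∀ ε : ℝ, 0 ≤ ε → ∀ φ ∈ smoothModule θ, ∀ χ ∈ smoothModule θ,
      IsTraceClass (loopBlock μ₀ ε N φ χ) ∧ IsTraceClass (loopBlockConj μ₀ ε N φ χ)) ∧
    -- The Green's functions are tempered distributions, which converge when the regularization is
    -- removed to the Green's function built with the propagator itself.
    ∃ G : ℝ → 𝓢'(Fin N ⊕ Fin N → Fin 2 → ℝ, ℂ),
      (∀ ε : ℝ, 0 ≤ ε → ∀ (f g : Fin N → 𝓢(Fin 2 → ℝ, ℂ))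
        (F : 𝓢(Fin N ⊕ Fin N → Fin 2 → ℝ, ℂ)),
        (∀ x, F x = (∏ i, f i (x (Sum.inl i))) * ∏ j, g j (x (Sum.inr j))) →
          G ε F = green μ₀ lam ε N (fun i => bargmann θ (f i))
            (fun j => bargmann θ (fun x => conj (g j x)))) ∧
      Tendsto G (𝓝[>] 0) (𝓝 (G 0)) := by
  have : Fact (0 < θ) := ⟨hθ⟩
  refine ⟨fun φ hφ χ hχ η => ?_, fun ε hε φ hφ χ hχ =>
    isTraceClass_of_mem_smoothModule μ₀ hε hN hφ hχ,
    -- the value at negative `ε` is immaterial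
    fun ε => greenDist θ μ₀ lam hN ε.toNNReal, fun ε hε f g F hF => ?_, ?_⟩
  · have h1 := nice_of_mem_smoothModule hφ
    have h2 := nice_of_mem_smoothModule hχ
    exact ⟨summable_pairing_smul_actU h2 h1 η, summable_pairing_smul_actU_right h2 h1 η,
      summable_pairing_smul_actU_left h2 h1 η⟩
  · have h := greenDist_prod (θ := θ) μ₀ lam hN ε.toNNReal f g F hF
    rwa [Real.coe_toNNReal ε hε] at h
  · have h : Tendsto Real.toNNReal (𝓝[>] 0) (𝓝 0) := by
      have := (continuous_real_toNNReal.tendsto 0).mono_left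
        (nhdsWithin_le_nhds (s := Set.Ioi (0 : ℝ)))
      rwa [Real.toNNReal_zero] at this
    show Tendsto _ _ (𝓝 (greenDist θ μ₀ lam hN (Real.toNNReal 0)))
    rw [Real.toNNReal_zero]
    exact (tendsto_greenDist μ₀ lam hN).comp h
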